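/- Let $n\in\mathbb N$, and let $\chi,\varphi:\mathbb R^n\to[0,1]$ be smooth radial functions with $\operatorname{supp}\chi\subset B(0,4/3)$ compact, $\operatorname{supp}\varphi\subset B(0,8/3)\setminus\overline B(0,3/4)$ compact, $\chi(\xi)+\sum_{j\ge0}\varphi(2^{-j}\xi)=1$ for all $\xi$, and $\sum_{j\in\mathbb Z}\varphi(2^{-j}\xi)=1$ for all $\xi\ne0$. For $u\in\mathcal S'(\mathbb R^n)$ and $j\in\mathbb Z$ put $\dot S_ju=\chi(2^{-j}D)u$ and $\dot\Delta_ju=\varphi(2^{-j}D)u$, where $m(D)u=\mathcal F^{-1}(m\,\mathcal Fu)$ and $\mathcal Fu(\xi)=\int e^{-i\xi\cdot x}u(x)\,dx$. Let $$\|u\|_{\dot B^s_{p,q}}=\big\|j\mapsto2^{js}\|\dot\Delta_ju\|_{L^p(\mathbb R^n)}\big\|_{\ell^q(\mathbb Z)},\qquad \dot T_uw=\sum_{j\in\mathbb Z}\dot S_{j-1}u\,\dot\Delta_jw,\qquad \dot R(u,w)=\sum_{j\in\mathbb Z}\sum_{|\nu|\le1}\dot\Delta_ju\,\dot\Delta_{j-\nu}w,$$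 the last two series being taken in $\mathcal S'$. An $L^p$ norm is $\infty$ for a distribution that is not an $L^p$ function, $\|\cdot\|_{\ell^q}$ is given by the usual formula also when $q<1$, and products of norms use $0\cdot\infty=0$. For $r\ge 0$, $\dot H^r$ is the set of $u\in\mathcal S'$ such that $\mathcal Fu$ is a locally integrable function with $|\xi|^r\mathcal Fu\in L^2$. Let $v=(v_1,\dots,v_n)$ and $f$ (scalar, complex-valued) belong to $\bigcap_{r\in[0,\infty)}\dot H^r$. With summation over the repeated index $k$ and $[A,B]=AB-BA$, let, for $j\in\mathbb Z$, $R_j=[v\cdot\nabla,\dot\Delta_j]f=[v_k,\dot\Delta_j]\nabla_kf$ and $$R_j^1=[\dot T_{v_k},\dot\Delta_j]\nabla_kf,\quad R_j^2=\dot T_{\nabla_k\dot\Delta_jf}v_k,\quad R_j^3=-\dot\Delta_j\dot T_{\nabla_kf}v_k,$$ $$R_j^4=\dot R(v_k,\nabla_k\dot\Delta_jf),\quad R_j^5=-\nabla_k\dot\Delta_j\dot R(v_k,f),\quad R_j^6=\dot\Delta_j\dot R(\nabla_kv_k,f).$$ Then all the products and series involved are well defined (the series converging unconditionally in $\mathcal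 S'$), and $R_j=\sum_{i=1}^6R_j^i$ for every $j$. Moreover, let $s_1,s_2\in\mathbb R$, $s=s_1+s_2$, $p_1,p_2,q_1,q_2\in[1,\infty]$, $\frac1p=\frac1{p_1}+\frac1{p_2}$, $\frac1q=\frac1{q_1}+\frac1{q_2}$, and suppose $p\ge1$. Then there is a finite constant $C$ depending only on $\varphi$ (hence on $n$), $s_1,s_2,p_1,p_2$ such that, for all $v,f$ as above, $$\big\|j\mapsto2^{js}\|R_j^1\|_{L^p}\big\|_{\ell^q}\le C\,\|\nabla v\|_{L^{p_1}}\|f\|_{\dot B^s_{p_2,q}},$$ and $$\big\|j\mapsto2^{js}\|R_j^i\|_{L^p}\big\|_{\ell^q}\le C\,\|\nabla v\|_{\dot B^{s_1}_{p_1,q_1}}\|f\|_{\dot B^{s_2}_{p_2,q_2}}$$ for $i=1$ if $s_1<0$; for $i=2$ if $s_1>-1$; for $i=3$ if $s_2<1$; for $i=4$ without further condition; for $i=5$ if $s>-1$; and for $i=6$ if $s>0$. -/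

import Mathlib

open MeasureTheory SchwartzMap LineDeriv
open scoped ENNReal NNReal ContDiff

noncomputable section

namespace LittlewoodPaley

/-- Euclidean space of dimension `n`. -/
abbrev Rn (n : ℕ) := EuclideanSpace ℝ (Fin n)

/-- The open annulus `B(0, 8/3)` minus the closed ball of radius `3/4`. -/
def annulus (n : ℕ) : Set (Rn n) := Metric.ball 0 (8 / 3) \ Metric.closedBall 0 (3 / 4)

/-- A pair of radial cut-off functions generating a dyadic partition of unity.
Since the supports of `χ` and `φ` are confined to the ball of radius `4/3` and to the annulus, the
usual almost-disjointness of the supports of the dilates and the bounds `1/2 ≤ ∑ φ² ≤ 1` are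
consequences of the fields below. -/
structure IsDyadicPair {n : ℕ} (χ φ : Rn n → ℝ) : Prop where
  smooth_low : ContDiff ℝ ∞ χ
  smooth_ann : ContDiff ℝ ∞ φ
  compact_low : HasCompactSupport χ
  compact_ann : HasCompactSupport φ
  support_low : tsupport χ ⊆ Metric.ball 0 (4 / 3)
  support_ann : tsupport φ ⊆ annulus n
  radial_low : ∀ ξ η, ‖ξ‖ = ‖η‖ → χ ξ = χ η
  radial_ann : ∀ ξ η, ‖ξ‖ = ‖η‖ → φ ξ = φ η
  range_low : ∀ ξ, χ ξ ∈ Set.Icc (0 : ℝ) 1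
  range_ann : ∀ ξ, φ ξ ∈ Set.Icc (0 : ℝ) 1
  sum_nonneg : ∀ ξ, HasSum (fun j : ℕ ↦ φ ((2 : ℝ) ^ (-(j : ℤ)) • ξ)) (1 - χ ξ)
  sum_int : ∀ ξ, ξ ≠ 0 → HasSum (fun j : ℤ ↦ φ ((2 : ℝ) ^ (-j) • ξ)) 1

section Distributions

variable {n : ℕ} {F : Type*} [NormedAddCommGroup F] [NormedSpace ℂ F]

/-- The Fourier multiplier `m(2^{-j} D)`, where `D` has symbol the angular frequency; Mathlib's
Fourier transform has kernel `exp(-2πi x·ξ)`, so the angular frequency is `2πξ`.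
For a dyadic pair `χ, φ` this gives `Ṡ_j = dyadic χ j` and `Δ̇_j = dyadic φ j`. -/
def dyadic (m : Rn n → ℝ) (j : ℤ) (u : 𝓢'(Rn n, F)) : 𝓢'(Rn n, F) :=
  TemperedDistribution.fourierMultiplierCLM F
    (fun ξ ↦ ((m ((2 : ℝ) ^ (-j) • ((2 * Real.pi) • ξ)) : ℝ) : ℂ)) u

/-- The tempered distribution `u` is (integration against) the function `g`. -/
def RepresentedBy (u : 𝓢'(Rn n, F)) (g : Rn n → F) : Prop :=
  ∀ θ : 𝓢(Rn n, ℂ), Integrable (fun x ↦ θ x • g x) ∧ u θ = ∫ x, θ x • g x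

/-- The `L^p` norm of a tempered distribution: the `L^p` norm of the function representing it if
there is such a function in `L^p`, and `∞` otherwise (infimum of the empty set). -/
def distLpNorm (p : ℝ≥0∞) (u : 𝓢'(Rn n, F)) : ℝ≥0∞ :=
  ⨅ (g : Rn n → F) (_ : MemLp g p volume ∧ RepresentedBy u g), eLpNorm g p volume

/-- The `ℓ^q(ℤ)` norm of `j ↦ 2^{js} ‖u_j‖_{L^p}`. -/
def seqNorm (s : ℝ) (p q : ℝ≥0∞) (u : ℤ → 𝓢'(Rn n, F)) : ℝ≥0∞ :=
  eLpNorm (fun j : ℤ ↦ (2 : ℝ≥0∞) ^ ((j : ℝ) * s) * distLpNorm p (u j)) q Measure.count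

/-- The homogeneous Besov seminorm of `u` in `Ḃ^s_{p,q}`. -/
def besovNorm (φ : Rn n → ℝ) (s : ℝ) (p q : ℝ≥0∞) (u : 𝓢'(Rn n, F)) : ℝ≥0∞ :=
  seqNorm s p q (fun j ↦ dyadic φ j u)

/-- Membership in the homogeneous Sobolev space `Ḣ^r`: the Fourier transform is a locally
integrable function `g` with `|ξ|^r g ∈ L²`. -/
def MemHdot (r : ℝ) (u : 𝓢'(Rn n, F)) : Prop :=
  ∃ g : Rn n → F, LocallyIntegrable g ∧ RepresentedBy (FourierTransform.fourier u) g ∧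
    MemLp (fun ξ ↦ ((‖ξ‖ ^ r : ℝ) : ℂ) • g ξ) 2 volume

/-- Membership in the intersection of the spaces `Ḣ^r` over `r ∈ [0, ∞)`. -/
def MemHdotInter (u : 𝓢'(Rn n, F)) : Prop := ∀ r : ℝ, 0 ≤ r → MemHdot r u

/-- The partial derivative `∇_k`. -/
def partialD (k : Fin n) (u : 𝓢'(Rn n, F)) : 𝓢'(Rn n, F) :=
  ∂_{(EuclideanSpace.single k (1 : ℝ) : Rn n)} u

/-- The `k`-th component of a vector-valued tempered distribution. -/
def component (v : 𝓢'(Rn n, EuclideanSpace ℂ (Fin n))) (k : Fin n) : 𝓢'(Rn n, ℂ) :=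
  PointwiseConvergenceCLM.postcomp 𝓢(Rn n, ℂ)
    (EuclideanSpace.proj k : EuclideanSpace ℂ (Fin n) →L[ℂ] ℂ) v

/-- The gradient `∇v`, whose `(k, l)` entry is `∇_k v_l`. -/
def gradVec (v : 𝓢'(Rn n, EuclideanSpace ℂ (Fin n))) :
    𝓢'(Rn n, EuclideanSpace ℂ (Fin n × Fin n)) :=
  ∑ k : Fin n, ∑ l : Fin n,
    PointwiseConvergenceCLM.postcomp 𝓢(Rn n, ℂ)
      (ContinuousLinearMap.toSpanSingleton ℂ
        (EuclideanSpace.single (k, l) (1 : ℂ) : EuclideanSpace ℂ (Fin n × Fin n)))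
      (partialD k (component v l))

end Distributions

section Products

variable {n : ℕ}

/-- `w` is the pointwise product of `u` and `v`, all three being given by functions. -/
def IsProduct (u v w : 𝓢'(Rn n, ℂ)) : Prop :=
  ∃ g h : Rn n → ℂ, RepresentedBy u g ∧ RepresentedBy v h ∧ RepresentedBy w (fun x ↦ g x * h x)

/-- The pointwise product of `u` and `v` makes sense as a tempered distribution. -/
def HasProduct (u v : 𝓢'(Rn n, ℂ)) : Prop := ∃ w, IsProduct u v w

open Classical in
/-- The pointwise product of two tempered distributions (zero if `HasProduct u v` fails). -/
def distMul (u v : 𝓢'(Rn n, ℂ)) : 𝓢'(Rn n, ℂ) :=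
  if h : HasProduct u v then h.choose else 0

/-- The `j`-th term `Ṡ_{j-1} u Δ̇_j v` of the paraproduct. -/
def paraTerm (χ φ : Rn n → ℝ) (u v : 𝓢'(Rn n, ℂ)) (j : ℤ) : 𝓢'(Rn n, ℂ) :=
  distMul (dyadic χ (j - 1) u) (dyadic φ j v)

/-- The paraproduct `Ṫ_u v = ∑_j Ṡ_{j-1} u Δ̇_j v`, the series converging in `𝓢'`. -/
def paraprod (χ φ : Rn n → ℝ) (u v : 𝓢'(Rn n, ℂ)) : 𝓢'(Rn n, ℂ) :=
  ∑' j : ℤ, paraTerm χ φ u v j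

/-- The products in the paraproduct `Ṫ_u v` make sense and the series converges in `𝓢'`. -/
def HasPara (χ φ : Rn n → ℝ) (u v : 𝓢'(Rn n, ℂ)) : Prop :=
  (∀ j : ℤ, HasProduct (dyadic χ (j - 1) u) (dyadic φ j v)) ∧ Summable (paraTerm χ φ u v)

/-- The `j`-th term `∑_{|ν| ≤ 1} Δ̇_j u Δ̇_{j-ν} v` of the remainder. -/
def remTerm (φ : Rn n → ℝ) (u v : 𝓢'(Rn n, ℂ)) (j : ℤ) : 𝓢'(Rn n, ℂ) :=
  ∑ ν ∈ Finset.Icc (-1 : ℤ) 1, distMul (dyadic φ j u) (dyadic φ (j - ν) v)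

/-- The remainder `Ṙ(u, v) = ∑_j ∑_{|ν| ≤ 1} Δ̇_j u Δ̇_{j-ν} v`, converging in `𝓢'`. -/
def remainder (φ : Rn n → ℝ) (u v : 𝓢'(Rn n, ℂ)) : 𝓢'(Rn n, ℂ) :=
  ∑' j : ℤ, remTerm φ u v j

/-- The products in the remainder `Ṙ(u, v)` make sense and the series converges in `𝓢'`. -/
def HasRem (φ : Rn n → ℝ) (u v : 𝓢'(Rn n, ℂ)) : Prop :=
  (∀ j : ℤ, ∀ ν ∈ Finset.Icc (-1 : ℤ) 1, HasProduct (dyadic φ j u) (dyadic φ (j - ν) v)) ∧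
    Summable (remTerm φ u v)

end Products

section Commutator

variable {n : ℕ} (χ φ : Rn n → ℝ)
  (v : 𝓢'(Rn n, EuclideanSpace ℂ (Fin n))) (f : 𝓢'(Rn n, ℂ)) (j : ℤ)

/-- `R_j = [v·∇, Δ̇_j] f = ∑_k (v_k Δ̇_j ∇_k f - Δ̇_j (v_k ∇_k f))`. -/
def commTerm : 𝓢'(Rn n, ℂ) :=
  ∑ k, (distMul (component v k) (dyadic φ j (partialD k f)) -
    dyadic φ j (distMul (component v k) (partialD k f)))

/-- `R_j^1 = [Ṫ_{v_k}, Δ̇_j] ∇_k f`. -/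
def R1 : 𝓢'(Rn n, ℂ) :=
  ∑ k, (paraprod χ φ (component v k) (dyadic φ j (partialD k f)) -
    dyadic φ j (paraprod χ φ (component v k) (partialD k f)))

/-- `R_j^2 = Ṫ_{∇_k Δ̇_j f} v_k`. -/
def R2 : 𝓢'(Rn n, ℂ) :=
  ∑ k, paraprod χ φ (partialD k (dyadic φ j f)) (component v k)

/-- `R_j^3 = -Δ̇_j Ṫ_{∇_k f} v_k`. -/
def R3 : 𝓢'(Rn n, ℂ) :=
  ∑ k, -dyadic φ j (paraprod χ φ (partialD k f) (component v k))

/-- `R_j^4 = Ṙ(v_k, ∇_k Δ̇_j f)`. -/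
def R4 : 𝓢'(Rn n, ℂ) :=
  ∑ k, remainder φ (component v k) (partialD k (dyadic φ j f))

/-- `R_j^5 = -∇_k Δ̇_j Ṙ(v_k, f)`. -/
def R5 : 𝓢'(Rn n, ℂ) :=
  ∑ k, -partialD k (dyadic φ j (remainder φ (component v k) f))

/-- `R_j^6 = Δ̇_j Ṙ(∇_k v_k, f)`. -/
def R6 : 𝓢'(Rn n, ℂ) :=
  ∑ k, dyadic φ j (remainder φ (partialD k (component v k)) f)

/-- All products and series that enter `R_j` and `R_j^1, …, R_j^6` make sense in `𝓢'`. -/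
def AllDefined : Prop :=
  ∀ k : Fin n,
    HasProduct (component v k) (dyadic φ j (partialD k f)) ∧
    HasProduct (component v k) (partialD k f) ∧
    HasPara χ φ (component v k) (dyadic φ j (partialD k f)) ∧
    HasPara χ φ (component v k) (partialD k f) ∧
    HasPara χ φ (partialD k (dyadic φ j f)) (component v k) ∧
    HasPara χ φ (partialD k f) (component v k) ∧
    HasRem φ (component v k) (partialD k (dyadic φ j f)) ∧
    HasRem φ (component v k) f ∧
    HasRem φ (partialD k (component v k)) f

end Commutator

end LittlewoodPaley

end

open LittlewoodPaley

noncomputable section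

namespace LittlewoodPaley

open FourierTransform Filter Topology

variable {n : ℕ}

/-! ### Distributions given by functions or by integrable Fourier transforms -/

section Represented

variable {F : Type*} [NormedAddCommGroup F] [NormedSpace ℂ F]

/-! The proof lives among distributions whose Fourier transform is integrable (`HasSpectrum`). By
Cauchy–Schwarz, membership in Ḣ^0 and Ḣ^{n+2} makes (1+|ξ|) times the Fourier transform integrable
(`MemHdotInter.exists_integrable`). Hence v_k, f and their first derivatives are bounded continuous
functions, products correspond to convolutions of spectra, and Σ_j φ(2^{-j}ξ) ≤ 1 makes the spectra
of the dyadic blocks summable in L¹. All series therefore converge absolutely on the Fourier side,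
which gives convergence both pointwise and unconditionally in 𝓢'.

Bony's decomposition (`IsDyadicPair.distMul_eq_para`) is then a rearrangement, at each point, of a
product of two absolutely convergent series. Applied to both products in the commutator it produces
R^1, ..., R^4 and -Δ̇_j Ṙ(v_k, ∇_k f). The Leibniz rule in each block splits the latter into R^5 +
R^6.

For the estimates, a dyadic multiplier is an average of translations, so it is bounded on L^p
uniformly in j and p. Its commutator with a function a involves only the differences a(x) - a(x-y)
and gains 2^{-j}‖∇a‖ (`IsCutoff.exists_distLpNorm_commutator_le`). Bernstein's inequality bounds the
derivatives of f by blocks of f, and the reverse inequality bounds blocks of v by blocks of ∇v. The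
supports decide which blocks interact. With Hölder's inequality, each R^i_j is dominated by finite
windows around j and geometric kernels 2^{-κm} acting by shifts of c + εm.

In a space with weight 2^{jσ} such a kernel is summable exactly when κ + εσ > 0
(`exists_weightedNorm_conv_le`), and this is where the conditions come from. The triples (κ, ε, σ)
are (0, -1, s₁) for the Besov bound of R^1, (1, 1, s₁) for R^2, (1, -1, s₂) for R^3, (1, 1, s) for
R^5 and (0, 1, s) for R^6. The bound of R^4 and the L^{p₁} bound of R^1 use windows only, so they
need no condition.

Since q may be less than 1, ℓ^q need not satisfy the triangle inequality. The discrete Young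
inequality `exists_lqNorm_conv_le` uses sup ≤ ℓ^q instead, with a constant uniform in q ≥ 1/2; hence
C does not depend on q, q₁, q₂. -/

theorem RepresentedBy.locallyIntegrable {u : 𝓢'(Rn n, F)} {g : Rn n → F}
    (h : RepresentedBy u g) : LocallyIntegrable g := by
  intro x
  let b : ContDiffBump x := ⟨1, 2, by norm_num, by norm_num⟩
  have hb : HasCompactSupport (fun y ↦ ((b y : ℝ) : ℂ)) :=
    b.hasCompactSupport.comp_left Complex.ofReal_zero
  let θ : 𝓢(Rn n, ℂ) := hb.toSchwartzMap (Complex.ofRealCLM.contDiff.comp b.contDiff)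
  refine ⟨Metric.closedBall x 1, Metric.closedBall_mem_nhds x one_pos, ?_⟩
  refine ((h θ).1.integrableOn (s := Metric.closedBall x 1)).congr_fun (fun y hy ↦ ?_)
    Metric.isClosed_closedBall.measurableSet
  have : b y = 1 := b.one_of_mem_closedBall hy
  change ((b y : ℝ) : ℂ) • g y = g y
  simp [this]

theorem RepresentedBy.ae_eq [CompleteSpace F] {u : 𝓢'(Rn n, F)} {g g' : Rn n → F}
    (h : RepresentedBy u g) (h' : RepresentedBy u g') : g =ᵐ[volume] g' := by
  let _ : NormedSpace ℝ F := NormedSpace.restrictScalars ℝ ℂ F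
  refine ae_eq_of_integral_contDiff_smul_eq h.locallyIntegrable h'.locallyIntegrable
    fun ψ hψ hc ↦ ?_
  have hb : HasCompactSupport (fun y ↦ ((ψ y : ℝ) : ℂ)) := hc.comp_left Complex.ofReal_zero
  let θ : 𝓢(Rn n, ℂ) := hb.toSchwartzMap (Complex.ofRealCLM.contDiff.comp hψ)
  exact (h θ).2.symm.trans (h' θ).2

theorem RepresentedBy.eq {u w : 𝓢'(Rn n, F)} {g g' : Rn n → F}
    (h : RepresentedBy u g) (h' : RepresentedBy w g') (hg : g =ᵐ[volume] g') : u = w := by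
  ext θ
  rw [(h θ).2, (h' θ).2]
  exact integral_congr_ae (by filter_upwards [hg] with x hx; rw [hx])

/-- Representatives agree almost everywhere, so the infimum runs over at most one class. If g is not
in L^p its norm is infinite, because local integrability already supplies measurability. -/
theorem RepresentedBy.distLpNorm_eq [CompleteSpace F] {u : 𝓢'(Rn n, F)} {g : Rn n → F}
    (h : RepresentedBy u g) (p : ℝ≥0∞) : distLpNorm p u = eLpNorm g p volume := by
  refine le_antisymm ?_ (le_iInf₂ fun g' hg' ↦ (eLpNorm_congr_ae (h.ae_eq hg'.2)).le)
  by_cases hp : MemLp g p volume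
  · exact iInf₂_le g ⟨hp, h⟩
  · have : eLpNorm g p volume = ⊤ := by
      by_contra hne
      exact hp ⟨h.locallyIntegrable.aestronglyMeasurable, lt_top_iff_ne_top.2 hne⟩
    rw [this]
    exact le_top

end Represented

/-- The tempered distribution `u` has the integrable function `G` as Fourier transform. -/
def HasSpectrum (u : 𝓢'(Rn n, ℂ)) (G : Rn n → ℂ) : Prop :=
  Integrable G ∧ ∀ θ : 𝓢(Rn n, ℂ), u θ = ∫ ξ, (𝓕⁻ θ) ξ * G ξ

theorem integrable_schwartz_mul {G : Rn n → ℂ} (hG : Integrable G) (θ : 𝓢(Rn n, ℂ)) :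
    Integrable (fun ξ ↦ θ ξ * G ξ) := by
  obtain ⟨C, hC⟩ := (θ.toBoundedContinuousFunction).bddAbove_range_norm_comp
  refine hG.bdd_mul (c := C) θ.continuous.aestronglyMeasurable (ae_of_all _ fun x ↦ ?_)
  exact hC ⟨x, rfl⟩

theorem continuous_fourierInv {G : Rn n → ℂ} (hG : Integrable G) : Continuous (𝓕⁻ G) := by
  rw [show (𝓕⁻ G : Rn n → ℂ) = fun x ↦ 𝓕 G (-x) from
    funext fun x ↦ Real.fourierInv_eq_fourier_neg G x]
  exact (VectorFourier.fourierIntegral_continuous Real.continuous_fourierChar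
    continuous_inner hG).comp continuous_neg

theorem norm_fourierInv_le (G : Rn n → ℂ) (x : Rn n) : ‖𝓕⁻ G x‖ ≤ ∫ ξ, ‖G ξ‖ := by
  rw [Real.fourierInv_eq_fourier_neg]
  exact VectorFourier.norm_fourierIntegral_le_integral_norm _ _ _ _ _

theorem integral_fourierInv_mul_eq {G H : Rn n → ℂ} (hG : Integrable G) (hH : Integrable H) :
    ∫ ξ, 𝓕⁻ G ξ * H ξ = ∫ x, G x * 𝓕⁻ H x := by
  -- The inverse transform is the Fourier integral for the form -⟨·,·⟩. This form is symmetric, so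
  -- the flip on the other side is again the inverse transform.
  have h := VectorFourier.integral_fourierIntegral_smul_eq_flip (f := G) (g := H)
    (L := -innerₗ (Rn n)) Real.continuous_fourierChar
    (by simpa using! continuous_inner.neg) hG hH
  have e1 : ∀ G : Rn n → ℂ, VectorFourier.fourierIntegral Real.fourierChar volume
      (-innerₗ (Rn n)) G = 𝓕⁻ G := fun G ↦ rfl
  have e2 : ∀ G : Rn n → ℂ, VectorFourier.fourierIntegral Real.fourierChar volume
      (-innerₗ (Rn n)).flip G = 𝓕⁻ G := fun G ↦ by
    rw [← e1]; congr 1; ext x y; simp [real_inner_comm]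
  rw [e1, e2] at h
  simpa using h

theorem HasSpectrum.representedBy {u : 𝓢'(Rn n, ℂ)} {G : Rn n → ℂ} (h : HasSpectrum u G) :
    RepresentedBy u (𝓕⁻ G) := by
  intro θ
  constructor
  · exact (θ.integrable.mul_bdd (c := ∫ ξ, ‖G ξ‖)
      (continuous_fourierInv h.1).aestronglyMeasurable
      (ae_of_all _ fun x ↦ norm_fourierInv_le G x))
  · rw [h.2]
    have := integral_fourierInv_mul_eq θ.integrable h.1
    simpa [SchwartzMap.fourierInv_coe] using this

theorem HasSpectrum.distLpNorm_eq {u : 𝓢'(Rn n, ℂ)} {G : Rn n → ℂ} (h : HasSpectrum u G)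
    (p : ℝ≥0∞) : distLpNorm p u = eLpNorm (𝓕⁻ G) p volume :=
  h.representedBy.distLpNorm_eq p

theorem HasSpectrum.eq {u w : 𝓢'(Rn n, ℂ)} {G : Rn n → ℂ} (h : HasSpectrum u G)
    (h' : HasSpectrum w G) : u = w := by
  ext θ; rw [h.2, h'.2]

theorem HasSpectrum.congr {u : 𝓢'(Rn n, ℂ)} {G H : Rn n → ℂ} (h : HasSpectrum u G)
    (hGH : G =ᵐ[volume] H) : HasSpectrum u H :=
  ⟨h.1.congr hGH, fun θ ↦ by
    rw [h.2]; exact integral_congr_ae (by filter_upwards [hGH] with x hx; rw [hx])⟩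

theorem hasSpectrum_iff_fourier {u : 𝓢'(Rn n, ℂ)} {G : Rn n → ℂ} (hG : Integrable G) :
    HasSpectrum u G ↔ RepresentedBy (𝓕 u) G := by
  constructor
  · intro h θ
    refine ⟨integrable_schwartz_mul hG θ, ?_⟩
    rw [TemperedDistribution.fourier_apply, h.2, FourierTransform.fourierInv_fourier_eq]
    rfl
  · intro h
    refine ⟨hG, fun θ ↦ ?_⟩
    have := (h (𝓕⁻ θ)).2
    rwa [TemperedDistribution.fourier_apply, FourierTransform.fourier_fourierInv_eq] at this

theorem exists_hasSpectrum {G : Rn n → ℂ} (hG : Integrable G) : ∃ u, HasSpectrum u G := by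
  have hG' : MemLp G 1 volume := memLp_one_iff_integrable.2 hG
  let w : 𝓢'(Rn n, ℂ) := Lp.toTemperedDistribution (hG'.toLp G)
  refine ⟨𝓕⁻ w, hG, fun θ ↦ ?_⟩
  rw [TemperedDistribution.fourierInv_apply, Lp.toTemperedDistribution_apply]
  refine integral_congr_ae ?_
  filter_upwards [hG'.coeFn_toLp] with x hx
  rw [hx, smul_eq_mul]

theorem HasSpectrum.zero : HasSpectrum (0 : 𝓢'(Rn n, ℂ)) 0 :=
  ⟨integrable_zero _ _ _, fun θ ↦ by simp⟩

theorem HasSpectrum.add {u w : 𝓢'(Rn n, ℂ)} {G H : Rn n → ℂ} (h : HasSpectrum u G)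
    (h' : HasSpectrum w H) : HasSpectrum (u + w) (G + H) :=
  ⟨h.1.add h'.1, fun θ ↦ by
    simp only [Pi.add_apply, mul_add]
    rw [integral_add (integrable_schwartz_mul h.1 _) (integrable_schwartz_mul h'.1 _),
      ← h.2, ← h'.2]; rfl⟩

theorem HasSpectrum.smul {u : 𝓢'(Rn n, ℂ)} {G : Rn n → ℂ} (h : HasSpectrum u G) (c : ℂ) :
    HasSpectrum (c • u) (c • G) :=
  ⟨h.1.smul c, fun θ ↦ by
    have : ∀ ξ, (𝓕⁻ θ) ξ * (c • G) ξ = c * ((𝓕⁻ θ) ξ * G ξ) := fun ξ ↦ by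
      simp only [Pi.smul_apply, smul_eq_mul]; ring
    simp only [this, integral_const_mul]
    rw [← h.2]; rfl⟩

theorem HasSpectrum.sum {ι : Type*} {u : ι → 𝓢'(Rn n, ℂ)} {G : ι → Rn n → ℂ} (s : Finset ι)
    (h : ∀ i ∈ s, HasSpectrum (u i) (G i)) : HasSpectrum (∑ i ∈ s, u i) (∑ i ∈ s, G i) := by
  classical
  induction s using Finset.induction_on with
  | empty => simpa using HasSpectrum.zero
  | insert a s ha ih =>
    rw [Finset.sum_insert ha, Finset.sum_insert ha]
    exact (h a (by simp)).add (ih fun i hi ↦ h i (by simp [hi]))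

theorem HasSpectrum.fourierMultiplier {u : 𝓢'(Rn n, ℂ)} {G : Rn n → ℂ} (h : HasSpectrum u G)
    {m : Rn n → ℂ} (hm : m.HasTemperateGrowth) (hmG : Integrable (fun ξ ↦ m ξ * G ξ)) :
    HasSpectrum (TemperedDistribution.fourierMultiplierCLM ℂ m u) (fun ξ ↦ m ξ * G ξ) := by
  refine ⟨hmG, fun θ ↦ ?_⟩
  rw [TemperedDistribution.fourierMultiplierCLM_apply_apply, h.2]
  refine integral_congr_ae (ae_of_all _ fun ξ ↦ ?_)
  simp [SchwartzMap.smulLeftCLM_apply_apply hm]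
  ring

/-- The family `u` has integrable Fourier transforms with summable `L¹` norms. -/
def WienerSummable {ι : Type*} (u : ι → 𝓢'(Rn n, ℂ)) (G : ι → Rn n → ℂ) : Prop :=
  (∀ i, HasSpectrum (u i) (G i)) ∧ Summable fun i ↦ ∫ ξ, ‖G i ξ‖

/-! ### Series with summable spectra -/

section Series

variable {ι : Type*} {u : ι → 𝓢'(Rn n, ℂ)} {G : ι → Rn n → ℂ}

theorem tsum_lintegral_enorm_ne_top (hG : ∀ i, Integrable (G i))
    (hs : Summable fun i ↦ ∫ ξ, ‖G i ξ‖) : ∑' i, ∫⁻ ξ, ‖G i ξ‖ₑ ≠ ⊤ := by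
  have : ∀ i, ∫⁻ ξ, ‖G i ξ‖ₑ = ENNReal.ofReal (∫ ξ, ‖G i ξ‖) := fun i ↦ by
    rw [ofReal_integral_norm_eq_lintegral_enorm (hG i)]
  simp only [this]
  exact hs.tsum_ofReal_ne_top

variable [Countable ι]

theorem ae_summable_norm (hG : ∀ i, Integrable (G i))
    (hs : Summable fun i ↦ ∫ ξ, ‖G i ξ‖) : ∀ᵐ ξ, Summable fun i ↦ ‖G i ξ‖ :=
  summable_norm_of_tsum_eLpNorm_ne_top le_rfl (fun i ↦ (hG i).1)
    (by simpa only [eLpNorm_one_eq_lintegral_enorm] using tsum_lintegral_enorm_ne_top hG hs)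

theorem integrable_tsum (hG : ∀ i, Integrable (G i))
    (hs : Summable fun i ↦ ∫ ξ, ‖G i ξ‖) : Integrable (fun ξ ↦ ∑' i, G i ξ) := by
  refine ⟨?_, ?_⟩
  · refine aestronglyMeasurable_of_tendsto_ae (u := atTop)
      (f := fun (s : Finset ι) ξ ↦ ∑ i ∈ s, G i ξ) (fun s ↦ ?_) ?_
    · exact Finset.aestronglyMeasurable_fun_sum s fun i _ ↦ (hG i).1
    · filter_upwards [ae_summable_norm hG hs] with ξ hξ
      exact hξ.of_norm.hasSum
  · calc ∫⁻ ξ, ‖∑' i, G i ξ‖ₑ ≤ ∫⁻ ξ, ∑' i, ‖G i ξ‖ₑ :=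
          lintegral_mono fun ξ ↦ enorm_tsum_le_tsum_enorm
      _ = ∑' i, ∫⁻ ξ, ‖G i ξ‖ₑ := lintegral_tsum fun i ↦ (hG i).1.enorm
      _ < ⊤ := (tsum_lintegral_enorm_ne_top hG hs).lt_top

/-- Used with two choices of k: a character gives pointwise convergence of the functions, and 𝓕⁻ θ
gives convergence tested against θ. -/
theorem hasSum_integral_mul (hG : ∀ i, Integrable (G i))
    (hs : Summable fun i ↦ ∫ ξ, ‖G i ξ‖) {k : Rn n → ℂ} (hk : AEStronglyMeasurable k volume)
    {C : ℝ} (hC : ∀ ξ, ‖k ξ‖ ≤ C) :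
    HasSum (fun i ↦ ∫ ξ, k ξ * G i ξ) (∫ ξ, k ξ * ∑' i, G i ξ) := by
  have h1 : ∀ i, Integrable (fun ξ ↦ k ξ * G i ξ) := fun i ↦
    (hG i).bdd_mul (c := C) hk (ae_of_all _ hC)
  have h2 : Summable fun i ↦ ∫ ξ, ‖k ξ * G i ξ‖ := by
    refine Summable.of_nonneg_of_le (fun i ↦ integral_nonneg fun _ ↦ norm_nonneg _) (fun i ↦ ?_)
      (hs.mul_left C)
    rw [← integral_const_mul]
    refine integral_mono (h1 i).norm ((hG i).norm.const_mul C) fun ξ ↦ ?_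
    simp only [norm_mul]
    exact mul_le_mul_of_nonneg_right (hC ξ) (norm_nonneg _)
  simpa only [tsum_mul_left] using hasSum_integral_of_summable_integral_norm h1 h2

theorem WienerSummable.hasSum_fourierInv (h : WienerSummable u G) (x : Rn n) :
    HasSum (fun i ↦ 𝓕⁻ (G i) x) (𝓕⁻ (fun ξ ↦ ∑' i, G i ξ) x) := by
  have := hasSum_integral_mul (fun i ↦ (h.1 i).1) h.2
    (k := fun ξ ↦ ((Real.fourierChar (inner ℝ ξ x) : Circle) : ℂ)) (C := 1)
    (by
      refine Continuous.aestronglyMeasurable ?_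
      exact (by fun_prop : Continuous fun z : Circle ↦ (z : ℂ)).comp
        (Real.continuous_fourierChar.comp (by fun_prop)))
    (fun ξ ↦ (Circle.norm_coe _).le)
  simpa only [Real.fourierInv_eq, Circle.smul_def, smul_eq_mul] using this

/-- The topology of 𝓢' is that of pointwise convergence on test functions, and the limit is along
all finite index sets, so the convergence is unconditional. -/
theorem WienerSummable.hasSum (h : WienerSummable u G) {w : 𝓢'(Rn n, ℂ)}
    (hw : HasSpectrum w fun ξ ↦ ∑' i, G i ξ) : HasSum u w := by
  refine PointwiseConvergenceCLM.tendsto_iff_forall_tendsto.2 fun θ ↦ ?_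
  obtain ⟨C, hC⟩ := ((𝓕⁻ θ).toBoundedContinuousFunction).bddAbove_range_norm_comp
  have := hasSum_integral_mul (fun i ↦ (h.1 i).1) h.2 (𝓕⁻ θ).continuous.aestronglyMeasurable
    (C := C) (fun x ↦ hC ⟨x, rfl⟩)
  have this : HasSum (fun i ↦ u i θ) (w θ) := by
    rw [hw.2]; simp only [(h.1 _).2]; exact this
  have e : (fun s : Finset ι ↦ (∑ i ∈ s, u i) θ) = fun s ↦ ∑ i ∈ s, u i θ := by
    funext s
    exact map_sum (PointwiseConvergenceCLM.evalCLM (RingHom.id ℂ) ℂ θ) u s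
  rw [e]
  exact this

theorem WienerSummable.summable (h : WienerSummable u G) : Summable u := by
  obtain ⟨w, hw⟩ := exists_hasSpectrum (integrable_tsum (fun i ↦ (h.1 i).1) h.2)
  exact (h.hasSum hw).summable

theorem WienerSummable.hasSpectrum_tsum (h : WienerSummable u G) :
    HasSpectrum (∑' i, u i) (fun ξ ↦ ∑' i, G i ξ) := by
  obtain ⟨w, hw⟩ := exists_hasSpectrum (integrable_tsum (fun i ↦ (h.1 i).1) h.2)
  rwa [(h.hasSum hw).tsum_eq]

end Series

end LittlewoodPaley

namespace LittlewoodPaley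

open FourierTransform Filter Topology
open scoped Convolution

variable {n : ℕ}

/-! ### Products as convolutions of spectra -/

section Convolution

theorem fourierInv_convolution {G H : Rn n → ℂ} (hG : Integrable G) (hH : Integrable H)
    (x : Rn n) :
    𝓕⁻ (G ⋆[ContinuousLinearMap.mul ℂ ℂ, volume] H) x = 𝓕⁻ G x * 𝓕⁻ H x := by
  simp only [Real.fourierInv_eq_fourier_neg]
  exact Real.fourier_mul_convolution_eq hG hH (-x)

theorem integral_norm_convolution_le {G H : Rn n → ℂ} (hG : Integrable G) (hH : Integrable H) :
    ∫ ξ, ‖(G ⋆[ContinuousLinearMap.mul ℂ ℂ, volume] H) ξ‖ ≤ (∫ ξ, ‖G ξ‖) * ∫ ξ, ‖H ξ‖ := by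
  have h1 := integral_convolution (ContinuousLinearMap.mul ℝ ℝ) hG.norm hH.norm
  rw [ContinuousLinearMap.mul_apply'] at h1
  rw [← h1]
  refine integral_mono (hG.integrable_convolution _ hH).norm
    (hG.norm.integrable_convolution _ hH.norm) fun ξ ↦ ?_
  refine (norm_integral_le_integral_norm _).trans_eq ?_
  simp [MeasureTheory.convolution]

/-- Additivity gives a(ξ) = a(t) + a(ξ - t) under the convolution integral. This is the Leibniz rule
on the Fourier side. -/
theorem convolution_coord_mul {G H : Rn n → ℂ} (hG : Integrable G) (hH : Integrable H)
    {a : Rn n → ℂ} (ha : ∀ ξ η, a (ξ + η) = a ξ + a η)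
    (haG : Integrable fun ξ ↦ a ξ * G ξ) (haH : Integrable fun ξ ↦ a ξ * H ξ) :
    (fun ξ ↦ a ξ * (G ⋆[ContinuousLinearMap.mul ℂ ℂ, volume] H) ξ) =ᵐ[volume]
      ((fun ξ ↦ a ξ * G ξ) ⋆[ContinuousLinearMap.mul ℂ ℂ, volume] H) +
        (G ⋆[ContinuousLinearMap.mul ℂ ℂ, volume] fun ξ ↦ a ξ * H ξ) := by
  filter_upwards [haG.ae_convolution_exists (ContinuousLinearMap.mul ℂ ℂ) hH,
    hG.ae_convolution_exists (ContinuousLinearMap.mul ℂ ℂ) haH] with ξ h1 h2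
  simp only [Pi.add_apply, MeasureTheory.convolution]
  rw [← integral_add h1 h2, ← integral_const_mul]
  refine integral_congr_ae (ae_of_all _ fun t ↦ ?_)
  have := ha t (ξ - t)
  rw [add_sub_cancel] at this
  simp only [ContinuousLinearMap.mul_apply', this]
  ring

/-- The integrand at ξ is nonzero only if ξ = t + (ξ - t) splits into a frequency of G and one of H.
-/
theorem mul_convolution_eq_zero {G H m : Rn n → ℂ}
    (h : ∀ ξ η, G ξ ≠ 0 → H η ≠ 0 → m (ξ + η) = 0) (ξ : Rn n) :
    m ξ * (G ⋆[ContinuousLinearMap.mul ℂ ℂ, volume] H) ξ = 0 := by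
  rw [MeasureTheory.convolution, ← integral_const_mul]
  refine integral_eq_zero_of_ae (ae_of_all _ fun t ↦ ?_)
  by_cases h1 : G t = 0
  · simp [h1]
  by_cases h2 : H (ξ - t) = 0
  · simp [h2]
  have := h _ _ h1 h2
  rw [add_sub_cancel] at this
  simp [this]

end Convolution

section Product

theorem IsProduct.unique {u v w w' : 𝓢'(Rn n, ℂ)} (h : IsProduct u v w)
    (h' : IsProduct u v w') : w = w' := by
  obtain ⟨g, k, h1, h2, h3⟩ := h
  obtain ⟨g', k', h1', h2', h3'⟩ := h'
  refine h3.eq h3' ?_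
  filter_upwards [h1.ae_eq h1', h2.ae_eq h2'] with x hx hy
  rw [hx, hy]

/-- Uniqueness makes the choice inside `distMul` immaterial: any product that can be exhibited is
the product. -/
theorem IsProduct.distMul_eq {u v w : 𝓢'(Rn n, ℂ)} (h : IsProduct u v w) :
    distMul u v = w := by
  have h' : HasProduct u v := ⟨w, h⟩
  rw [distMul, dif_pos h']
  exact h'.choose_spec.unique h

variable {u w z : 𝓢'(Rn n, ℂ)} {G H K : Rn n → ℂ}

theorem HasSpectrum.isProduct (hu : HasSpectrum u G) (hw : HasSpectrum w H)
    (hz : HasSpectrum z (G ⋆[ContinuousLinearMap.mul ℂ ℂ, volume] H)) : IsProduct u w z := by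
  refine ⟨_, _, hu.representedBy, hw.representedBy, ?_⟩
  have := hz.representedBy
  rwa [show (𝓕⁻ (G ⋆[ContinuousLinearMap.mul ℂ ℂ, volume] H) : Rn n → ℂ) = _ from
    funext (fourierInv_convolution hu.1 hw.1)] at this

theorem HasSpectrum.hasProduct (hu : HasSpectrum u G) (hw : HasSpectrum w H) :
    HasProduct u w := by
  obtain ⟨z, hz⟩ := exists_hasSpectrum
    (hu.1.integrable_convolution (ContinuousLinearMap.mul ℂ ℂ) hw.1)
  exact ⟨z, hu.isProduct hw hz⟩

theorem HasSpectrum.distMul (hu : HasSpectrum u G) (hw : HasSpectrum w H) :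
    HasSpectrum (distMul u w) (G ⋆[ContinuousLinearMap.mul ℂ ℂ, volume] H) := by
  obtain ⟨z, hz⟩ := exists_hasSpectrum
    (hu.1.integrable_convolution (ContinuousLinearMap.mul ℂ ℂ) hw.1)
  rwa [(hu.isProduct hw hz).distMul_eq]

theorem HasSpectrum.representedBy_distMul (hu : HasSpectrum u G) (hw : HasSpectrum w H) :
    RepresentedBy (LittlewoodPaley.distMul u w) (fun x ↦ 𝓕⁻ G x * 𝓕⁻ H x) := by
  have := (hu.distMul hw).representedBy
  rwa [show (𝓕⁻ (G ⋆[ContinuousLinearMap.mul ℂ ℂ, volume] H) : Rn n → ℂ) = _ from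
    funext (fourierInv_convolution hu.1 hw.1)] at this

end Product

/-! ### Symbols of dyadic multipliers and of derivatives -/

section Symbols

/-- The symbol of the multiplier `dyadic m j` with respect to Mathlib's Fourier transform. -/
def dyadicSymbol (m : Rn n → ℝ) (j : ℤ) (ξ : Rn n) : ℂ :=
  ((m ((2 : ℝ) ^ (-j) • ((2 * Real.pi) • ξ)) : ℝ) : ℂ)

/-- A smooth compactly supported cut-off function. -/
structure IsCutoff (m : Rn n → ℝ) : Prop where
  smooth : ContDiff ℝ ∞ m
  compact : HasCompactSupport m

theorem IsCutoff.exists_bound {m : Rn n → ℝ} (hm : IsCutoff m) : ∃ C, ∀ ξ, ‖m ξ‖ ≤ C :=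
  hm.compact.exists_bound_of_continuous hm.smooth.continuous

theorem IsCutoff.contDiff_symbol {m : Rn n → ℝ} (hm : IsCutoff m) (j : ℤ) :
    ContDiff ℝ ∞ (dyadicSymbol m j) := by
  refine Complex.ofRealCLM.contDiff.comp (hm.smooth.comp ?_)
  fun_prop

theorem IsCutoff.compact_symbol {m : Rn n → ℝ} (hm : IsCutoff m) (j : ℤ) :
    HasCompactSupport (dyadicSymbol m j) := by
  have h1 : HasCompactSupport (fun ξ ↦ ((m ξ : ℝ) : ℂ)) := hm.compact.comp_left Complex.ofReal_zero
  have h2 := h1.comp_smul (c := (2 : ℝ) ^ (-j) * (2 * Real.pi))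
    (mul_ne_zero (zpow_ne_zero _ two_ne_zero) (by positivity))
  have h3 : dyadicSymbol m j =
      fun ξ ↦ ((m (((2 : ℝ) ^ (-j) * (2 * Real.pi)) • ξ) : ℝ) : ℂ) := by
    funext ξ; rw [dyadicSymbol, smul_smul]
  rw [h3]
  exact h2

theorem IsCutoff.hasTemperateGrowth_symbol {m : Rn n → ℝ} (hm : IsCutoff m) (j : ℤ) :
    (dyadicSymbol m j).HasTemperateGrowth :=
  (hm.compact_symbol j).hasTemperateGrowth (hm.contDiff_symbol j)

theorem IsCutoff.integrable_symbol_mul {m : Rn n → ℝ} (hm : IsCutoff m) (j : ℤ) {G : Rn n → ℂ}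
    (hG : Integrable G) : Integrable (fun ξ ↦ dyadicSymbol m j ξ * G ξ) := by
  obtain ⟨C, hC⟩ := hm.exists_bound
  refine hG.bdd_mul (c := C) (hm.contDiff_symbol j).continuous.aestronglyMeasurable
    (ae_of_all _ fun ξ ↦ ?_)
  simpa [dyadicSymbol] using hC _

theorem dyadic_eq (m : Rn n → ℝ) (j : ℤ) (u : 𝓢'(Rn n, ℂ)) :
    dyadic m j u = TemperedDistribution.fourierMultiplierCLM ℂ (dyadicSymbol m j) u := rfl

theorem HasSpectrum.dyadic {m : Rn n → ℝ} (hm : IsCutoff m) {u : 𝓢'(Rn n, ℂ)} {G : Rn n → ℂ}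
    (h : HasSpectrum u G) (j : ℤ) :
    HasSpectrum (dyadic m j u) (fun ξ ↦ dyadicSymbol m j ξ * G ξ) :=
  h.fourierMultiplier (hm.hasTemperateGrowth_symbol j) (hm.integrable_symbol_mul j h.1)

theorem dyadic_add (m : Rn n → ℝ) (j : ℤ) (u w : 𝓢'(Rn n, ℂ)) :
    dyadic m j (u + w) = dyadic m j u + dyadic m j w :=
  map_add (TemperedDistribution.fourierMultiplierCLM ℂ (dyadicSymbol m j)) u w

theorem dyadic_sub (m : Rn n → ℝ) (j : ℤ) (u w : 𝓢'(Rn n, ℂ)) :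
    dyadic m j (u - w) = dyadic m j u - dyadic m j w :=
  map_sub (TemperedDistribution.fourierMultiplierCLM ℂ (dyadicSymbol m j)) u w

theorem dyadic_tsum {ι : Type*} (m : Rn n → ℝ) (j : ℤ) {u : ι → 𝓢'(Rn n, ℂ)}
    (hu : Summable u) : dyadic m j (∑' i, u i) = ∑' i, dyadic m j (u i) :=
  (TemperedDistribution.fourierMultiplierCLM ℂ (dyadicSymbol m j)).map_tsum hu

/-- The symbol of the partial derivative `∇_k` with respect to Mathlib's Fourier transform. -/
def derivSymbol (k : Fin n) (ξ : Rn n) : ℂ := 2 * Real.pi * Complex.I * (ξ k : ℂ)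

theorem derivSymbol_add (k : Fin n) (ξ η : Rn n) :
    derivSymbol k (ξ + η) = derivSymbol k ξ + derivSymbol k η := by
  simp [derivSymbol, mul_add]

theorem norm_coord_le (ξ : Rn n) (k : Fin n) : ‖ξ k‖ ≤ ‖ξ‖ := PiLp.norm_apply_le ξ k

theorem norm_derivSymbol_le (k : Fin n) (ξ : Rn n) :
    ‖derivSymbol k ξ‖ ≤ 2 * Real.pi * ‖ξ‖ := by
  simp only [derivSymbol, norm_mul, Complex.norm_ofNat, Complex.norm_real, Complex.norm_I,
    Real.norm_of_nonneg Real.pi_pos.le, mul_one]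
  exact mul_le_mul_of_nonneg_left (norm_coord_le ξ k) (by positivity)

theorem contDiff_coord (k : Fin n) : ContDiff ℝ ∞ (fun ξ : Rn n ↦ ξ k) :=
  (EuclideanSpace.proj (𝕜 := ℝ) k).contDiff

theorem contDiff_derivSymbol (k : Fin n) : ContDiff ℝ ∞ (derivSymbol (n := n) k) :=
  contDiff_const.mul (Complex.ofRealCLM.contDiff.comp (contDiff_coord k))

theorem hasTemperateGrowth_coord (k : Fin n) :
    (fun ξ : Rn n ↦ ((ξ k : ℝ) : ℂ)).HasTemperateGrowth :=
  (Complex.ofRealCLM.comp (EuclideanSpace.proj (𝕜 := ℝ) k)).hasTemperateGrowth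

theorem hasTemperateGrowth_derivSymbol (k : Fin n) :
    (derivSymbol (n := n) k).HasTemperateGrowth :=
  (Function.HasTemperateGrowth.const _).mul (hasTemperateGrowth_coord k)

theorem partialD_eq (k : Fin n) (u : 𝓢'(Rn n, ℂ)) :
    partialD k u = TemperedDistribution.fourierMultiplierCLM ℂ (derivSymbol k) u := by
  have h : derivSymbol (n := n) k = (2 * Real.pi * Complex.I) •
      (fun ξ : Rn n ↦ ((ξ k : ℝ) : ℂ)) := rfl
  rw [partialD, TemperedDistribution.lineDeriv_eq_fourierMultiplierCLM, h,
    TemperedDistribution.fourierMultiplierCLM_smul (hasTemperateGrowth_coord k)]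
  simp [EuclideanSpace.inner_single_right]

theorem HasSpectrum.partialD {u : 𝓢'(Rn n, ℂ)} {G : Rn n → ℂ} (h : HasSpectrum u G) (k : Fin n)
    (hG : Integrable fun ξ ↦ derivSymbol k ξ * G ξ) :
    HasSpectrum (partialD k u) (fun ξ ↦ derivSymbol k ξ * G ξ) := by
  rw [partialD_eq]
  exact h.fourierMultiplier (hasTemperateGrowth_derivSymbol k) hG

theorem partialD_tsum {ι : Type*} (k : Fin n) {u : ι → 𝓢'(Rn n, ℂ)}
    (hu : Summable u) : LittlewoodPaley.partialD k (∑' i, u i) =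
      ∑' i, LittlewoodPaley.partialD k (u i) := by
  simp only [partialD_eq]
  exact (TemperedDistribution.fourierMultiplierCLM ℂ (derivSymbol k)).map_tsum hu

theorem partialD_dyadic {m : Rn n → ℝ} (hm : IsCutoff m) (k : Fin n) (j : ℤ) (u : 𝓢'(Rn n, ℂ)) :
    LittlewoodPaley.partialD k (LittlewoodPaley.dyadic m j u) =
      LittlewoodPaley.dyadic m j (LittlewoodPaley.partialD k u) := by
  simp only [partialD_eq, dyadic_eq]
  rw [TemperedDistribution.fourierMultiplierCLM_fourierMultiplierCLM_apply
      (hm.hasTemperateGrowth_symbol j) (hasTemperateGrowth_derivSymbol k),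
    TemperedDistribution.fourierMultiplierCLM_fourierMultiplierCLM_apply
      (hasTemperateGrowth_derivSymbol k) (hm.hasTemperateGrowth_symbol j), mul_comm]

end Symbols

/-- The Fourier transform of `u` is the function `G`, and both `G` and `|ξ| G` are integrable. -/
structure HasSpectrum₁ (u : 𝓢'(Rn n, ℂ)) (G : Rn n → ℂ) : Prop where
  hasSpectrum : HasSpectrum u G
  integrable_norm_mul : Integrable fun ξ ↦ ‖ξ‖ * ‖G ξ‖

theorem HasSpectrum₁.integrable_deriv {u : 𝓢'(Rn n, ℂ)} {G : Rn n → ℂ} (h : HasSpectrum₁ u G)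
    (k : Fin n) : Integrable fun ξ ↦ derivSymbol k ξ * G ξ := by
  refine (h.integrable_norm_mul.const_mul (2 * Real.pi)).mono'
    ((contDiff_derivSymbol k).continuous.aestronglyMeasurable.mul h.1.1.1) (ae_of_all _ fun ξ ↦ ?_)
  rw [norm_mul, ← mul_assoc]
  exact mul_le_mul_of_nonneg_right (norm_derivSymbol_le k ξ) (norm_nonneg _)

theorem HasSpectrum₁.partialD {u : 𝓢'(Rn n, ℂ)} {G : Rn n → ℂ} (h : HasSpectrum₁ u G)
    (k : Fin n) : HasSpectrum (partialD k u) (fun ξ ↦ derivSymbol k ξ * G ξ) :=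
  h.1.partialD k (h.integrable_deriv k)

theorem HasSpectrum₁.dyadic {m : Rn n → ℝ} (hm : IsCutoff m) {u : 𝓢'(Rn n, ℂ)} {G : Rn n → ℂ}
    (h : HasSpectrum₁ u G) (j : ℤ) :
    HasSpectrum₁ (dyadic m j u) (fun ξ ↦ dyadicSymbol m j ξ * G ξ) := by
  refine ⟨h.1.dyadic hm j, ?_⟩
  obtain ⟨C, hC⟩ := hm.exists_bound
  refine (h.integrable_norm_mul.bdd_mul (c := C) (f := fun ξ ↦ ‖dyadicSymbol m j ξ‖)
    (hm.contDiff_symbol j).continuous.norm.aestronglyMeasurable (ae_of_all _ fun ξ ↦ ?_)).congr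
      (ae_of_all _ fun ξ ↦ ?_)
  · simpa [dyadicSymbol] using hC _
  · simp only [norm_mul]; ring

/-- For a distribution with integrable spectrum, frequency localization makes the first moment of
the spectrum integrable. -/
theorem HasSpectrum.dyadic₁ {m : Rn n → ℝ} (hm : IsCutoff m) {u : 𝓢'(Rn n, ℂ)} {G : Rn n → ℂ}
    (h : HasSpectrum u G) (j : ℤ) :
    HasSpectrum₁ (LittlewoodPaley.dyadic m j u) (fun ξ ↦ dyadicSymbol m j ξ * G ξ) := by
  refine ⟨h.dyadic hm j, ?_⟩
  have hc : HasCompactSupport (fun ξ ↦ ‖ξ‖ * ‖dyadicSymbol m j ξ‖) :=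
    (hm.compact_symbol j).norm.mul_left
  have hcont : Continuous (fun ξ : Rn n ↦ ‖ξ‖ * ‖dyadicSymbol m j ξ‖) :=
    continuous_norm.mul (hm.contDiff_symbol j).continuous.norm
  obtain ⟨C, hC⟩ := hc.exists_bound_of_continuous hcont
  refine (h.1.norm.bdd_mul (c := C) hcont.aestronglyMeasurable (ae_of_all _ hC)).congr
    (ae_of_all _ fun ξ ↦ ?_)
  simp only [norm_mul]; ring

/-- The Leibniz rule. -/
theorem HasSpectrum₁.partialD_distMul {u w : 𝓢'(Rn n, ℂ)} {G H : Rn n → ℂ}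
    (hu : HasSpectrum₁ u G) (hw : HasSpectrum₁ w H) (k : Fin n) :
    LittlewoodPaley.partialD k (distMul u w) =
      distMul (LittlewoodPaley.partialD k u) w + distMul u (LittlewoodPaley.partialD k w) := by
  have h1 := ((hu.partialD k).distMul hw.1).add (hu.1.distMul (hw.partialD k))
  have h2 := convolution_coord_mul hu.1.1 hw.1.1 (derivSymbol_add k) (hu.integrable_deriv k)
    (hw.integrable_deriv k)
  exact ((hu.1.distMul hw.1).partialD k (h1.1.congr h2.symm)).eq (h1.congr h2.symm)

theorem HasSpectrum.dyadic_distMul_eq_zero {m : Rn n → ℝ} (hm : IsCutoff m) (j : ℤ)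
    {u w : 𝓢'(Rn n, ℂ)} {G H : Rn n → ℂ} (hu : HasSpectrum u G) (hw : HasSpectrum w H)
    (h : ∀ ξ η, G ξ ≠ 0 → H η ≠ 0 → dyadicSymbol m j (ξ + η) = 0) :
    LittlewoodPaley.dyadic m j (LittlewoodPaley.distMul u w) = 0 := by
  refine ((hu.distMul hw).dyadic hm j).eq (HasSpectrum.zero.congr (ae_of_all _ fun ξ ↦ ?_))
  exact (mul_convolution_eq_zero h ξ).symm

/-! ### Integrability of the spectrum from Sobolev regularity -/

section Sobolev

variable {F : Type*} [NormedAddCommGroup F] [NormedSpace ℂ F]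

theorem one_add_pow_le_mul (M : ℕ) {t : ℝ} (ht : 0 ≤ t) :
    (1 + t) ^ M ≤ 2 ^ M * (1 + t ^ M) := by
  rcases le_total t 1 with h | h
  · calc (1 + t) ^ M ≤ 2 ^ M := pow_le_pow_left₀ (by linarith) (by linarith) M
      _ ≤ 2 ^ M * (1 + t ^ M) := le_mul_of_one_le_right (by positivity)
          (by have := pow_nonneg ht M; linarith)
  · calc (1 + t) ^ M ≤ (2 * t) ^ M := pow_le_pow_left₀ (by linarith) (by linarith) M
      _ = 2 ^ M * t ^ M := mul_pow _ _ _
      _ ≤ 2 ^ M * (1 + t ^ M) := by gcongr; linarith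

theorem memLp_two_one_add_norm_inv_pow :
    MemLp (fun ξ : Rn n ↦ ((1 + ‖ξ‖) ^ (n + 1))⁻¹) 2 volume := by
  have hc : Continuous (fun ξ : Rn n ↦ ((1 + ‖ξ‖) ^ (n + 1))⁻¹) :=
    ((continuous_const.add continuous_norm).pow _).inv₀ fun ξ ↦
      (pow_pos (add_pos_of_pos_of_nonneg one_pos (norm_nonneg ξ)) _).ne'
  rw [memLp_two_iff_integrable_sq hc.aestronglyMeasurable]
  have h := integrable_one_add_norm (E := Rn n) (μ := volume) (r := 2 * (n + 1))
    (by simp; linarith)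
  refine h.congr (ae_of_all _ fun ξ ↦ ?_)
  have h0 : (0 : ℝ) ≤ 1 + ‖ξ‖ := by positivity
  simp only
  rw [Real.rpow_neg h0, inv_pow, ← pow_mul, ← Real.rpow_natCast]
  congr 2
  push_cast
  ring

/-- Cauchy–Schwarz: (1+|ξ|)|G| is at most a constant times the square-integrable weight
(1+|ξ|)^{-(n+1)} times |G| + |ξ|^{n+2}|G|, which is in L². -/
theorem MemHdotInter.exists_integrable [CompleteSpace F] {u : 𝓢'(Rn n, F)}
    (hu : MemHdotInter u) : ∃ G : Rn n → F, RepresentedBy (𝓕 u) G ∧ Integrable G ∧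
      Integrable fun ξ ↦ ‖ξ‖ * ‖G ξ‖ := by
  obtain ⟨G, -, hG, hG2⟩ := hu 0 le_rfl
  -- Of the n + 2 powers, n + 1 pay for the weight, whose square decays at the rate 2(n+1) > n, and
  -- one is left for the first moment.
  obtain ⟨G', -, hG', hG2'⟩ := hu ((n + 2 : ℕ) : ℝ) (by positivity)
  have hm : AEStronglyMeasurable G volume := hG.locallyIntegrable.aestronglyMeasurable
  have h1 : MemLp (fun ξ ↦ ‖G ξ‖) 2 volume := by
    have : MemLp G 2 volume := by simpa using hG2
    exact this.norm
  have h2 : MemLp (fun ξ ↦ ‖ξ‖ ^ (n + 2) * ‖G ξ‖) 2 volume := by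
    refine (hG2'.norm.ae_eq ?_)
    filter_upwards [hG.ae_eq hG'] with ξ hξ
    rw [norm_smul, ← hξ, Real.rpow_natCast]
    simp
  have h3 : Integrable fun ξ ↦ ((1 + ‖ξ‖) ^ (n + 1))⁻¹ * (‖G ξ‖ + ‖ξ‖ ^ (n + 2) * ‖G ξ‖) :=
    memLp_two_one_add_norm_inv_pow.integrable_mul (h1.add h2)
  have h4 : ∀ ξ : Rn n, (1 + ‖ξ‖) * ‖G ξ‖ ≤
      2 ^ (n + 2) * (((1 + ‖ξ‖) ^ (n + 1))⁻¹ * (‖G ξ‖ + ‖ξ‖ ^ (n + 2) * ‖G ξ‖)) := fun ξ ↦ by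
    have hp : 0 < (1 + ‖ξ‖) ^ (n + 1) := by positivity
    have := one_add_pow_le_mul (n + 2) (norm_nonneg ξ)
    have e : (1 + ‖ξ‖) * ‖G ξ‖ =
        ((1 + ‖ξ‖) ^ (n + 1))⁻¹ * ((1 + ‖ξ‖) ^ (n + 2) * ‖G ξ‖) := by
      field_simp; ring
    rw [e, mul_left_comm ((2 : ℝ) ^ (n + 2))]
    refine mul_le_mul_of_nonneg_left ?_ (inv_pos.2 hp).le
    calc _ ≤ 2 ^ (n + 2) * (1 + ‖ξ‖ ^ (n + 2)) * ‖G ξ‖ :=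
          mul_le_mul_of_nonneg_right this (norm_nonneg _)
      _ = _ := by ring
  refine ⟨G, hG, ?_, ?_⟩
  · refine (h3.const_mul (2 ^ (n + 2))).mono' hm (ae_of_all _ fun ξ ↦ le_trans ?_ (h4 ξ))
    nlinarith [norm_nonneg ξ, norm_nonneg (G ξ)]
  · refine (h3.const_mul (2 ^ (n + 2))).mono'
      (continuous_norm.aestronglyMeasurable.mul hm.norm) (ae_of_all _ fun ξ ↦ le_trans ?_ (h4 ξ))
    rw [Real.norm_of_nonneg (mul_nonneg (norm_nonneg ξ) (norm_nonneg (G ξ)))]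
    nlinarith [norm_nonneg ξ, norm_nonneg (G ξ)]

theorem MemHdotInter.exists_hasSpectrum₁ {u : 𝓢'(Rn n, ℂ)} (hu : MemHdotInter u) :
    ∃ G, HasSpectrum₁ u G := by
  obtain ⟨G, h1, h2, h3⟩ := hu.exists_integrable
  exact ⟨G, (hasSpectrum_iff_fourier h2).2 h1, h3⟩

theorem RepresentedBy.component {v : 𝓢'(Rn n, EuclideanSpace ℂ (Fin n))}
    {g : Rn n → EuclideanSpace ℂ (Fin n)} (h : RepresentedBy v g) (k : Fin n) :
    RepresentedBy (component v k) (fun x ↦ g x k) := by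
  intro θ
  have h1 := (EuclideanSpace.proj k : EuclideanSpace ℂ (Fin n) →L[ℂ] ℂ).integrable_comp (h θ).1
  refine ⟨by simpa using h1, ?_⟩
  have h2 := (EuclideanSpace.proj k : EuclideanSpace ℂ (Fin n) →L[ℂ] ℂ).integral_comp_comm (h θ).1
  rw [← (h θ).2] at h2
  simp only [smul_eq_mul]
  exact h2.symm

theorem MemHdotInter.exists_hasSpectrum₁_component
    {v : 𝓢'(Rn n, EuclideanSpace ℂ (Fin n))} (hv : MemHdotInter v) (k : Fin n) :
    ∃ G, HasSpectrum₁ (component v k) G := by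
  obtain ⟨G, h1, h2, h3⟩ := hv.exists_integrable
  have hi : Integrable (fun x ↦ G x k) := by
    simpa using (EuclideanSpace.proj k : EuclideanSpace ℂ (Fin n) →L[ℂ] ℂ).integrable_comp h2
  refine ⟨fun x ↦ G x k, (hasSpectrum_iff_fourier hi).2 (h1.component k), ?_⟩
  refine h3.mono' (continuous_norm.aestronglyMeasurable.mul hi.1.norm) (ae_of_all _ fun ξ ↦ ?_)
  rw [norm_mul, norm_norm, norm_norm]
  exact mul_le_mul_of_nonneg_left (PiLp.norm_apply_le _ k) (norm_nonneg _)

end Sobolev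

end LittlewoodPaley

namespace LittlewoodPaley

open FourierTransform Filter Topology
open scoped Convolution

/-! ### Minkowski's integral inequality -/

section Minkowski

variable {X Y : Type*} [MeasurableSpace X] [MeasurableSpace Y] {μ : Measure X} {ν : Measure Y}

/-- Minkowski's integral inequality for a family with uniformly bounded `L^p` norms. -/
theorem eLpNorm_lintegral_le_of_isFiniteMeasure [SFinite μ] [IsFiniteMeasure ν]
    {H : X → Y → ℝ≥0∞} (hH : Measurable (Function.uncurry H)) {p : ℝ≥0∞} (hp : 1 ≤ p) {M : ℝ≥0∞}
    (hM : ∀ y, eLpNorm (fun x ↦ H x y) p μ ≤ M) :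
    eLpNorm (fun x ↦ ∫⁻ y, H x y ∂ν) p μ ≤ ν Set.univ * M := by
  rcases eq_or_ne p ⊤ with rfl | hp'
  · have h1 : ∀ᵐ x ∂μ, ∀ᵐ y ∂ν, H x y ≤ M := by
      rw [Measure.ae_ae_comm (p := fun x y ↦ H x y ≤ M) (measurableSet_le hH measurable_const)]
      refine ae_of_all _ fun y ↦ ?_
      have := hM y
      rw [eLpNorm_exponent_top] at this
      filter_upwards [ae_le_eLpNormEssSup (f := fun x ↦ H x y) (μ := μ)] with x hx
      exact hx.trans this
    rw [eLpNorm_exponent_top]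
    refine eLpNormEssSup_le_of_ae_enorm_bound ?_
    filter_upwards [h1] with x hx
    calc ∫⁻ y, H x y ∂ν ≤ ∫⁻ _, M ∂ν := lintegral_mono_ae hx
      _ = ν Set.univ * M := by rw [lintegral_const, mul_comm]
  · have hp0 : p ≠ 0 := (one_pos.trans_le hp).ne'
    set P := p.toReal with hP
    have hP1 : 1 ≤ P := by
      rw [hP, ← ENNReal.toReal_one]; exact ENNReal.toReal_mono hp' hp
    have hP0 : 0 < P := by linarith
    -- Jensen's inequality on the finite measure ν. Since the L^p norms are bounded uniformly in y,
    -- Tonelli's theorem then finishes the proof without duality.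
    have hx1 : ∀ x, (∫⁻ y, H x y ∂ν) ^ P ≤ ν Set.univ ^ (P - 1) * ∫⁻ y, H x y ^ P ∂ν := fun x ↦ by
      have h := eLpNorm_le_eLpNorm_mul_rpow_measure_univ (μ := ν) (f := H x) hp
        (hH.of_uncurry_left (x := x)).aestronglyMeasurable
      rw [eLpNorm_one_eq_lintegral_enorm, eLpNorm_eq_lintegral_rpow_enorm_toReal hp0 hp'] at h
      simp only [enorm_eq_self, ← hP, ENNReal.toReal_one] at h
      refine (ENNReal.rpow_le_rpow h hP0.le).trans_eq ?_
      rw [ENNReal.mul_rpow_of_nonneg _ _ hP0.le, ← ENNReal.rpow_mul, ← ENNReal.rpow_mul,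
        div_mul_cancel₀ _ hP0.ne', ENNReal.rpow_one, mul_comm]
      congr 2
      field_simp
    rw [eLpNorm_eq_lintegral_rpow_enorm_toReal hp0 hp']
    simp only [enorm_eq_self, ← hP]
    rw [one_div, ENNReal.rpow_inv_le_iff hP0]
    have hMP : ∀ y, ∫⁻ x, H x y ^ P ∂μ ≤ M ^ P := fun y ↦ by
      have := hM y
      rw [eLpNorm_eq_lintegral_rpow_enorm_toReal hp0 hp'] at this
      simp only [enorm_eq_self, ← hP] at this
      rwa [one_div, ENNReal.rpow_inv_le_iff hP0] at this
    calc ∫⁻ x, (∫⁻ y, H x y ∂ν) ^ P ∂μ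
        ≤ ∫⁻ x, ν Set.univ ^ (P - 1) * ∫⁻ y, H x y ^ P ∂ν ∂μ := lintegral_mono hx1
      _ = ν Set.univ ^ (P - 1) * ∫⁻ x, ∫⁻ y, H x y ^ P ∂ν ∂μ :=
          lintegral_const_mul _ ((hH.pow_const P).lintegral_prod_right')
      _ = ν Set.univ ^ (P - 1) * ∫⁻ y, ∫⁻ x, H x y ^ P ∂μ ∂ν := by
          rw [lintegral_lintegral_swap (hH.pow_const P).aemeasurable]
      _ ≤ ν Set.univ ^ (P - 1) * ∫⁻ _, M ^ P ∂ν := by gcongr with y; exact hMP y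
      _ = ν Set.univ ^ (P - 1) * ν Set.univ ^ (1 : ℝ) * M ^ P := by
          rw [lintegral_const, ENNReal.rpow_one, mul_comm (M ^ P), mul_assoc]
      _ = (ν Set.univ * M) ^ P := by
          rw [← ENNReal.rpow_add_of_nonneg _ _ (by linarith) zero_le_one,
            ENNReal.mul_rpow_of_nonneg _ _ hP0.le]
          simp

/-- Taking k as a density turns ν into a finite measure of total mass ∫ k. -/
theorem eLpNorm_lintegral_mul_le [SFinite μ] [SFinite ν] {k : Y → ℝ≥0∞} (hk : Measurable k)
    (hk' : ∫⁻ y, k y ∂ν ≠ ⊤)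
    {H : X → Y → ℝ≥0∞} (hH : Measurable (Function.uncurry H)) {p : ℝ≥0∞} (hp : 1 ≤ p) {M : ℝ≥0∞}
    (hM : ∀ y, eLpNorm (fun x ↦ H x y) p μ ≤ M) :
    eLpNorm (fun x ↦ ∫⁻ y, k y * H x y ∂ν) p μ ≤ (∫⁻ y, k y ∂ν) * M := by
  have : IsFiniteMeasure (ν.withDensity k) := isFiniteMeasure_withDensity hk'
  have h := eLpNorm_lintegral_le_of_isFiniteMeasure (ν := ν.withDensity k) hH hp hM
  rw [withDensity_apply _ MeasurableSet.univ, Measure.restrict_univ] at h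
  refine le_of_eq_of_le ?_ h
  congr 1
  funext x
  rw [lintegral_withDensity_eq_lintegral_mul _ hk hH.of_uncurry_left]
  rfl

end Minkowski

variable {n : ℕ}

/-! ### Multipliers as superpositions of translations -/

section Kernel

theorem continuous_fourierChar_coe : Continuous (fun t : ℝ ↦ (Real.fourierChar t : ℂ)) :=
  (by fun_prop : Continuous fun z : Circle ↦ (z : ℂ)).comp Real.continuous_fourierChar

variable {Y : Type*} [MeasurableSpace Y] {ν : Measure Y} [SFinite ν] {K : Y → ℂ} {ρ : Y → Rn n}

/-- A multiplier whose symbol is the Fourier transform of a complex measure acts as a superposition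
of translations. -/
theorem fourierInv_kernel_mul (hK : Integrable K ν) (hρ : Measurable ρ) {G : Rn n → ℂ}
    (hG : Integrable G) (x : Rn n) :
    𝓕⁻ (fun ξ ↦ (∫ y, (Real.fourierChar (-inner ℝ (ρ y) ξ) : ℂ) * K y ∂ν) * G ξ) x =
      ∫ y, K y * 𝓕⁻ G (x - ρ y) ∂ν := by
  simp only [Real.fourierInv_eq, Circle.smul_def, smul_eq_mul]
  have h1 : ∀ ξ : Rn n, (Real.fourierChar (inner ℝ ξ x) : ℂ) *
      ((∫ y, (Real.fourierChar (-inner ℝ (ρ y) ξ) : ℂ) * K y ∂ν) * G ξ) =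
      ∫ y, (Real.fourierChar (inner ℝ ξ (x - ρ y)) : ℂ) * (K y * G ξ) ∂ν := fun ξ ↦ by
    rw [← integral_mul_const, ← integral_const_mul]
    refine integral_congr_ae (ae_of_all _ fun y ↦ ?_)
    simp only
    rw [inner_sub_right, sub_eq_add_neg, AddChar.map_add_eq_mul, Circle.coe_mul,
      real_inner_comm (ρ y) ξ]
    ring
  have h2 : ∀ y, K y * ∫ ξ, (Real.fourierChar (inner ℝ ξ (x - ρ y)) : ℂ) * G ξ =
      ∫ ξ, (Real.fourierChar (inner ℝ ξ (x - ρ y)) : ℂ) * (K y * G ξ) := fun y ↦ by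
    rw [← integral_const_mul]
    refine integral_congr_ae (ae_of_all _ fun ξ ↦ ?_)
    simp only
    ring
  simp only [h1, h2]
  refine integral_integral_swap ?_
  have h3 : Integrable (fun z : Rn n × Y ↦ K z.2 * G z.1) (volume.prod ν) := by
    simpa only [mul_comm] using hG.mul_prod hK
  refine h3.bdd_mul (c := 1) ?_ (ae_of_all _ fun z ↦ (Circle.norm_coe _).le)
  refine Measurable.aestronglyMeasurable ?_
  exact continuous_fourierChar_coe.measurable.comp
    (measurable_fst.inner (measurable_const.sub (hρ.comp measurable_snd)))

theorem eLpNorm_translate {f : Rn n → ℂ} (hf : Continuous f) (p : ℝ≥0∞) (h : Rn n) :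
    eLpNorm (fun x ↦ f (x - h)) p volume = eLpNorm f p volume :=
  eLpNorm_comp_measurePreserving hf.aestronglyMeasurable (measurePreserving_sub_right volume h)

theorem eLpNorm_enorm_eq {X : Type*} [MeasurableSpace X] (μ : Measure X) (f : X → ℂ) (p : ℝ≥0∞) :
    eLpNorm (fun x ↦ ‖f x‖ₑ) p μ = eLpNorm f p μ :=
  eLpNorm_congr_enorm_ae (ae_of_all _ fun _ ↦ rfl)

/-- Translations are isometries of L^p, so only the total mass of K counts and not the map ρ. With ρ
y = t • y the bound is independent of the dilation t; with ρ τ = τ • h it controls averages along a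
segment. -/
theorem eLpNorm_kernel_le (hK : Integrable K ν) (hK' : Measurable K) (hρ : Measurable ρ)
    {G : Rn n → ℂ} (hG : Integrable G) {p : ℝ≥0∞} (hp : 1 ≤ p) :
    eLpNorm (𝓕⁻ (fun ξ ↦ (∫ y, (Real.fourierChar (-inner ℝ (ρ y) ξ) : ℂ) * K y ∂ν) * G ξ)) p
      volume ≤ (∫⁻ y, ‖K y‖ₑ ∂ν) * eLpNorm (𝓕⁻ G) p volume := by
  have hc := continuous_fourierInv hG
  have h1 : Measurable (Function.uncurry fun (x : Rn n) (y : Y) ↦ ‖𝓕⁻ G (x - ρ y)‖ₑ) :=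
    (hc.measurable.comp (measurable_fst.sub (hρ.comp measurable_snd))).enorm
  refine le_trans ?_ (eLpNorm_lintegral_mul_le (μ := volume) (ν := ν) hK'.enorm hK.2.ne h1 hp
    (M := eLpNorm (𝓕⁻ G) p volume) fun y ↦ ?_)
  · refine eLpNorm_mono_enorm fun x ↦ ?_
    rw [fourierInv_kernel_mul hK hρ hG]
    refine (enorm_integral_le_lintegral_enorm _).trans_eq ?_
    simp only [enorm_mul, enorm_eq_self]
  · rw [eLpNorm_enorm_eq, eLpNorm_translate hc]

theorem schwartz_eq_integral (m : 𝓢(Rn n, ℂ)) (t : ℝ) (ξ : Rn n) :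
    m (t • ξ) = ∫ y, (Real.fourierChar (-inner ℝ (t • y) ξ) : ℂ) * (𝓕⁻ m) y := by
  have h : m (t • ξ) = 𝓕 (𝓕⁻ m) (t • ξ) := by rw [FourierTransform.fourier_fourierInv_eq]
  rw [h, SchwartzMap.fourier_coe, Real.fourier_eq]
  simp only [Circle.smul_def, smul_eq_mul, inner_smul_left, inner_smul_right]
  rfl

theorem fourierInv_schwartz_mul (m : 𝓢(Rn n, ℂ)) (t : ℝ) {G : Rn n → ℂ} (hG : Integrable G)
    (x : Rn n) :
    𝓕⁻ (fun ξ ↦ m (t • ξ) * G ξ) x = ∫ y, (𝓕⁻ m) y * 𝓕⁻ G (x - t • y) := by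
  simp only [schwartz_eq_integral m t]
  exact fourierInv_kernel_mul (𝓕⁻ m).integrable (measurable_const_smul t) hG x

theorem eLpNorm_schwartz_mul_le (m : 𝓢(Rn n, ℂ)) (t : ℝ) {G : Rn n → ℂ} (hG : Integrable G)
    {p : ℝ≥0∞} (hp : 1 ≤ p) :
    eLpNorm (𝓕⁻ (fun ξ ↦ m (t • ξ) * G ξ)) p volume ≤
      (∫⁻ y, ‖(𝓕⁻ m) y‖ₑ) * eLpNorm (𝓕⁻ G) p volume := by
  simp only [schwartz_eq_integral m t]
  exact eLpNorm_kernel_le (𝓕⁻ m).integrable (𝓕⁻ m).continuous.measurable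
    (measurable_const_smul t) hG hp

end Kernel

/-! ### Differences of translates -/

section Difference

/-- The fundamental theorem of calculus for τ ↦ e^{-2πiτs} on [0, 1]. -/
theorem one_sub_fourierChar (s : ℝ) :
    1 - (Real.fourierChar (-s) : ℂ) = 2 * Real.pi * Complex.I * s *
      ∫ τ in Set.Ioc (0 : ℝ) 1, (Real.fourierChar (-(τ * s)) : ℂ) := by
  rw [← intervalIntegral.integral_of_le zero_le_one]
  rcases eq_or_ne s 0 with rfl | hs
  · simp
  have hc : (-(2 * Real.pi * Complex.I * s) : ℂ) ≠ 0 := by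
    simp [hs, Real.pi_ne_zero]
  have h := integral_exp_mul_complex (a := 0) (b := 1) hc
  have e : ∀ τ : ℝ, (Real.fourierChar (-(τ * s)) : ℂ) =
      Complex.exp (-(2 * Real.pi * Complex.I * s) * τ) := fun τ ↦ by
    rw [Real.fourierChar_apply]; congr 1; push_cast; ring
  simp only [e, h]
  have e1 := e 1
  simp only [one_mul] at e1
  rw [e1]
  have hc' : (2 * Real.pi * Complex.I * s : ℂ) ≠ 0 := neg_ne_zero.1 hc
  rw [div_neg, mul_neg, mul_div_cancel₀ _ hc']
  simp

theorem fourierInv_add' {G H : Rn n → ℂ} (hG : Integrable G) (hH : Integrable H) (x : Rn n) :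
    𝓕⁻ (G + H) x = 𝓕⁻ G x + 𝓕⁻ H x := by
  simp only [Real.fourierInv_eq, Pi.add_apply, smul_add]
  refine integral_add ?_ ?_
  · have := (Real.fourierIntegral_convergent_iff (-x)).2 hG
    simpa using this
  · have := (Real.fourierIntegral_convergent_iff (-x)).2 hH
    simpa using this

theorem fourierInv_const_mul (c : ℂ) (G : Rn n → ℂ) (x : Rn n) :
    𝓕⁻ (fun ξ ↦ c * G ξ) x = c * 𝓕⁻ G x := by
  simp only [Real.fourierInv_eq, Circle.smul_def, smul_eq_mul]
  rw [← integral_const_mul]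
  exact integral_congr_ae (ae_of_all _ fun ξ ↦ by simp only; ring)

theorem fourierInv_finset_sum {ι : Type*} (s : Finset ι) {G : ι → Rn n → ℂ}
    (hG : ∀ i ∈ s, Integrable (G i)) (x : Rn n) :
    𝓕⁻ (fun ξ ↦ ∑ i ∈ s, G i ξ) x = ∑ i ∈ s, 𝓕⁻ (G i) x := by
  simp only [Real.fourierInv_eq, Finset.smul_sum]
  refine integral_finsetSum s fun i hi ↦ ?_
  have := (Real.fourierIntegral_convergent_iff (-x)).2 (hG i hi)
  simpa using this

theorem fourierInv_translate {G : Rn n → ℂ} (h x : Rn n) :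
    𝓕⁻ (fun ξ ↦ (Real.fourierChar (-inner ℝ h ξ) : ℂ) * G ξ) x = 𝓕⁻ G (x - h) := by
  simp only [Real.fourierInv_eq, Circle.smul_def, smul_eq_mul]
  refine integral_congr_ae (ae_of_all _ fun ξ ↦ ?_)
  simp only
  rw [inner_sub_right, sub_eq_add_neg, AddChar.map_add_eq_mul, Circle.coe_mul, real_inner_comm h ξ]
  ring

theorem inner_eq_sum_coord (h ξ : Rn n) : inner ℝ h ξ = ∑ l, h l * ξ l := by
  simp [PiLp.inner_apply, mul_comm]

/-- The mean value formula f(x) - f(x-h) = Σ_l h_l ∫₀¹ ∂_l f(x - τh) dτ, carried out on symbols;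
each average over τ is a superposition of translations of total mass 1. -/
theorem eLpNorm_sub_translate_le {u : 𝓢'(Rn n, ℂ)} {G : Rn n → ℂ} (hG : HasSpectrum₁ u G)
    (h : Rn n) {p : ℝ≥0∞} (hp : 1 ≤ p) :
    eLpNorm (fun x ↦ 𝓕⁻ G x - 𝓕⁻ G (x - h)) p volume ≤
      ‖h‖ₑ * ∑ l, eLpNorm (𝓕⁻ (fun ξ ↦ derivSymbol l ξ * G ξ)) p volume := by
  have hGi := hG.1.1
  set μ : Measure ℝ := volume.restrict (Set.Ioc (0 : ℝ) 1)
  have hρ : Measurable (fun τ : ℝ ↦ τ • h) := by fun_prop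
  have hK : Integrable (fun _ : ℝ ↦ (1 : ℂ)) μ := integrable_const 1
  -- The spectrum of the average of ∂_l f over the segment from x - h to x.
  let T : Fin n → Rn n → ℂ := fun l ξ ↦
    (∫ τ, (Real.fourierChar (-inner ℝ (τ • h) ξ) : ℂ) * 1 ∂μ) * (derivSymbol l ξ * G ξ)
  have hTm : ∀ ξ : Rn n, ‖∫ τ, (Real.fourierChar (-inner ℝ (τ • h) ξ) : ℂ) * 1 ∂μ‖ ≤ 1 :=
    fun ξ ↦ by
      refine (norm_integral_le_of_norm_le_const (C := 1) (ae_of_all _ fun τ ↦ ?_)).trans ?_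
      · rw [mul_one]; exact (Circle.norm_coe _).le
      · simp [μ]
  have hTi : ∀ l, Integrable (T l) := fun l ↦ by
    refine (hG.integrable_deriv l).bdd_mul (c := 1) ?_ (ae_of_all _ hTm)
    refine Continuous.aestronglyMeasurable ?_
    refine continuous_of_dominated (bound := fun _ ↦ 1) (fun ξ ↦ ?_) (fun ξ ↦ ?_)
      (integrable_const 1) (ae_of_all _ fun τ ↦ ?_)
    · exact ((continuous_fourierChar_coe.comp (by fun_prop)).mul continuous_const).aestronglyMeasurable
    · exact ae_of_all _ fun τ ↦ by rw [mul_one]; exact (Circle.norm_coe _).le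
    · exact (continuous_fourierChar_coe.comp (by fun_prop)).mul continuous_const
  have key : ∀ x, 𝓕⁻ G x - 𝓕⁻ G (x - h) = ∑ l, (h l : ℂ) * 𝓕⁻ (T l) x := fun x ↦ by
    have e1 : 𝓕⁻ G x = 𝓕⁻ (fun ξ ↦ (Real.fourierChar (-inner ℝ h ξ) : ℂ) * G ξ) x +
        𝓕⁻ (fun ξ ↦ ∑ l, (h l : ℂ) * T l ξ) x := by
      rw [← fourierInv_add']
      · refine congrArg (fun g : Rn n → ℂ ↦ 𝓕⁻ g x) (funext fun ξ ↦ ?_)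
        have h1 := one_sub_fourierChar (inner ℝ h ξ)
        have h2 : ∑ l, (h l : ℂ) * T l ξ = (1 - (Real.fourierChar (-inner ℝ h ξ) : ℂ)) * G ξ := by
          rw [h1, inner_eq_sum_coord]
          simp only [T, derivSymbol, mul_one, inner_smul_left, inner_eq_sum_coord]
          push_cast
          simp only [Finset.mul_sum, Finset.sum_mul]
          refine Finset.sum_congr rfl fun l _ ↦ ?_
          simp only [μ, Real.ringHom_apply]
          ring
        rw [Pi.add_apply, h2]
        ring
      · refine hGi.bdd_mul (c := 1) ?_ (ae_of_all _ fun z ↦ (Circle.norm_coe _).le)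
        exact (continuous_fourierChar_coe.comp (by fun_prop)).aestronglyMeasurable
      · exact integrable_finsetSum _ fun l _ ↦ (hTi l).const_mul _
    rw [fourierInv_translate, fourierInv_finset_sum _ fun l _ ↦ (hTi l).const_mul _] at e1
    rw [e1]
    simp only [fourierInv_const_mul]
    ring
  have e : (fun x ↦ 𝓕⁻ G x - 𝓕⁻ G (x - h)) = ∑ l, (h l : ℂ) • 𝓕⁻ (T l) := by
    funext x; rw [key]; simp
  rw [e]
  refine (eLpNorm_sum_le (fun l _ ↦
    ((continuous_fourierInv (hTi l)).const_smul _).aestronglyMeasurable) hp).trans ?_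
  rw [Finset.mul_sum]
  refine Finset.sum_le_sum fun l _ ↦ ?_
  rw [eLpNorm_const_smul]
  refine mul_le_mul' ?_ ?_
  · rw [← ofReal_norm, ← ofReal_norm]
    refine ENNReal.ofReal_le_ofReal ?_
    rw [Complex.norm_real]
    exact norm_coord_le h l
  · refine (eLpNorm_kernel_le hK measurable_const hρ (hG.integrable_deriv l) hp).trans_eq ?_
    simp [μ]

end Difference

end LittlewoodPaley

namespace LittlewoodPaley

open FourierTransform Filter Topology
open scoped Convolution

variable {n : ℕ}

/-! ### The commutator of a multiplier with a function -/

section Commutator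

/-- Both terms are integrals against the same kernel at the same translates of 𝓕⁻ W; they differ
only in whether the factor 𝓕⁻ A is evaluated at x or at x - ty. -/
theorem commutator_eq_integral (m : 𝓢(Rn n, ℂ)) (t : ℝ) {A W : Rn n → ℂ} (hA : Integrable A)
    (hW : Integrable W) (x : Rn n) :
    𝓕⁻ A x * 𝓕⁻ (fun ξ ↦ m (t • ξ) * W ξ) x -
      𝓕⁻ (fun ξ ↦ m (t • ξ) * (A ⋆[ContinuousLinearMap.mul ℂ ℂ, volume] W) ξ) x =
    ∫ y, (𝓕⁻ m) y * ((𝓕⁻ A x - 𝓕⁻ A (x - t • y)) * 𝓕⁻ W (x - t • y)) := by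
  rw [fourierInv_schwartz_mul m t hW, fourierInv_schwartz_mul m t (hA.integrable_convolution _ hW),
    ← integral_const_mul]
  have hb : ∀ {f : Rn n → ℂ} (_ : Continuous f) (C : ℝ) (_ : ∀ x, ‖f x‖ ≤ C),
      Integrable fun y ↦ (𝓕⁻ m) y * f (x - t • y) := fun {f} hf C hC ↦
    (𝓕⁻ m).integrable.mul_bdd (c := C)
      (hf.comp (by fun_prop : Continuous fun y : Rn n ↦ x - t • y)).aestronglyMeasurable
      (ae_of_all _ fun y ↦ hC _)
  rw [← integral_sub]
  · refine integral_congr_ae (ae_of_all _ fun y ↦ ?_)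
    simp only [fourierInv_convolution hA hW]
    ring
  · exact (hb (continuous_fourierInv hW) _ (norm_fourierInv_le W)).const_mul _
  · exact hb (continuous_fourierInv (hA.integrable_convolution _ hW)) _ (norm_fourierInv_le _)

theorem lintegral_enorm_mul_enorm_lt_top (K : 𝓢(Rn n, ℂ)) : ∫⁻ y, ‖K y‖ₑ * ‖y‖ₑ < ⊤ := by
  have h := K.integrable_pow_mul volume 1
  have h2 := h.2
  refine lt_of_eq_of_lt (lintegral_congr fun y ↦ ?_) h2
  simp only [pow_one, enorm_mul, enorm_norm]
  rw [mul_comm]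

theorem eLpNorm_commutator_le (m : 𝓢(Rn n, ℂ)) (t : ℝ) {a : 𝓢'(Rn n, ℂ)} {A W : Rn n → ℂ}
    (hA : HasSpectrum₁ a A) (hW : Integrable W) {p p₁ p₂ : ℝ≥0∞} (hp : 1 ≤ p) (hp₁ : 1 ≤ p₁)
    (hpp : p⁻¹ = p₁⁻¹ + p₂⁻¹) :
    eLpNorm (fun x ↦ 𝓕⁻ A x * 𝓕⁻ (fun ξ ↦ m (t • ξ) * W ξ) x -
      𝓕⁻ (fun ξ ↦ m (t • ξ) * (A ⋆[ContinuousLinearMap.mul ℂ ℂ, volume] W) ξ) x) p volume ≤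
    (∫⁻ y, ‖(𝓕⁻ m) y‖ₑ * ‖y‖ₑ) * ‖t‖ₑ *
      ((∑ l, eLpNorm (𝓕⁻ (fun ξ ↦ derivSymbol l ξ * A ξ)) p₁ volume) *
        eLpNorm (𝓕⁻ W) p₂ volume) := by
  have hcA := continuous_fourierInv hA.1.1
  have hcW := continuous_fourierInv hW
  have hK : Measurable fun y ↦ ‖(𝓕⁻ m) y‖ₑ * ‖t • y‖ₑ :=
    (𝓕⁻ m).continuous.measurable.enorm.mul (measurable_const_smul t).enorm
  have hKt : ∫⁻ y, ‖(𝓕⁻ m) y‖ₑ * ‖t • y‖ₑ = (∫⁻ y, ‖(𝓕⁻ m) y‖ₑ * ‖y‖ₑ) * ‖t‖ₑ := by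
    rw [← lintegral_mul_const' _ _ enorm_ne_top]
    refine lintegral_congr fun y ↦ ?_
    rw [enorm_smul]; ring
  -- The difference quotient of 𝓕⁻ A. Its L^{p₁} norm is bounded uniformly in y, as Minkowski's
  -- inequality requires, and the factor |ty| goes to the kernel, where it produces the first moment
  -- and the gain |t|. At ty = 0 the convention 0⁻¹ = 0 is harmless because the difference vanishes.
  let φ : Rn n → Rn n → ℂ := fun y x ↦
    ((‖t • y‖⁻¹ : ℝ) : ℂ) * (𝓕⁻ A x - 𝓕⁻ A (x - t • y))
  have hφc : Continuous (Function.uncurry fun x y : Rn n ↦ 𝓕⁻ A x - 𝓕⁻ A (x - t • y)) :=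
    (hcA.comp continuous_fst).sub
      (hcA.comp (continuous_fst.sub (continuous_snd.const_smul t)))
  have hφm : Measurable (Function.uncurry fun x y : Rn n ↦ ‖φ y x * 𝓕⁻ W (x - t • y)‖ₑ) := by
    refine (Measurable.mul (Measurable.mul ?_ hφc.measurable) ?_).enorm
    · exact Complex.measurable_ofReal.comp ((measurable_snd.const_smul t).norm.inv)
    · exact (hcW.comp (continuous_fst.sub (continuous_snd.const_smul t))).measurable
  have hM : ∀ y, eLpNorm (fun x ↦ ‖φ y x * 𝓕⁻ W (x - t • y)‖ₑ) p volume ≤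
      (∑ l, eLpNorm (𝓕⁻ (fun ξ ↦ derivSymbol l ξ * A ξ)) p₁ volume) *
        eLpNorm (𝓕⁻ W) p₂ volume := fun y ↦ by
    have : p₁.HolderTriple p₂ p := ⟨hpp.symm⟩
    have hd : Continuous fun x ↦ 𝓕⁻ A x - 𝓕⁻ A (x - t • y) :=
      hcA.sub (hcA.comp (continuous_id.sub continuous_const))
    have hφy : φ y = ((‖t • y‖⁻¹ : ℝ) : ℂ) • fun x ↦ 𝓕⁻ A x - 𝓕⁻ A (x - t • y) := rfl
    rw [eLpNorm_enorm_eq]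
    refine (eLpNorm_smul_le_mul_eLpNorm (p := p₁) (q := p₂) (φ := φ y)
      (f := fun x ↦ 𝓕⁻ W (x - t • y))
      (hcW.comp (continuous_id.sub continuous_const)).aestronglyMeasurable ?_).trans ?_
    · rw [hφy]; exact (hd.const_smul _).aestronglyMeasurable
    · rw [eLpNorm_translate hcW]
      gcongr
      rw [hφy, eLpNorm_const_smul]
      refine (mul_le_mul_right (eLpNorm_sub_translate_le hA (t • y) hp₁) _).trans ?_
      rw [← mul_assoc]
      refine mul_le_of_le_one_left zero_le ?_
      rw [← ofReal_norm, ← ofReal_norm, ← ENNReal.ofReal_mul (norm_nonneg _), Complex.norm_real,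
        norm_inv, norm_norm]
      exact ENNReal.ofReal_le_one.2 (inv_mul_le_one)
  have h := eLpNorm_lintegral_mul_le (μ := volume) (ν := volume) hK
    (by rw [hKt]; exact (ENNReal.mul_lt_top (lintegral_enorm_mul_enorm_lt_top _)
      enorm_lt_top).ne) hφm hp hM
  rw [hKt] at h
  refine le_trans (eLpNorm_mono_enorm fun x ↦ ?_) h
  rw [commutator_eq_integral m t hA.1.1 hW, enorm_eq_self]
  refine (enorm_integral_le_lintegral_enorm _).trans (lintegral_mono fun y ↦ ?_)
  simp only [φ, enorm_mul]
  rcases eq_or_ne (t • y) 0 with h0 | h0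
  · simp [h0]
  · have : ‖t • y‖ₑ * ‖((‖t • y‖⁻¹ : ℝ) : ℂ)‖ₑ = 1 := by
      rw [← ofReal_norm, ← ofReal_norm, ← ENNReal.ofReal_mul (norm_nonneg _), Complex.norm_real,
        norm_inv, norm_norm, mul_inv_cancel₀ (norm_ne_zero_iff.2 h0), ENNReal.ofReal_one]
    rw [mul_assoc (‖_‖ₑ), mul_assoc (‖_‖ₑ), ← mul_assoc (‖t • y‖ₑ), this, one_mul]

end Commutator

/-! ### L^p norms of distributions -/

section DistLpNorm

variable {p p₁ p₂ : ℝ≥0∞}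

theorem distLpNorm_zero (p : ℝ≥0∞) : distLpNorm p (0 : 𝓢'(Rn n, ℂ)) = 0 := by
  have h : RepresentedBy (0 : 𝓢'(Rn n, ℂ)) 0 := fun θ ↦ ⟨by simp, by simp⟩
  rw [h.distLpNorm_eq, eLpNorm_zero]

theorem distLpNorm_neg (p : ℝ≥0∞) (u : 𝓢'(Rn n, ℂ)) (hu : ∃ G, HasSpectrum u G) :
    distLpNorm p (-u) = distLpNorm p u := by
  obtain ⟨G, hG⟩ := hu
  have h : RepresentedBy (-u) (-𝓕⁻ G) := fun θ ↦ by
    have := hG.representedBy θ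
    refine ⟨by simpa using! this.1.neg, ?_⟩
    simp only [Pi.neg_apply, smul_neg, integral_neg]
    rw [← this.2]; rfl
  rw [h.distLpNorm_eq, hG.distLpNorm_eq, eLpNorm_neg]

theorem RepresentedBy.add {u w : 𝓢'(Rn n, ℂ)} {f g : Rn n → ℂ} (hu : RepresentedBy u f)
    (hw : RepresentedBy w g) : RepresentedBy (u + w) (f + g) := fun θ ↦ by
  simp only [Pi.add_apply, smul_add]
  refine ⟨(hu θ).1.add (hw θ).1, ?_⟩
  rw [integral_add (hu θ).1 (hw θ).1, ← (hu θ).2, ← (hw θ).2]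
  rfl

theorem RepresentedBy.sub {u w : 𝓢'(Rn n, ℂ)} {f g : Rn n → ℂ} (hu : RepresentedBy u f)
    (hw : RepresentedBy w g) : RepresentedBy (u - w) (fun x ↦ f x - g x) := fun θ ↦ by
  simp only [smul_sub]
  refine ⟨(hu θ).1.sub (hw θ).1, ?_⟩
  rw [integral_sub (hu θ).1 (hw θ).1, ← (hu θ).2, ← (hw θ).2]
  rfl

theorem distLpNorm_add_le (hp : 1 ≤ p) (u w : 𝓢'(Rn n, ℂ)) :
    distLpNorm p (u + w) ≤ distLpNorm p u + distLpNorm p w := by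
  by_cases hu : ∃ f, RepresentedBy u f
  · by_cases hw : ∃ g, RepresentedBy w g
    · obtain ⟨f, hf⟩ := hu
      obtain ⟨g, hg⟩ := hw
      rw [hf.distLpNorm_eq, hg.distLpNorm_eq, (hf.add hg).distLpNorm_eq]
      exact eLpNorm_add_le hf.locallyIntegrable.aestronglyMeasurable
        hg.locallyIntegrable.aestronglyMeasurable hp
    · have : distLpNorm p w = ⊤ := by
        simp only [distLpNorm, iInf_eq_top]
        exact fun g hg ↦ (hw ⟨g, hg.2⟩).elim
      simp [this]
  · have : distLpNorm p u = ⊤ := by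
      simp only [distLpNorm, iInf_eq_top]
      exact fun g hg ↦ (hu ⟨g, hg.2⟩).elim
    simp [this]

theorem distLpNorm_sum_le {ι : Type*} (hp : 1 ≤ p) (s : Finset ι) (u : ι → 𝓢'(Rn n, ℂ)) :
    distLpNorm p (∑ i ∈ s, u i) ≤ ∑ i ∈ s, distLpNorm p (u i) := by
  classical
  induction s using Finset.induction_on with
  | empty => simp [distLpNorm_zero]
  | insert a s ha ih =>
    rw [Finset.sum_insert ha, Finset.sum_insert ha]
    exact (distLpNorm_add_le hp _ _).trans (add_le_add le_rfl ih)

/-- Fatou's lemma along a sequence of finite partial sums exhausting the index set, with the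
triangle inequality for each of them. -/
theorem eLpNorm_le_tsum_of_hasSum {X : Type*} [MeasurableSpace X] {μ : Measure X} {ι : Type*}
    [Countable ι] {f : ι → X → ℂ} {g : X → ℂ} (hf : ∀ i, AEStronglyMeasurable (f i) μ)
    (hfg : ∀ᵐ x ∂μ, HasSum (fun i ↦ f i x) (g x)) (hp : 1 ≤ p) :
    eLpNorm g p μ ≤ ∑' i, eLpNorm (f i) p μ := by
  obtain ⟨s, hs⟩ := exists_seq_tendsto (atTop : Filter (Finset ι))
  refine (Lp.eLpNorm_lim_le_liminf_eLpNorm (f := fun N ↦ ∑ i ∈ s N, f i)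
    (fun N ↦ Finset.aestronglyMeasurable_sum _ fun i _ ↦ hf i) g ?_).trans ?_
  · filter_upwards [hfg] with x hx
    simpa [Function.comp_def] using hx.comp hs
  · refine liminf_le_of_le (by isBoundedDefault) fun b hb ↦ ?_
    obtain ⟨N, hN⟩ := hb.exists
    exact hN.trans ((eLpNorm_sum_le (fun i _ ↦ hf i) hp).trans (ENNReal.sum_le_tsum _))

theorem WienerSummable.distLpNorm_tsum_le {ι : Type*} [Countable ι] {u : ι → 𝓢'(Rn n, ℂ)}
    {G : ι → Rn n → ℂ} (h : WienerSummable u G) (hp : 1 ≤ p) :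
    distLpNorm p (∑' i, u i) ≤ ∑' i, distLpNorm p (u i) := by
  simp only [h.hasSpectrum_tsum.distLpNorm_eq, (h.1 _).distLpNorm_eq]
  exact eLpNorm_le_tsum_of_hasSum
    (fun i ↦ (continuous_fourierInv (h.1 i).1).aestronglyMeasurable)
    (ae_of_all _ h.hasSum_fourierInv) hp

theorem HasSpectrum.distLpNorm_distMul_le {u w : 𝓢'(Rn n, ℂ)} {G H : Rn n → ℂ}
    (hu : HasSpectrum u G) (hw : HasSpectrum w H) (hpp : p⁻¹ = p₁⁻¹ + p₂⁻¹) :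
    distLpNorm p (LittlewoodPaley.distMul u w) ≤ distLpNorm p₁ u * distLpNorm p₂ w := by
  have : p₁.HolderTriple p₂ p := ⟨hpp.symm⟩
  rw [(hu.representedBy_distMul hw).distLpNorm_eq, hu.distLpNorm_eq, hw.distLpNorm_eq]
  have h := eLpNorm_smul_le_mul_eLpNorm (μ := volume) (p := p₁) (q := p₂) (r := p)
    (f := 𝓕⁻ H) (φ := 𝓕⁻ G) (continuous_fourierInv hw.1).aestronglyMeasurable
    (continuous_fourierInv hu.1).aestronglyMeasurable
  exact h

/-- The constant is the L¹ norm of the undilated kernel, hence the same for all t and p; this is the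
source of uniformity in j. -/
theorem HasSpectrum.distLpNorm_multiplier_le (m : 𝓢(Rn n, ℂ)) (t : ℝ) {u w : 𝓢'(Rn n, ℂ)}
    {G : Rn n → ℂ} (hu : HasSpectrum u G) (hw : HasSpectrum w fun ξ ↦ m (t • ξ) * G ξ)
    (hp : 1 ≤ p) :
    distLpNorm p w ≤ (∫⁻ y, ‖(𝓕⁻ m) y‖ₑ) * distLpNorm p u := by
  rw [hu.distLpNorm_eq, hw.distLpNorm_eq]
  exact eLpNorm_schwartz_mul_le m t hu.1 hp

theorem lintegral_enorm_ne_top (m : 𝓢(Rn n, ℂ)) : ∫⁻ y, ‖m y‖ₑ ≠ ⊤ := m.integrable.2.ne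

/-- The Schwartz function whose dilates are the symbols of `dyadic m j`. -/
def IsCutoff.schwartz {m : Rn n → ℝ} (hm : IsCutoff m) : 𝓢(Rn n, ℂ) :=
  (hm.compact_symbol 0).toSchwartzMap (hm.contDiff_symbol 0)

theorem IsCutoff.schwartz_apply {m : Rn n → ℝ} (hm : IsCutoff m) (ξ : Rn n) :
    hm.schwartz ξ = ((m ((2 * Real.pi) • ξ) : ℝ) : ℂ) := by
  change dyadicSymbol m 0 ξ = _
  simp [dyadicSymbol]

theorem IsCutoff.dyadicSymbol_eq {m : Rn n → ℝ} (hm : IsCutoff m) (j : ℤ) (ξ : Rn n) :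
    dyadicSymbol m j ξ = hm.schwartz ((2 : ℝ) ^ (-j) • ξ) := by
  rw [hm.schwartz_apply, dyadicSymbol, smul_comm]

theorem IsCutoff.exists_distLpNorm_dyadic_le {m : Rn n → ℝ} (hm : IsCutoff m) :
    ∃ C : ℝ≥0, ∀ (p : ℝ≥0∞) (j : ℤ) (u : 𝓢'(Rn n, ℂ)) (G : Rn n → ℂ), 1 ≤ p →
      HasSpectrum u G → distLpNorm p (dyadic m j u) ≤ C * distLpNorm p u := by
  refine ⟨(∫⁻ y, ‖(𝓕⁻ hm.schwartz) y‖ₑ).toNNReal, fun p j u G hp hu ↦ ?_⟩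
  rw [ENNReal.coe_toNNReal (lintegral_enorm_ne_top _)]
  refine hu.distLpNorm_multiplier_le hm.schwartz ((2 : ℝ) ^ (-j)) ?_ hp
  simpa only [hm.dyadicSymbol_eq] using hu.dyadic hm j

theorem enorm_two_zpow (j : ℤ) : ‖(2 : ℝ) ^ j‖ₑ = (2 : ℝ≥0∞) ^ j := by
  have h : (2 : ℝ) ^ j = (((2 : ℝ≥0) ^ j : ℝ≥0) : ℝ) := by push_cast; rfl
  rw [← ofReal_norm, Real.norm_of_nonneg (by positivity), h, ENNReal.ofReal_coe_nnreal,
    ENNReal.coe_zpow two_ne_zero]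
  rfl

theorem IsCutoff.exists_distLpNorm_commutator_le {m : Rn n → ℝ} (hm : IsCutoff m) :
    ∃ C : ℝ≥0, ∀ (p p₁ p₂ : ℝ≥0∞) (j : ℤ) (a w : 𝓢'(Rn n, ℂ)) (A W : Rn n → ℂ), 1 ≤ p → 1 ≤ p₁ →
      p⁻¹ = p₁⁻¹ + p₂⁻¹ → HasSpectrum₁ a A → HasSpectrum w W →
      distLpNorm p (distMul a (dyadic m j w) - dyadic m j (distMul a w)) ≤
        C * (2 : ℝ≥0∞) ^ (-j) * ((∑ l, distLpNorm p₁ (partialD l a)) * distLpNorm p₂ w) := by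
  refine ⟨(∫⁻ y, ‖(𝓕⁻ hm.schwartz) y‖ₑ * ‖y‖ₑ).toNNReal, fun p p₁ p₂ j a w A W hp hp₁ hpp ha hw ↦ ?_⟩
  rw [ENNReal.coe_toNNReal (lintegral_enorm_mul_enorm_lt_top _).ne]
  have h := eLpNorm_commutator_le hm.schwartz ((2 : ℝ) ^ (-j)) ha hw.1 hp hp₁ hpp
  simp only [← hm.dyadicSymbol_eq] at h
  have h1 := ha.1.representedBy_distMul (hw.dyadic hm j)
  have h2 := ((ha.1.distMul hw).dyadic hm j).representedBy
  have h3 := h1.sub h2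
  rw [h3.distLpNorm_eq, hw.distLpNorm_eq]
  simp only [(ha.partialD _).distLpNorm_eq]
  rwa [enorm_two_zpow] at h

end DistLpNorm

end LittlewoodPaley

namespace LittlewoodPaley

open FourierTransform Filter Topology
open scoped Convolution

variable {n : ℕ} {χ φ : Rn n → ℝ}

/-! ### Supports of the dyadic symbols and the partitions of unity -/

section Partition

theorem IsDyadicPair.isCutoff_low (h : IsDyadicPair χ φ) : IsCutoff χ :=
  ⟨h.smooth_low, h.compact_low⟩

theorem IsDyadicPair.isCutoff_ann (h : IsDyadicPair χ φ) : IsCutoff φ :=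
  ⟨h.smooth_ann, h.compact_ann⟩

theorem IsDyadicPair.norm_lt_of_low_ne (h : IsDyadicPair χ φ) {ξ : Rn n} (hξ : χ ξ ≠ 0) :
    ‖ξ‖ < 4 / 3 := by
  simpa using h.support_low (subset_tsupport χ hξ)

theorem IsDyadicPair.norm_mem_of_ann_ne (h : IsDyadicPair χ φ) {ξ : Rn n} (hξ : φ ξ ≠ 0) :
    3 / 4 < ‖ξ‖ ∧ ‖ξ‖ < 8 / 3 := by
  have := h.support_ann (subset_tsupport φ hξ)
  simpa [annulus, and_comm] using this

theorem IsDyadicPair.ann_zero (h : IsDyadicPair χ φ) : φ 0 = 0 := by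
  by_contra h0
  have := (h.norm_mem_of_ann_ne h0).1
  rw [norm_zero] at this
  linarith

theorem norm_dyadic_arg (j : ℤ) (ξ : Rn n) :
    ‖(2 : ℝ) ^ (-j) • ((2 * Real.pi) • ξ)‖ = (2 : ℝ) ^ (-j) * ‖(2 * Real.pi) • ξ‖ := by
  rw [norm_smul, Real.norm_of_nonneg (by positivity)]

theorem IsDyadicPair.norm_lt_of_symbol_low_ne (h : IsDyadicPair χ φ) {j : ℤ} {ξ : Rn n}
    (hξ : dyadicSymbol χ j ξ ≠ 0) : ‖(2 * Real.pi) • ξ‖ < 4 / 3 * 2 ^ j := by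
  have := h.norm_lt_of_low_ne (fun h0 ↦ hξ (by rw [dyadicSymbol, h0, Complex.ofReal_zero]))
  rw [norm_dyadic_arg, zpow_neg, inv_mul_lt_iff₀ (by positivity)] at this
  linarith

theorem IsDyadicPair.norm_mem_of_symbol_ann_ne (h : IsDyadicPair χ φ) {j : ℤ} {ξ : Rn n}
    (hξ : dyadicSymbol φ j ξ ≠ 0) :
    3 / 4 * 2 ^ j < ‖(2 * Real.pi) • ξ‖ ∧ ‖(2 * Real.pi) • ξ‖ < 8 / 3 * 2 ^ j := by
  have := h.norm_mem_of_ann_ne (fun h0 ↦ hξ (by rw [dyadicSymbol, h0, Complex.ofReal_zero]))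
  rw [norm_dyadic_arg, zpow_neg, inv_mul_lt_iff₀ (by positivity),
    lt_inv_mul_iff₀ (by positivity)] at this
  constructor <;> linarith [this.1, this.2]

theorem lt_add_of_two_zpow_lt {i j k : ℤ} (h : (2 : ℝ) ^ i < 2 ^ k * 2 ^ j) : i < k + j := by
  rwa [← zpow_add₀ two_ne_zero, zpow_lt_zpow_iff_right₀ one_lt_two] at h

/-- The radii of the annulus have ratio (8/3)/(3/4) = 32/9 < 4. -/
theorem IsDyadicPair.symbol_ann_ann (h : IsDyadicPair χ φ) {i j : ℤ} {ξ : Rn n}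
    (hi : dyadicSymbol φ i ξ ≠ 0) (hj : dyadicSymbol φ j ξ ≠ 0) : i ≤ j + 1 := by
  have h1 := h.norm_mem_of_symbol_ann_ne hi
  have h2 := h.norm_mem_of_symbol_ann_ne hj
  have : (2 : ℝ) ^ i < 2 ^ (2 : ℤ) * 2 ^ j := by
    have : (0 : ℝ) < 2 ^ j := by positivity
    norm_num
    linarith [h1.1, h2.2]
  have := lt_add_of_two_zpow_lt this
  omega

theorem IsDyadicPair.symbol_low_ann (h : IsDyadicPair χ φ) {i j : ℤ} {ξ : Rn n}
    (hi : dyadicSymbol χ i ξ ≠ 0) (hj : dyadicSymbol φ j ξ ≠ 0) : j ≤ i := by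
  have h1 := h.norm_lt_of_symbol_low_ne hi
  have h2 := h.norm_mem_of_symbol_ann_ne hj
  have : (2 : ℝ) ^ j < 2 ^ (1 : ℤ) * 2 ^ i := by
    have : (0 : ℝ) < 2 ^ i := by positivity
    norm_num
    linarith [h2.1]
  have := lt_add_of_two_zpow_lt this
  omega

/-- The low frequency is below (2/3)2^i and the high one lies between (3/4)2^i and (8/3)2^i, so the
sum has size between 2^i/12 and (10/3)2^i. Comparison with the annulus of index j gives the radius 4
used for all windows. -/
theorem IsDyadicPair.symbol_para (h : IsDyadicPair χ φ) {i j : ℤ} {ξ η : Rn n}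
    (h1 : dyadicSymbol χ (i - 1) ξ ≠ 0) (h2 : dyadicSymbol φ i η ≠ 0)
    (h3 : dyadicSymbol φ j (ξ + η) ≠ 0) : j ≤ i + 2 ∧ i ≤ j + 4 := by
  have k1 := h.norm_lt_of_symbol_low_ne h1
  have k2 := h.norm_mem_of_symbol_ann_ne h2
  have k3 := h.norm_mem_of_symbol_ann_ne h3
  rw [smul_add] at k3
  have t1 := norm_add_le ((2 * Real.pi) • ξ) ((2 * Real.pi) • η)
  have t2 : ‖(2 * Real.pi) • η‖ ≤ ‖(2 * Real.pi) • ξ + (2 * Real.pi) • η‖ +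
      ‖(2 * Real.pi) • ξ‖ := by
    have := norm_sub_le ((2 * Real.pi) • ξ + (2 * Real.pi) • η) ((2 * Real.pi) • ξ)
    rwa [add_sub_cancel_left] at this
  have hi : (2 : ℝ) ^ (i - 1) = 2 ^ i / 2 := zpow_sub_one₀ two_ne_zero i
  have hi0 : (0 : ℝ) < 2 ^ i := by positivity
  have hj0 : (0 : ℝ) < 2 ^ j := by positivity
  rw [hi] at k1
  have e1 : (2 : ℝ) ^ j < 2 ^ (3 : ℤ) * 2 ^ i := by
    norm_num
    linarith [k3.1, k2.2]
  have e2 : (2 : ℝ) ^ i < 2 ^ (5 : ℤ) * 2 ^ j := by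
    norm_num
    linarith [k3.2, k2.1]
  have := lt_add_of_two_zpow_lt e1
  have := lt_add_of_two_zpow_lt e2
  omega

/-- Only one side is available: comparable frequencies may cancel, so the sum can be arbitrarily
small, but its size is at most (8/3 + 16/3)2^i. -/
theorem IsDyadicPair.symbol_rem (h : IsDyadicPair χ φ) {i j ν : ℤ} {ξ η : Rn n}
    (hν : ν ∈ Finset.Icc (-1 : ℤ) 1)
    (h1 : dyadicSymbol φ i ξ ≠ 0) (h2 : dyadicSymbol φ (i - ν) η ≠ 0)
    (h3 : dyadicSymbol φ j (ξ + η) ≠ 0) : j ≤ i + 3 := by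
  have k1 := h.norm_mem_of_symbol_ann_ne h1
  have k2 := h.norm_mem_of_symbol_ann_ne h2
  have k3 := h.norm_mem_of_symbol_ann_ne h3
  rw [smul_add] at k3
  have t1 := norm_add_le ((2 * Real.pi) • ξ) ((2 * Real.pi) • η)
  rw [Finset.mem_Icc] at hν
  have hi : (2 : ℝ) ^ (i - ν) ≤ 2 * 2 ^ i := by
    rw [← zpow_one_add₀ two_ne_zero]
    exact zpow_le_zpow_right₀ one_le_two (by omega)
  have hi0 : (0 : ℝ) < 2 ^ i := by positivity
  have e1 : (2 : ℝ) ^ j < 2 ^ (4 : ℤ) * 2 ^ i := by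
    norm_num
    linarith [k3.1, k2.2, k1.2]
  have := lt_add_of_two_zpow_lt e1
  omega

theorem IsDyadicPair.hasSum_symbol (h : IsDyadicPair χ φ) {ξ : Rn n} (hξ : ξ ≠ 0) :
    HasSum (fun j : ℤ ↦ dyadicSymbol φ j ξ) 1 := by
  have := h.sum_int ((2 * Real.pi) • ξ) (smul_ne_zero (by positivity) hξ)
  simpa [dyadicSymbol] using! Complex.hasSum_ofReal.2 this

/-- At η = 2^{-j}·2πξ the full partition sums to 1 and its nonnegative indices to 1 - χ(η), so the
negative indices sum to χ(η). -/
theorem IsDyadicPair.hasSum_symbol_low (h : IsDyadicPair χ φ) {ξ : Rn n} (hξ : ξ ≠ 0) (j : ℤ) :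
    HasSum (fun i : ℕ ↦ dyadicSymbol φ (j - 1 - i) ξ) (dyadicSymbol χ j ξ) := by
  set η := (2 : ℝ) ^ (-j) • ((2 * Real.pi) • ξ) with hη
  have hη0 : η ≠ 0 := smul_ne_zero (zpow_ne_zero _ two_ne_zero) (smul_ne_zero (by positivity) hξ)
  have h1 := h.sum_int η hη0
  have h2 := h.sum_nonneg η
  have h3 : Summable (fun i : ℕ ↦ φ ((2 : ℝ) ^ (-(-((i : ℤ) + 1))) • η)) :=
    h1.summable.comp_injective (i := fun i : ℕ ↦ -((i : ℤ) + 1)) fun a b hab ↦ by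
      simpa using hab
  have h4 := HasSum.of_nat_of_neg_add_one (f := fun j : ℤ ↦ φ ((2 : ℝ) ^ (-j) • η)) h2 h3.hasSum
  have h5 := h4.unique h1
  have h6 : HasSum (fun i : ℕ ↦ φ ((2 : ℝ) ^ (-(-((i : ℤ) + 1))) • η)) (χ η) := by
    have := h3.hasSum
    rwa [show ∑' i : ℕ, φ ((2 : ℝ) ^ (-(-((i : ℤ) + 1))) • η) = χ η by linarith] at this
  refine (Complex.hasSum_ofReal.2 h6).congr_fun fun i ↦ ?_
  rw [dyadicSymbol, hη, smul_smul ((2 : ℝ) ^ _) ((2 : ℝ) ^ _), ← zpow_add₀ two_ne_zero]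
  congr 4
  ring

theorem IsDyadicPair.sum_norm_symbol_le (h : IsDyadicPair χ φ) (s : Finset ℤ) (ξ : Rn n) :
    ∑ j ∈ s, ‖dyadicSymbol φ j ξ‖ ≤ 1 := by
  rcases eq_or_ne ξ 0 with rfl | hξ
  · simp [dyadicSymbol, h.ann_zero]
  · have := h.sum_int ((2 * Real.pi) • ξ) (smul_ne_zero (by positivity) hξ)
    have e : ∀ j, ‖dyadicSymbol φ j ξ‖ = φ ((2 : ℝ) ^ (-j) • ((2 * Real.pi) • ξ)) := fun j ↦ by
      rw [dyadicSymbol, Complex.norm_real, Real.norm_of_nonneg (h.range_ann _).1]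
    simp only [e]
    exact sum_le_hasSum s (fun j _ ↦ (h.range_ann _).1) this

theorem IsDyadicPair.norm_symbol_low_le (h : IsDyadicPair χ φ) (j : ℤ) (ξ : Rn n) :
    ‖dyadicSymbol χ j ξ‖ ≤ 1 := by
  rw [dyadicSymbol, Complex.norm_real, Real.norm_of_nonneg (h.range_low _).1]
  exact (h.range_low _).2

theorem IsDyadicPair.norm_symbol_ann_le (h : IsDyadicPair χ φ) (j : ℤ) (ξ : Rn n) :
    ‖dyadicSymbol φ j ξ‖ ≤ 1 := by
  rw [dyadicSymbol, Complex.norm_real, Real.norm_of_nonneg (h.range_ann _).1]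
  exact (h.range_ann _).2

/-- A cut-off that equals `1` on the support of `φ`. -/
def fatten (φ : Rn n → ℝ) (ξ : Rn n) : ℝ := ∑ ν ∈ Finset.Icc (-1 : ℤ) 1, φ ((2 : ℝ) ^ (-ν) • ξ)

theorem IsDyadicPair.isCutoff_fatten (h : IsDyadicPair χ φ) : IsCutoff (fatten φ) := by
  constructor
  · exact ContDiff.sum fun ν _ ↦ h.smooth_ann.comp (by fun_prop)
  · have : ∀ ν : ℤ, HasCompactSupport fun ξ ↦ φ ((2 : ℝ) ^ (-ν) • ξ) := fun ν ↦
      h.compact_ann.comp_smul (zpow_ne_zero _ two_ne_zero)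
    have e : fatten φ = (fun ξ ↦ φ ((2 : ℝ) ^ (-(-1 : ℤ)) • ξ)) +
        ((fun ξ ↦ φ ((2 : ℝ) ^ (-(0 : ℤ)) • ξ)) + fun ξ ↦ φ ((2 : ℝ) ^ (-(1 : ℤ)) • ξ)) := by
      funext ξ
      rw [fatten, show Finset.Icc (-1 : ℤ) 1 = {-1, 0, 1} by decide]
      rw [Finset.sum_insert (by decide), Finset.sum_insert (by decide), Finset.sum_singleton]
      rfl
    rw [e]
    exact (this _).add ((this _).add (this _))

/-- On the support of φ only the neighbours |ν| ≤ 1 in the homogeneous partition can be nonzero, so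
their sum is the whole sum 1. -/
theorem IsDyadicPair.fatten_mul (h : IsDyadicPair χ φ) (ξ : Rn n) :
    fatten φ ξ * φ ξ = φ ξ := by
  by_cases h0 : φ ξ = 0
  · simp [h0]
  have hξ := h.norm_mem_of_ann_ne h0
  have hξ0 : ξ ≠ 0 := fun e ↦ by rw [e, h.ann_zero] at h0; exact h0 rfl
  have h1 := h.sum_int ξ hξ0
  have h2 : HasSum (fun j : ℤ ↦ φ ((2 : ℝ) ^ (-j) • ξ)) (fatten φ ξ) := by
    refine hasSum_sum_of_ne_finset_zero fun ν hν ↦ ?_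
    by_contra hne
    have h3 := h.norm_mem_of_ann_ne hne
    rw [norm_smul, Real.norm_of_nonneg (by positivity), zpow_neg,
      inv_mul_lt_iff₀ (by positivity), lt_inv_mul_iff₀ (by positivity)] at h3
    have e1 : (2 : ℝ) ^ ν < 2 ^ (2 : ℤ) * 2 ^ (0 : ℤ) := by norm_num; linarith [h3.1]
    have e2 : (2 : ℝ) ^ (0 : ℤ) < 2 ^ (2 : ℤ) * 2 ^ ν := by norm_num; linarith [h3.2]
    have := lt_add_of_two_zpow_lt e1
    have := lt_add_of_two_zpow_lt e2
    exact hν (Finset.mem_Icc.2 ⟨by omega, by omega⟩)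
  rw [h2.unique h1, one_mul]

theorem IsDyadicPair.fatten_symbol_mul (h : IsDyadicPair χ φ) (j : ℤ) (ξ : Rn n) :
    dyadicSymbol (fatten φ) j ξ * dyadicSymbol φ j ξ = dyadicSymbol φ j ξ := by
  simp only [dyadicSymbol]
  rw [← Complex.ofReal_mul, h.fatten_mul]

/-- The fattened cut-off stays away from 0, which permits division by |ξ|² in the reverse Bernstein
inequality. -/
theorem IsDyadicPair.norm_of_fatten_ne (h : IsDyadicPair χ φ) {ξ : Rn n}
    (hξ : fatten φ ξ ≠ 0) : 3 / 8 < ‖ξ‖ := by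
  obtain ⟨ν, hν, hne⟩ := Finset.exists_ne_zero_of_sum_ne_zero hξ
  have h3 := (h.norm_mem_of_ann_ne hne).1
  rw [norm_smul, Real.norm_of_nonneg (by positivity), zpow_neg,
    lt_inv_mul_iff₀ (by positivity)] at h3
  rw [Finset.mem_Icc] at hν
  have : (2 : ℝ) ^ (-1 : ℤ) ≤ 2 ^ ν := zpow_le_zpow_right₀ one_le_two hν.1
  norm_num at this
  linarith

end Partition

/-! ### Bernstein inequalities -/

section Bernstein

theorem HasSpectrum.distLpNorm_smul {u : 𝓢'(Rn n, ℂ)} {G : Rn n → ℂ} (h : HasSpectrum u G) (c : ℂ)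
    (p : ℝ≥0∞) : distLpNorm p (c • u) = ‖c‖ₑ * distLpNorm p u := by
  rw [(h.smul c).distLpNorm_eq, h.distLpNorm_eq, ← eLpNorm_const_smul]
  congr 1
  funext x
  exact fourierInv_const_mul c G x

theorem derivSymbol_smul (k : Fin n) (t : ℝ) (ξ : Rn n) :
    derivSymbol k (t • ξ) = t * derivSymbol k ξ := by
  simp [derivSymbol]; ring

/-- Bernstein's inequality for derivatives of frequency-localized distributions. -/
theorem IsDyadicPair.exists_bernstein (h : IsDyadicPair χ φ) :
    ∃ C : ℝ≥0, ∀ (p : ℝ≥0∞) (j : ℤ) (k : Fin n) (u : 𝓢'(Rn n, ℂ)) (G : Rn n → ℂ), 1 ≤ p →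
      HasSpectrum u G → distLpNorm p (partialD k (dyadic φ j u)) ≤
        C * (2 : ℝ≥0∞) ^ j * distLpNorm p (dyadic φ j u) := by
  have hf := h.isCutoff_fatten
  have hc : ∀ k : Fin n, HasCompactSupport fun ξ ↦ derivSymbol k ξ * dyadicSymbol (fatten φ) 0 ξ :=
    fun k ↦ (hf.compact_symbol 0).mul_left
  let m : Fin n → 𝓢(Rn n, ℂ) := fun k ↦
    (hc k).toSchwartzMap ((contDiff_derivSymbol k).mul (hf.contDiff_symbol 0))
  have hm : ∀ k ξ, m k ξ = derivSymbol k ξ * dyadicSymbol (fatten φ) 0 ξ := fun k ξ ↦ rfl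
  refine ⟨∑ k, (∫⁻ y, ‖(𝓕⁻ (m k)) y‖ₑ).toNNReal, fun p j k u G hp hu ↦ ?_⟩
  have h1 := hu.dyadic h.isCutoff_ann j
  have h2 := (hu.dyadic₁ h.isCutoff_ann j).partialD k
  -- The derivative symbol is homogeneous of degree 1: after the factor 2^{-j}, and with the
  -- fattened cut-off inserted for free, the derivative acts on the block as the dilate of one fixed
  -- Schwartz symbol.
  have h3 := h2.smul (((2 : ℝ) ^ (-j) : ℝ) : ℂ)
  have h4 : HasSpectrum ((((2 : ℝ) ^ (-j) : ℝ) : ℂ) • partialD k (dyadic φ j u))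
      (fun ξ ↦ m k ((2 : ℝ) ^ (-j) • ξ) * (dyadicSymbol φ j ξ * G ξ)) := by
    refine h3.congr (ae_of_all _ fun ξ ↦ ?_)
    have e : dyadicSymbol (fatten φ) 0 ((2 : ℝ) ^ (-j) • ξ) = dyadicSymbol (fatten φ) j ξ := by
      rw [hf.dyadicSymbol_eq, hf.dyadicSymbol_eq]; simp
    simp only [Pi.smul_apply, smul_eq_mul]
    rw [hm, derivSymbol_smul, e]
    nth_rewrite 1 [← h.fatten_symbol_mul j ξ]
    ring
  have h5 := h1.distLpNorm_multiplier_le (m k) _ h4 hp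
  rw [h2.distLpNorm_smul] at h5
  have e1 : ‖(((2 : ℝ) ^ (-j) : ℝ) : ℂ)‖ₑ = (2 : ℝ≥0∞) ^ (-j) := by
    rw [← enorm_two_zpow, ← ofReal_norm, ← ofReal_norm, Complex.norm_real]
  rw [e1] at h5
  have e2 : (2 : ℝ≥0∞) ^ j * (2 : ℝ≥0∞) ^ (-j) = 1 := by
    rw [← ENNReal.zpow_add two_ne_zero ENNReal.ofNat_ne_top]; simp
  have h6 : (∫⁻ y, ‖(𝓕⁻ (m k)) y‖ₑ) ≤
      ((∑ k, (∫⁻ y, ‖(𝓕⁻ (m k)) y‖ₑ).toNNReal : ℝ≥0) : ℝ≥0∞) := by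
    rw [← ENNReal.coe_toNNReal (lintegral_enorm_ne_top (𝓕⁻ (m k)))]
    exact ENNReal.coe_le_coe.2 (Finset.single_le_sum
      (f := fun k ↦ (∫⁻ y, ‖(𝓕⁻ (m k)) y‖ₑ).toNNReal) (fun _ _ ↦ zero_le) (Finset.mem_univ k))
  calc distLpNorm p (partialD k (dyadic φ j u))
      = (2 : ℝ≥0∞) ^ j * ((2 : ℝ≥0∞) ^ (-j) * distLpNorm p (partialD k (dyadic φ j u))) := by
        rw [← mul_assoc, e2, one_mul]
    _ ≤ (2 : ℝ≥0∞) ^ j * (_ * distLpNorm p (dyadic φ j u)) :=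
        mul_le_mul_right (h5.trans (mul_le_mul_left h6 _)) _
    _ = _ := by ring

/-- The reverse Bernstein inequality. -/
theorem IsDyadicPair.exists_reverse_bernstein (h : IsDyadicPair χ φ) :
    ∃ C : ℝ≥0, ∀ (p : ℝ≥0∞) (j : ℤ) (u : 𝓢'(Rn n, ℂ)) (G : Rn n → ℂ), 1 ≤ p →
      HasSpectrum₁ u G → distLpNorm p (dyadic φ j u) ≤
        C * (2 : ℝ≥0∞) ^ (-j) * ∑ l, distLpNorm p (dyadic φ j (partialD l u)) := by
  have hf := h.isCutoff_fatten
  -- A localized left inverse of the gradient: off the origin, Σ_l ψ_l(ξ) · 2πi ξ_l is the fattened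
  -- cut-off, which is 1 where the block lives.
  let ψ : Fin n → Rn n → ℂ := fun l ξ ↦
    dyadicSymbol (fatten φ) 0 ξ * ((ξ l : ℂ) * (2 * Real.pi * Complex.I * ((‖ξ‖ ^ 2 : ℝ) : ℂ))⁻¹)
  have hc : ∀ l, HasCompactSupport (ψ l) := fun l ↦ (hf.compact_symbol 0).mul_right
  have hd : ∀ l, ContDiff ℝ ∞ (ψ l) := fun l ↦ by
    rw [contDiff_iff_contDiffAt]
    intro ξ
    rcases eq_or_ne ξ 0 with rfl | hξ
    -- The singularity of 1/|ξ|² at 0 is invisible because the fattened cut-off vanishes in a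
    -- neighbourhood.
    · refine ContDiffAt.congr_of_eventuallyEq (f := fun _ ↦ 0) contDiffAt_const ?_
      filter_upwards [Metric.ball_mem_nhds (0 : Rn n) (ε := 3 / 8 / (2 * Real.pi))
        (by positivity)] with η hη
      have : dyadicSymbol (fatten φ) 0 η = 0 := by
        by_contra hne
        have h1 := h.norm_of_fatten_ne fun h0 ↦ hne (by rw [dyadicSymbol, h0, Complex.ofReal_zero])
        rw [norm_dyadic_arg, norm_smul, Real.norm_of_nonneg (by positivity)] at h1
        rw [mem_ball_zero_iff, lt_div_iff₀ (by positivity)] at hη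
        simp at h1
        linarith
      simp only [ψ, this, zero_mul]
    · refine (hf.contDiff_symbol 0).contDiffAt.mul
        (ContDiffAt.mul ?_ (ContDiffAt.inv ?_ ?_))
      · exact (Complex.ofRealCLM.contDiff.comp (contDiff_coord l)).contDiffAt
      · exact contDiffAt_const.mul
          (Complex.ofRealCLM.contDiff.comp (contDiff_norm_sq ℝ)).contDiffAt
      · have : ‖ξ‖ ≠ 0 := norm_ne_zero_iff.2 hξ
        simp [Real.pi_ne_zero, this]
  let m : Fin n → 𝓢(Rn n, ℂ) := fun l ↦ (hc l).toSchwartzMap (hd l)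
  have hm : ∀ l ξ, m l ξ = ψ l ξ := fun l ξ ↦ rfl
  refine ⟨∑ l, (∫⁻ y, ‖(𝓕⁻ (m l)) y‖ₑ).toNNReal, fun p j u G hp hu ↦ ?_⟩
  have h1 : ∀ l, HasSpectrum (dyadic φ j (partialD l u))
      (fun ξ ↦ dyadicSymbol φ j ξ * (derivSymbol l ξ * G ξ)) := fun l ↦
    (hu.partialD l).dyadic h.isCutoff_ann j
  have h2 : ∀ l, ∃ w, HasSpectrum w (fun ξ ↦ m l ((2 : ℝ) ^ (-j) • ξ) *
      (dyadicSymbol φ j ξ * (derivSymbol l ξ * G ξ))) := fun l ↦ by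
    refine exists_hasSpectrum ?_
    obtain ⟨C, hC⟩ := (hc l).exists_bound_of_continuous (hd l).continuous
    exact (h1 l).1.bdd_mul (c := C)
      ((hd l).continuous.comp (by fun_prop)).aestronglyMeasurable (ae_of_all _ fun ξ ↦ hC _)
  choose w hw using h2
  have h3 : dyadic φ j u = (((2 : ℝ) ^ (-j) : ℝ) : ℂ) • ∑ l, w l := by
    refine (hu.1.dyadic h.isCutoff_ann j).eq
      (((HasSpectrum.sum Finset.univ fun l _ ↦ hw l).smul _).congr (ae_of_all _ fun ξ ↦ ?_))
    simp only [Pi.smul_apply, Finset.sum_apply, smul_eq_mul, hm, ψ]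
    by_cases h0 : dyadicSymbol φ j ξ = 0
    · simp [h0]
    have hξ : ‖ξ‖ ≠ 0 := fun e ↦ by
      have := (h.norm_mem_of_symbol_ann_ne h0).1
      rw [norm_smul, e, mul_zero] at this
      exact absurd this (not_lt.2 (by positivity))
    have e : dyadicSymbol (fatten φ) 0 ((2 : ℝ) ^ (-j) • ξ) = dyadicSymbol (fatten φ) j ξ := by
      rw [hf.dyadicSymbol_eq, hf.dyadicSymbol_eq]; simp
    have e2 : ((‖ξ‖ ^ 2 : ℝ) : ℂ) = ∑ l, (ξ l : ℂ) * (ξ l : ℂ) := by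
      rw [EuclideanSpace.norm_sq_eq]
      push_cast
      refine Finset.sum_congr rfl fun l _ ↦ ?_
      rw [← Complex.ofReal_pow, Real.norm_eq_abs, sq_abs]
      push_cast; ring
    set t : ℝ := (2 : ℝ) ^ (-j) with ht
    have ht0 : (t : ℂ) ≠ 0 := by
      rw [Complex.ofReal_ne_zero]; positivity
    have hN : ((‖ξ‖ ^ 2 : ℝ) : ℂ) ≠ 0 := by
      rw [Complex.ofReal_ne_zero]; positivity
    have e3 : ∀ l, dyadicSymbol (fatten φ) 0 (t • ξ) *
        (((t • ξ) l : ℂ) * (2 * Real.pi * Complex.I * ((‖t • ξ‖ ^ 2 : ℝ) : ℂ))⁻¹) *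
        (dyadicSymbol φ j ξ * (derivSymbol l ξ * G ξ)) =
        ((t : ℂ)⁻¹ * ((‖ξ‖ ^ 2 : ℝ) : ℂ)⁻¹ * (dyadicSymbol φ j ξ * G ξ)) *
          ((ξ l : ℂ) * (ξ l : ℂ)) := fun l ↦ by
      have hn : ((‖t • ξ‖ ^ 2 : ℝ) : ℂ) = (t : ℂ) ^ 2 * ((‖ξ‖ ^ 2 : ℝ) : ℂ) := by
        rw [norm_smul, mul_pow, Real.norm_eq_abs, sq_abs]; push_cast; ring
      have hpi : (Real.pi : ℂ) ≠ 0 := Complex.ofReal_ne_zero.2 Real.pi_ne_zero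
      rw [e, hn, derivSymbol]
      nth_rewrite 2 [← h.fatten_symbol_mul j ξ]
      simp only [PiLp.smul_apply, smul_eq_mul, Complex.ofReal_mul]
      field_simp
    simp only [e3]
    rw [← Finset.mul_sum, ← e2]
    field_simp
  have h4 : distLpNorm p (dyadic φ j u) = (2 : ℝ≥0∞) ^ (-j) * distLpNorm p (∑ l, w l) := by
    rw [h3, (HasSpectrum.sum Finset.univ fun l _ ↦ hw l).distLpNorm_smul, ← enorm_two_zpow,
      ← ofReal_norm, ← ofReal_norm, Complex.norm_real]
  rw [h4]
  have h5 : ∀ l, distLpNorm p (w l) ≤ ((∑ k, (∫⁻ y, ‖(𝓕⁻ (m k)) y‖ₑ).toNNReal : ℝ≥0) : ℝ≥0∞) *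
      distLpNorm p (dyadic φ j (partialD l u)) := fun l ↦ by
    refine ((h1 l).distLpNorm_multiplier_le (m l) _ (hw l) hp).trans (mul_le_mul_left ?_ _)
    rw [← ENNReal.coe_toNNReal (lintegral_enorm_ne_top (𝓕⁻ (m l)))]
    exact ENNReal.coe_le_coe.2 (Finset.single_le_sum
      (f := fun k ↦ (∫⁻ y, ‖(𝓕⁻ (m k)) y‖ₑ).toNNReal) (fun _ _ ↦ zero_le) (Finset.mem_univ l))
  calc (2 : ℝ≥0∞) ^ (-j) * distLpNorm p (∑ l, w l)
      ≤ (2 : ℝ≥0∞) ^ (-j) * ∑ l, distLpNorm p (w l) :=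
        mul_le_mul_right (distLpNorm_sum_le hp _ _) _
    _ ≤ (2 : ℝ≥0∞) ^ (-j) * ∑ l, _ * distLpNorm p (dyadic φ j (partialD l u)) :=
        mul_le_mul_right (Finset.sum_le_sum fun l _ ↦ h5 l) _
    _ = _ := by rw [← Finset.mul_sum]; ring

end Bernstein

end LittlewoodPaley

namespace LittlewoodPaley

open FourierTransform Filter Topology
open scoped Convolution

variable {n : ℕ} {χ φ : Rn n → ℝ}

/-! ### Summability of blocks, paraproducts and remainders -/

section BlockSeries

variable {u w : 𝓢'(Rn n, ℂ)} {G H : Rn n → ℂ}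

/-- Every finite sum of the |φ(2^{-j}·)| is at most 1, so all partial sums are bounded by ∫|G|. -/
theorem IsDyadicPair.summable_blocks (h : IsDyadicPair χ φ) (hG : Integrable G) :
    Summable fun j : ℤ ↦ ∫ ξ, ‖dyadicSymbol φ j ξ * G ξ‖ := by
  have hi := fun j ↦ (h.isCutoff_ann.integrable_symbol_mul j hG).norm
  refine summable_of_sum_le (c := ∫ ξ, ‖G ξ‖) (fun j ↦ integral_nonneg fun _ ↦ norm_nonneg _)
    fun s ↦ ?_
  rw [← integral_finsetSum _ fun j _ ↦ hi j]
  refine integral_mono (integrable_finsetSum _ fun j _ ↦ hi j) hG.norm fun ξ ↦ ?_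
  simp only [norm_mul, ← Finset.sum_mul]
  exact mul_le_of_le_one_left (norm_nonneg _) (h.sum_norm_symbol_le s ξ)

theorem IsDyadicPair.wienerSummable_blocks (h : IsDyadicPair χ φ) (hu : HasSpectrum u G) :
    WienerSummable (fun j : ℤ ↦ dyadic φ j u) (fun j ξ ↦ dyadicSymbol φ j ξ * G ξ) :=
  ⟨hu.dyadic h.isCutoff_ann, h.summable_blocks hu.1⟩

/-- In dimension 0 the origin has positive measure. The homogeneous partition holds only off the
origin, so identities that use it almost everywhere need n ≠ 0. -/
theorem ae_ne_zero [NeZero n] : ∀ᵐ ξ : Rn n, ξ ≠ 0 := by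
  have : Nonempty (Fin n) := ⟨0⟩
  exact Measure.ae_ne volume 0

theorem IsDyadicPair.wienerSummable_low_blocks (h : IsDyadicPair χ φ) (hu : HasSpectrum u G)
    (j : ℤ) : WienerSummable (fun i : ℕ ↦ dyadic φ (j - 1 - i) u)
      (fun i ξ ↦ dyadicSymbol φ (j - 1 - i) ξ * G ξ) :=
  ⟨fun i ↦ hu.dyadic h.isCutoff_ann _, (h.summable_blocks hu.1).comp_injective
    (i := fun i : ℕ ↦ j - 1 - i) fun a b hab ↦ by simpa using hab⟩

theorem IsDyadicPair.hasSum_blocks_apply [NeZero n] (h : IsDyadicPair χ φ) (hu : HasSpectrum u G)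
    (x : Rn n) :
    HasSum (fun j : ℤ ↦ 𝓕⁻ (fun ξ ↦ dyadicSymbol φ j ξ * G ξ) x) (𝓕⁻ G x) := by
  have h1 := (h.wienerSummable_blocks hu).hasSum_fourierInv x
  rwa [Real.fourierInv_congr_ae (f₂ := G)] at h1
  filter_upwards [ae_ne_zero] with ξ hξ
  rw [tsum_mul_right, (h.hasSum_symbol hξ).tsum_eq, one_mul]

theorem IsDyadicPair.low_spectrum_ae_eq [NeZero n] (h : IsDyadicPair χ φ) (G : Rn n → ℂ) (j : ℤ) :
    (fun ξ ↦ ∑' i : ℕ, dyadicSymbol φ (j - 1 - i) ξ * G ξ) =ᵐ[volume]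
      fun ξ ↦ dyadicSymbol χ j ξ * G ξ := by
  filter_upwards [ae_ne_zero] with ξ hξ
  rw [tsum_mul_right, (h.hasSum_symbol_low hξ j).tsum_eq]

theorem IsDyadicPair.hasSum_low_apply [NeZero n] (h : IsDyadicPair χ φ) (hu : HasSpectrum u G)
    (j : ℤ) (x : Rn n) :
    HasSum (fun i : ℕ ↦ 𝓕⁻ (fun ξ ↦ dyadicSymbol φ (j - 1 - i) ξ * G ξ) x)
      (𝓕⁻ (fun ξ ↦ dyadicSymbol χ j ξ * G ξ) x) := by
  have h1 := (h.wienerSummable_low_blocks hu j).hasSum_fourierInv x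
  rwa [Real.fourierInv_congr_ae (h.low_spectrum_ae_eq G j)] at h1

theorem IsDyadicPair.dyadic_low_eq_tsum [NeZero n] (h : IsDyadicPair χ φ) (hu : HasSpectrum u G)
    (j : ℤ) : dyadic χ j u = ∑' i : ℕ, dyadic φ (j - 1 - i) u :=
  (hu.dyadic h.isCutoff_low j).eq
    ((h.wienerSummable_low_blocks hu j).hasSpectrum_tsum.congr (h.low_spectrum_ae_eq G j))

theorem IsDyadicPair.integral_norm_low_le (h : IsDyadicPair χ φ) (hG : Integrable G) (j : ℤ) :
    ∫ ξ, ‖dyadicSymbol χ j ξ * G ξ‖ ≤ ∫ ξ, ‖G ξ‖ := by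
  refine integral_mono (h.isCutoff_low.integrable_symbol_mul j hG).norm hG.norm fun ξ ↦ ?_
  simp only [norm_mul]
  exact mul_le_of_le_one_left (norm_nonneg _) (h.norm_symbol_low_le j ξ)

theorem IsDyadicPair.integral_norm_ann_le (h : IsDyadicPair χ φ) (hG : Integrable G) (j : ℤ) :
    ∫ ξ, ‖dyadicSymbol φ j ξ * G ξ‖ ≤ ∫ ξ, ‖G ξ‖ := by
  refine integral_mono (h.isCutoff_ann.integrable_symbol_mul j hG).norm hG.norm fun ξ ↦ ?_
  simp only [norm_mul]
  exact mul_le_of_le_one_left (norm_nonneg _) (h.norm_symbol_ann_le j ξ)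

/-- The spectrum of the `j`-th term of the paraproduct. -/
def paraSpectrum (χ φ : Rn n → ℝ) (G H : Rn n → ℂ) (j : ℤ) : Rn n → ℂ :=
  (fun ξ ↦ dyadicSymbol χ (j - 1) ξ * G ξ) ⋆[ContinuousLinearMap.mul ℂ ℂ, volume]
    fun ξ ↦ dyadicSymbol φ j ξ * H ξ

/-- The spectrum of the product `Δ̇_j u Δ̇_{j-ν} w`. -/
def blockSpectrum (φ : Rn n → ℝ) (G H : Rn n → ℂ) (j ν : ℤ) : Rn n → ℂ :=
  (fun ξ ↦ dyadicSymbol φ j ξ * G ξ) ⋆[ContinuousLinearMap.mul ℂ ℂ, volume]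
    fun ξ ↦ dyadicSymbol φ (j - ν) ξ * H ξ

/-- The low-frequency factor has spectrum bounded in L¹ uniformly in j, and the blocks of the other
factor are summable; convolution multiplies L¹ norms. -/
theorem IsDyadicPair.wienerSummable_paraTerm (h : IsDyadicPair χ φ) (hu : HasSpectrum u G)
    (hw : HasSpectrum w H) : WienerSummable (paraTerm χ φ u w) (paraSpectrum χ φ G H) := by
  refine ⟨fun j ↦ (hu.dyadic h.isCutoff_low _).distMul (hw.dyadic h.isCutoff_ann _), ?_⟩
  refine Summable.of_nonneg_of_le (fun j ↦ integral_nonneg fun _ ↦ norm_nonneg _) (fun j ↦ ?_)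
    ((h.summable_blocks hw.1).mul_left (∫ ξ, ‖G ξ‖))
  refine (integral_norm_convolution_le (h.isCutoff_low.integrable_symbol_mul _ hu.1)
    (h.isCutoff_ann.integrable_symbol_mul _ hw.1)).trans ?_
  exact mul_le_mul_of_nonneg_right (h.integral_norm_low_le hu.1 _)
    (integral_nonneg fun _ ↦ norm_nonneg _)

theorem IsDyadicPair.wienerSummable_block (h : IsDyadicPair χ φ) (hu : HasSpectrum u G)
    (hw : HasSpectrum w H) (ν : ℤ) :
    WienerSummable (fun j ↦ distMul (dyadic φ j u) (dyadic φ (j - ν) w))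
      (fun j ↦ blockSpectrum φ G H j ν) := by
  refine ⟨fun j ↦ (hu.dyadic h.isCutoff_ann _).distMul (hw.dyadic h.isCutoff_ann _), ?_⟩
  refine Summable.of_nonneg_of_le (fun j ↦ integral_nonneg fun _ ↦ norm_nonneg _) (fun j ↦ ?_)
    ((h.summable_blocks hu.1).mul_right (∫ ξ, ‖H ξ‖))
  refine (integral_norm_convolution_le (h.isCutoff_ann.integrable_symbol_mul _ hu.1)
    (h.isCutoff_ann.integrable_symbol_mul _ hw.1)).trans ?_
  exact mul_le_mul_of_nonneg_left (h.integral_norm_ann_le hw.1 _)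
    (integral_nonneg fun _ ↦ norm_nonneg _)

theorem WienerSummable.sum {ι κ : Type*} {u : κ → ι → 𝓢'(Rn n, ℂ)} {G : κ → ι → Rn n → ℂ}
    (s : Finset κ) (h : ∀ k ∈ s, WienerSummable (u k) (G k)) :
    WienerSummable (fun i ↦ ∑ k ∈ s, u k i) (fun i ↦ ∑ k ∈ s, G k i) := by
  refine ⟨fun i ↦ HasSpectrum.sum s fun k hk ↦ (h k hk).1 i, ?_⟩
  refine Summable.of_nonneg_of_le (fun j ↦ integral_nonneg fun _ ↦ norm_nonneg _) (fun i ↦ ?_)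
    (summable_sum fun k hk ↦ (h k hk).2)
  have hi : ∀ k ∈ s, Integrable fun ξ ↦ ‖G k i ξ‖ := fun k hk ↦ ((h k hk).1 i).1.norm
  rw [← integral_finsetSum _ hi]
  refine integral_mono_of_nonneg (ae_of_all _ fun _ ↦ norm_nonneg _)
    (integrable_finsetSum _ hi) (ae_of_all _ fun ξ ↦ ?_)
  simp only [Finset.sum_apply]
  exact norm_sum_le _ _

theorem IsDyadicPair.wienerSummable_remTerm (h : IsDyadicPair χ φ) (hu : HasSpectrum u G)
    (hw : HasSpectrum w H) : WienerSummable (remTerm φ u w)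
      (fun j ↦ ∑ ν ∈ Finset.Icc (-1 : ℤ) 1, blockSpectrum φ G H j ν) :=
  WienerSummable.sum (Finset.Icc (-1 : ℤ) 1) fun ν _ ↦ h.wienerSummable_block hu hw ν

theorem IsDyadicPair.hasPara (h : IsDyadicPair χ φ) (hu : HasSpectrum u G)
    (hw : HasSpectrum w H) : HasPara χ φ u w :=
  ⟨fun _ ↦ (hu.dyadic h.isCutoff_low _).hasProduct (hw.dyadic h.isCutoff_ann _),
    (h.wienerSummable_paraTerm hu hw).summable⟩

theorem IsDyadicPair.hasRem (h : IsDyadicPair χ φ) (hu : HasSpectrum u G)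
    (hw : HasSpectrum w H) : HasRem φ u w :=
  ⟨fun _ _ _ ↦ (hu.dyadic h.isCutoff_ann _).hasProduct (hw.dyadic h.isCutoff_ann _),
    (h.wienerSummable_remTerm hu hw).summable⟩

end BlockSeries

/-! ### Bony's decomposition -/

section Bony

/-- The product of two absolutely convergent bilateral series, split according to the distance of
the indices. -/
theorem tsum_mul_tsum_eq_para {a b : ℤ → ℂ} (ha : Summable fun j ↦ ‖a j‖)
    (hb : Summable fun j ↦ ‖b j‖) :
    (∑' j, a j) * (∑' j, b j) = (∑' j, (∑' i : ℕ, a (j - 1 - 1 - i)) * b j) +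
      (∑' j, (∑' i : ℕ, b (j - 1 - 1 - i)) * a j) +
      ∑' j, ∑ ν ∈ Finset.Icc (-1 : ℤ) 1, a j * b (j - ν) := by
  have hP : Summable fun z : ℤ × ℤ ↦ a z.1 * b z.2 := summable_mul_of_summable_norm ha hb
  -- Reindexes pairs by the gap d between the two indices; f d below collects the pairs with gap d.
  let e : ℤ × ℤ ≃ ℤ × ℤ :=
    { toFun := fun z ↦ (z.2 - z.1, z.2)
      invFun := fun z ↦ (z.2 - z.1, z.2)
      left_inv := fun z ↦ by simp
      right_inv := fun z ↦ by simp }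
  have hQ : Summable fun z : ℤ × ℤ ↦ a (z.2 - z.1) * b z.2 := e.summable_iff.2 hP
  set f : ℤ → ℂ := fun d ↦ ∑' j, a (j - d) * b j with hf
  have hfs : Summable f := hQ.prod
  have h1 : (∑' j, a j) * (∑' j, b j) = ∑' d, f d := by
    rw [tsum_mul_tsum_of_summable_norm ha hb, ← e.tsum_eq]
    exact hQ.tsum_prod
  have hpos : Summable fun d : ℕ ↦ f d := hfs.comp_injective Nat.cast_injective
  have hneg : Summable fun d : ℕ ↦ f (-((d : ℤ) + 1)) :=
    hfs.comp_injective (i := fun d : ℕ ↦ -((d : ℤ) + 1)) fun x y hxy ↦ by simpa using hxy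
  -- Gaps d ≥ 2 form one paraproduct, gaps d ≤ -2 the other, and |d| ≤ 1 the remainder.
  have h2 : ∑' d, f d = (∑' d : ℕ, f (d + 2)) + (∑' d : ℕ, f (-((d : ℤ) + 2))) +
      (f 1 + f 0 + f (-1)) := by
    rw [(HasSum.of_nat_of_neg_add_one hpos.hasSum hneg.hasSum).tsum_eq,
      ← hpos.sum_add_tsum_nat_add 2, ← hneg.sum_add_tsum_nat_add 1]
    simp only [Finset.sum_range_succ, Finset.sum_range_zero, zero_add]
    have e1 : ∀ d : ℕ, f (-(((d + 1 : ℕ) : ℤ) + 1)) = f (-((d : ℤ) + 2)) := fun d ↦ by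
      congr 1
    simp only [e1]
    push_cast
    norm_num
    ring
  have hswap : ∀ {ρ : ℕ → ℤ} (_ : Function.Injective ρ),
      ∑' d, f (ρ d) = ∑' j, ∑' d, a (j - ρ d) * b j := fun {ρ} hρ ↦ by
    have hs : Summable fun z : ℕ × ℤ ↦ a (z.2 - ρ z.1) * b z.2 :=
      hQ.comp_injective (i := fun z : ℕ × ℤ ↦ (ρ z.1, z.2)) fun x y hxy ↦ by
        simp only [Prod.mk.injEq] at hxy
        exact Prod.ext (hρ hxy.1) hxy.2
    exact Summable.tsum_comm (f := fun j d ↦ a (j - ρ d) * b j) hs.prod_symm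
  rw [h1, h2]
  congr 1
  · congr 1
    · rw [hswap (ρ := fun d ↦ (d : ℤ) + 2) fun x y hxy ↦ by simpa using hxy]
      refine tsum_congr fun j ↦ ?_
      rw [← tsum_mul_right]
      refine tsum_congr fun d ↦ ?_
      congr 2
      ring
    · have hs : Summable fun z : ℕ × ℤ ↦ a z.2 * b (z.2 - 1 - 1 - z.1) :=
        hP.comp_injective (i := fun z : ℕ × ℤ ↦ (z.2, z.2 - 1 - 1 - z.1)) fun x y hxy ↦ by
          simp only [Prod.mk.injEq] at hxy
          refine Prod.ext ?_ hxy.1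
          have := hxy.2
          rw [hxy.1] at this
          simpa using this
      have e1 : ∀ d : ℕ, f (-((d : ℤ) + 2)) = ∑' j, a j * b (j - 1 - 1 - d) := fun d ↦ by
        rw [hf, ← (Equiv.addRight ((d : ℤ) + 2)).tsum_eq (fun j ↦ a j * b (j - 1 - 1 - d))]
        refine tsum_congr fun j ↦ ?_
        simp only [Equiv.coe_addRight]
        congr 2; ring
      simp only [e1]
      rw [Summable.tsum_comm (f := fun (j : ℤ) (d : ℕ) ↦ a j * b (j - 1 - 1 - d)) hs.prod_symm]
      refine tsum_congr fun j ↦ ?_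
      rw [tsum_mul_left, mul_comm]
  · have hs : ∀ ν : ℤ, Summable fun j ↦ a j * b (j - ν) := fun ν ↦
      hP.comp_injective (i := fun j : ℤ ↦ (j, j - ν)) fun x y hxy ↦ by
        simp only [Prod.mk.injEq] at hxy
        exact hxy.1
    rw [Summable.tsum_finsetSum fun ν _ ↦ hs ν]
    have e1 : ∀ ν : ℤ, ∑' j, a j * b (j - ν) = f (-ν) := fun ν ↦ by
      rw [hf, ← (Equiv.addRight ν).tsum_eq]
      refine tsum_congr fun j ↦ ?_
      simp
    simp only [e1]
    rw [show Finset.Icc (-1 : ℤ) 1 = {-1, 0, 1} by decide, Finset.sum_insert (by decide),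
      Finset.sum_insert (by decide), Finset.sum_singleton]
    norm_num
    ring

variable {u w : 𝓢'(Rn n, ℂ)} {G H : Rn n → ℂ}

theorem IsDyadicPair.summable_norm_blocks_apply (h : IsDyadicPair χ φ) (hG : Integrable G)
    (x : Rn n) : Summable fun j : ℤ ↦ ‖𝓕⁻ (fun ξ ↦ dyadicSymbol φ j ξ * G ξ) x‖ :=
  Summable.of_nonneg_of_le (fun _ ↦ norm_nonneg _) (fun _ ↦ norm_fourierInv_le _ _)
    (h.summable_blocks hG)

/-- Bony's decomposition of a product. -/
theorem IsDyadicPair.distMul_eq_para [NeZero n] (h : IsDyadicPair χ φ) (hu : HasSpectrum u G)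
    (hw : HasSpectrum w H) :
    distMul u w = paraprod χ φ u w + paraprod χ φ w u + remainder φ u w := by
  have W1 := h.wienerSummable_paraTerm hu hw
  have W2 := h.wienerSummable_paraTerm hw hu
  have W3 := h.wienerSummable_remTerm hu hw
  have R := ((W1.hasSpectrum_tsum.representedBy).add W2.hasSpectrum_tsum.representedBy).add
    W3.hasSpectrum_tsum.representedBy
  refine (hu.representedBy_distMul hw).eq R (ae_of_all _ fun x ↦ ?_)
  simp only [Pi.add_apply]
  rw [← (W1.hasSum_fourierInv x).tsum_eq, ← (W2.hasSum_fourierInv x).tsum_eq,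
    ← (W3.hasSum_fourierInv x).tsum_eq, ← (h.hasSum_blocks_apply hu x).tsum_eq,
    ← (h.hasSum_blocks_apply hw x).tsum_eq,
    tsum_mul_tsum_eq_para (h.summable_norm_blocks_apply hu.1 x)
      (h.summable_norm_blocks_apply hw.1 x)]
  have eP : ∀ {u w : 𝓢'(Rn n, ℂ)} {G H : Rn n → ℂ} (_ : HasSpectrum u G) (_ : HasSpectrum w H)
      (j : ℤ), 𝓕⁻ (paraSpectrum χ φ G H j) x =
      (∑' i : ℕ, 𝓕⁻ (fun ξ ↦ dyadicSymbol φ (j - 1 - 1 - i) ξ * G ξ) x) *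
        𝓕⁻ (fun ξ ↦ dyadicSymbol φ j ξ * H ξ) x := fun {u w G H} hu hw j ↦ by
    rw [paraSpectrum, fourierInv_convolution (h.isCutoff_low.integrable_symbol_mul _ hu.1)
      (h.isCutoff_ann.integrable_symbol_mul _ hw.1), (h.hasSum_low_apply hu _ x).tsum_eq]
  have eR : ∀ j : ℤ, 𝓕⁻ (∑ ν ∈ Finset.Icc (-1 : ℤ) 1, blockSpectrum φ G H j ν) x =
      ∑ ν ∈ Finset.Icc (-1 : ℤ) 1, 𝓕⁻ (fun ξ ↦ dyadicSymbol φ j ξ * G ξ) x *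
        𝓕⁻ (fun ξ ↦ dyadicSymbol φ (j - ν) ξ * H ξ) x := fun j ↦ by
    have hi := fun ν ↦ ((h.wienerSummable_block hu hw ν).1 j).1
    rw [show (∑ ν ∈ Finset.Icc (-1 : ℤ) 1, blockSpectrum φ G H j ν) =
      fun ξ ↦ ∑ ν ∈ Finset.Icc (-1 : ℤ) 1, blockSpectrum φ G H j ν ξ by
        funext ξ; simp only [Finset.sum_apply], fourierInv_finset_sum _ fun ν _ ↦ hi ν]
    refine Finset.sum_congr rfl fun ν _ ↦ ?_
    exact fourierInv_convolution (h.isCutoff_ann.integrable_symbol_mul _ hu.1)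
      (h.isCutoff_ann.integrable_symbol_mul _ hw.1) x
  simp only [eP hu hw, eP hw hu, eR]

theorem IsDyadicPair.partialD_remainder (h : IsDyadicPair χ φ) (hu : HasSpectrum₁ u G)
    (hw : HasSpectrum₁ w H) (k : Fin n) :
    partialD k (remainder φ u w) =
      remainder φ (partialD k u) w + remainder φ u (partialD k w) := by
  rw [remainder, partialD_tsum k (h.wienerSummable_remTerm hu.1 hw.1).summable, remainder,
    remainder, ← Summable.tsum_add (h.wienerSummable_remTerm (hu.partialD k) hw.1).summable
    (h.wienerSummable_remTerm hu.1 (hw.partialD k)).summable]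
  refine tsum_congr fun j ↦ ?_
  have e : ∀ (s : Finset ℤ) (t : ℤ → 𝓢'(Rn n, ℂ)), partialD k (∑ ν ∈ s, t ν) =
      ∑ ν ∈ s, partialD k (t ν) := fun s t ↦ by simp only [partialD_eq, map_sum]
  rw [remTerm, e, remTerm, remTerm, ← Finset.sum_add_distrib]
  refine Finset.sum_congr rfl fun ν _ ↦ ?_
  rw [(hu.dyadic h.isCutoff_ann j).partialD_distMul (hw.dyadic h.isCutoff_ann (j - ν)) k,
    partialD_dyadic h.isCutoff_ann, partialD_dyadic h.isCutoff_ann]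

end Bony

/-! ### The identity R_j = R_j^1 + ... + R_j^6 -/

section Decomposition

theorem IsDyadicPair.allDefined (h : IsDyadicPair χ φ)
    {v : 𝓢'(Rn n, EuclideanSpace ℂ (Fin n))} {f : 𝓢'(Rn n, ℂ)} (hv : MemHdotInter v)
    (hf : MemHdotInter f) (j : ℤ) : AllDefined χ φ v f j := by
  intro k
  obtain ⟨V, hV⟩ := hv.exists_hasSpectrum₁_component k
  obtain ⟨K, hK⟩ := hf.exists_hasSpectrum₁
  have hdf := hK.partialD k
  have hjdf := hdf.dyadic h.isCutoff_ann j
  have hdjf : HasSpectrum (partialD k (dyadic φ j f)) _ :=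
    (hK.dyadic h.isCutoff_ann j).partialD k
  exact ⟨hV.1.hasProduct hjdf, hV.1.hasProduct hdf, h.hasPara hV.1 hjdf, h.hasPara hV.1 hdf,
    h.hasPara hdjf hV.1, h.hasPara hdf hV.1, h.hasRem hV.1 hdjf, h.hasRem hV.1 hK.1,
    h.hasRem (hV.partialD k) hK.1⟩

/-- Bony's decomposition of both products gives the six terms once Ṙ(v_k, ∇_k f) is rewritten as ∇_k
Ṙ(v_k, f) - Ṙ(∇_k v_k, f). -/
theorem IsDyadicPair.commTerm_eq (h : IsDyadicPair χ φ)
    {v : 𝓢'(Rn n, EuclideanSpace ℂ (Fin n))} {f : 𝓢'(Rn n, ℂ)} (hv : MemHdotInter v)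
    (hf : MemHdotInter f) (j : ℤ) :
    commTerm φ v f j =
      R1 χ φ v f j + R2 χ φ v f j + R3 χ φ v f j + R4 φ v f j + R5 φ v f j + R6 φ v f j := by
  simp only [commTerm, R1, R2, R3, R4, R5, R6, ← Finset.sum_add_distrib]
  refine Finset.sum_congr rfl fun k _ ↦ ?_
  -- A summation index exists, so the dimension is positive.
  have : NeZero n := ⟨fun h0 ↦ by subst h0; exact k.elim0⟩
  obtain ⟨V, hV⟩ := hv.exists_hasSpectrum₁_component k
  obtain ⟨K, hK⟩ := hf.exists_hasSpectrum₁
  have hdf := hK.partialD k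
  have hjdf := hdf.dyadic h.isCutoff_ann j
  have e1 : remainder φ (component v k) (partialD k f) =
      partialD k (remainder φ (component v k) f) - remainder φ (partialD k (component v k)) f := by
    rw [h.partialD_remainder hV hK k]; abel
  rw [h.distMul_eq_para hV.1 hjdf, h.distMul_eq_para hV.1 hdf, e1, dyadic_add, dyadic_add,
    dyadic_sub, partialD_dyadic h.isCutoff_ann, partialD_dyadic h.isCutoff_ann]
  abel

end Decomposition

end LittlewoodPaley

namespace LittlewoodPaley

/-! ### Hölder and Young inequalities in ℓ^q for q ≥ 1/2 -/

section SequenceNorm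

/-- The `ℓ^q(ℤ)` norm of a sequence in `[0, ∞]`. -/
def lqNorm (q : ℝ≥0∞) (a : ℤ → ℝ≥0∞) : ℝ≥0∞ := eLpNorm a q Measure.count

theorem lqNorm_top (a : ℤ → ℝ≥0∞) : lqNorm ⊤ a = ⨆ j, a j := by
  rw [lqNorm, eLpNorm_exponent_top, eLpNormEssSup_eq_essSup_enorm]
  simp only [enorm_eq_self]
  exact essSup_count (α := ℤ) (f := a)

theorem lqNorm_eq_tsum {q : ℝ≥0∞} (hq : q ≠ 0) (hq' : q ≠ ⊤) (a : ℤ → ℝ≥0∞) :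
    lqNorm q a = (∑' j, a j ^ q.toReal) ^ (1 / q.toReal) := by
  rw [lqNorm, eLpNorm_eq_lintegral_rpow_enorm_toReal hq hq', lintegral_count]
  simp only [enorm_eq_self]

theorem lqNorm_mono {q : ℝ≥0∞} {a b : ℤ → ℝ≥0∞} (h : ∀ j, a j ≤ b j) : lqNorm q a ≤ lqNorm q b :=
  eLpNorm_mono_enorm fun j ↦ by simpa using h j

theorem lqNorm_const_mul {q : ℝ≥0∞} (hq : q ≠ 0) (c : ℝ≥0∞) (a : ℤ → ℝ≥0∞) :
    lqNorm q (fun j ↦ c * a j) = c * lqNorm q a := by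
  rcases eq_or_ne q ⊤ with rfl | hq'
  · simp only [lqNorm_top, ENNReal.mul_iSup]
  · have hQ : 0 < q.toReal := ENNReal.toReal_pos hq hq'
    simp only [lqNorm_eq_tsum hq hq', ENNReal.mul_rpow_of_nonneg _ _ hQ.le, ENNReal.tsum_mul_left]
    rw [ENNReal.mul_rpow_of_nonneg _ _ (by positivity), ← ENNReal.rpow_mul,
      mul_one_div_cancel hQ.ne', ENNReal.rpow_one]

/-- The exponent q may be below 1. When q₁ or q₂ is infinite, that factor is replaced by its
supremum; the remaining case is Hölder's inequality with finite exponents. -/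
theorem lqNorm_mul_le {q q₁ q₂ : ℝ≥0∞} (hq₁ : 1 ≤ q₁) (hq₂ : 1 ≤ q₂) (h : q⁻¹ = q₁⁻¹ + q₂⁻¹)
    (a b : ℤ → ℝ≥0∞) : lqNorm q (fun j ↦ a j * b j) ≤ lqNorm q₁ a * lqNorm q₂ b := by
  have h1 : q₁ ≠ 0 := (one_pos.trans_le hq₁).ne'
  have h2 : q₂ ≠ 0 := (one_pos.trans_le hq₂).ne'
  rcases eq_or_ne q₁ ⊤ with rfl | h1'
  · have : q = q₂ := by simpa using h
    subst this
    rw [← lqNorm_const_mul h2, lqNorm_top]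
    exact lqNorm_mono fun j ↦ mul_le_mul_left (le_iSup a j) _
  rcases eq_or_ne q₂ ⊤ with rfl | h2'
  · have : q = q₁ := by simpa using h
    subst this
    rw [mul_comm, ← lqNorm_const_mul h1, lqNorm_top]
    refine lqNorm_mono fun j ↦ ?_
    rw [mul_comm]
    exact mul_le_mul_left (le_iSup b j) _
  have hq0 : q ≠ 0 := by
    rintro rfl
    rw [ENNReal.inv_zero] at h
    exact absurd h.symm (ENNReal.add_ne_top.2 ⟨ENNReal.inv_ne_top.2 h1, ENNReal.inv_ne_top.2 h2⟩)
  have hqt : q ≠ ⊤ := by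
    rintro rfl
    rw [ENNReal.inv_top] at h
    exact h1' (ENNReal.inv_eq_zero.1 (add_eq_zero.1 h.symm).1)
  have r1 := ENNReal.toReal_pos h1 h1'
  have r2 := ENNReal.toReal_pos h2 h2'
  have r0 := ENNReal.toReal_pos hq0 hqt
  have hr : 1 / q.toReal = 1 / q₁.toReal + 1 / q₂.toReal := by
    have := congrArg ENNReal.toReal h
    rw [ENNReal.toReal_add (by simpa) (by simpa)] at this
    simpa [ENNReal.toReal_inv] using this
  have hlt : q.toReal < q₁.toReal := by
    rw [← one_div_lt_one_div r1 r0, hr]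
    have : 0 < 1 / q₂.toReal := by positivity
    linarith
  have key := ENNReal.lintegral_Lp_mul_le_Lq_mul_Lr (μ := (Measure.count : Measure ℤ)) r0 hlt hr
    (f := a) (g := b) (measurable_from_top.aemeasurable) (measurable_from_top.aemeasurable)
  simp only [lintegral_count, Pi.mul_apply] at key
  rw [lqNorm_eq_tsum hq0 hqt, lqNorm_eq_tsum h1 h1', lqNorm_eq_tsum h2 h2']
  exact key

/-- This lower bound is the only information on q that the constants use. -/
theorem half_le_of_inv_eq {q q₁ q₂ : ℝ≥0∞} (hq₁ : 1 ≤ q₁) (hq₂ : 1 ≤ q₂)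
    (h : q⁻¹ = q₁⁻¹ + q₂⁻¹) : 2⁻¹ ≤ q := by
  rw [← ENNReal.inv_le_inv, inv_inv, h]
  calc q₁⁻¹ + q₂⁻¹ ≤ 1 + 1 := add_le_add (ENNReal.inv_le_one.2 hq₁) (ENNReal.inv_le_one.2 hq₂)
    _ = 2 := one_add_one_eq_two

theorem ne_zero_of_half_le {q : ℝ≥0∞} (hq : 2⁻¹ ≤ q) : q ≠ 0 := by
  rintro rfl
  simp at hq

/-- A discrete Young inequality for geometric kernels, uniform in `q ≥ 1/2`. -/
theorem exists_lqNorm_conv_le {σ : ℝ} (hσ : 0 < σ) : ∃ K : ℝ≥0, ∀ q : ℝ≥0∞, 2⁻¹ ≤ q →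
    ∀ (e : ℕ → ℤ) (a : ℤ → ℝ≥0∞),
      lqNorm q (fun j ↦ ∑' i : ℕ, (2 : ℝ≥0∞) ^ (-(σ * i)) * a (j + e i)) ≤ K * lqNorm q a := by
  -- The kernel is ρ^{4i}, split into two factors ρ^{2i}. One is summed against a supremum; the
  -- other, raised to a power Q ≥ 1/2, still leaves ρ^i.
  set ρ : ℝ≥0∞ := (2 : ℝ≥0∞) ^ (-(σ / 4)) with hρ
  have hρ1 : ρ < 1 := ENNReal.rpow_lt_one_of_one_lt_of_neg (by norm_num) (by linarith)
  set L : ℝ≥0∞ := ∑' i : ℕ, ρ ^ i with hL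
  have hLt : L ≠ ⊤ := by
    rw [hL, ENNReal.tsum_geometric]
    exact ENNReal.inv_ne_top.2 (tsub_pos_of_lt hρ1).ne'
  have hL1 : 1 ≤ L := by
    have := ENNReal.le_tsum (f := fun i : ℕ ↦ ρ ^ i) 0
    rwa [pow_zero] at this
  have hk : ∀ i : ℕ, (2 : ℝ≥0∞) ^ (-(σ * i)) = ρ ^ (2 * i) * ρ ^ (2 * i) := fun i ↦ by
    rw [← pow_add, ← ENNReal.rpow_natCast, hρ, ← ENNReal.rpow_mul]
    congr 1
    push_cast
    ring
  have hρle : ∀ i : ℕ, ρ ^ (2 * i) ≤ ρ ^ i := fun i ↦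
    pow_le_pow_right_of_le_one' hρ1.le (by omega)
  refine ⟨(L ^ 3).toNNReal, fun q hq e a ↦ ?_⟩
  rw [ENNReal.coe_toNNReal (ENNReal.pow_ne_top hLt)]
  have hq0 := ne_zero_of_half_le hq
  rcases eq_or_ne q ⊤ with rfl | hq'
  · rw [lqNorm_top, lqNorm_top]
    refine iSup_le fun j ↦ ?_
    calc ∑' i : ℕ, (2 : ℝ≥0∞) ^ (-(σ * i)) * a (j + e i)
        ≤ ∑' i : ℕ, ρ ^ i * ⨆ j, a j := by
          refine ENNReal.tsum_le_tsum fun i ↦ mul_le_mul' ?_ (le_iSup a _)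
          rw [hk]
          exact (mul_le_of_le_one_left zero_le (pow_le_one₀ zero_le hρ1.le)).trans (hρle i)
      _ = L * ⨆ j, a j := ENNReal.tsum_mul_right
      _ ≤ L ^ 3 * ⨆ j, a j := mul_le_mul_left (le_self_pow₀ hL1 (by norm_num)) _
  · set Q := q.toReal with hQ
    have hQ0 : 0 < Q := ENNReal.toReal_pos hq0 hq'
    have hQ2 : 1 ≤ 2 * Q := by
      have := ENNReal.toReal_mono hq' hq
      rw [ENNReal.toReal_inv, ENNReal.toReal_ofNat] at this
      linarith
    rw [lqNorm_eq_tsum hq0 hq', lqNorm_eq_tsum hq0 hq', ← hQ, one_div]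
    have h1 : ∀ j, (∑' i : ℕ, (2 : ℝ≥0∞) ^ (-(σ * i)) * a (j + e i)) ^ Q ≤
        L ^ Q * ∑' i : ℕ, ρ ^ i * a (j + e i) ^ Q := fun j ↦ by
      -- The ℓ^Q norm dominates the supremum for every Q > 0, so no triangle inequality is needed
      -- when Q < 1.
      set M := (∑' i : ℕ, (ρ ^ (2 * i) * a (j + e i)) ^ Q) ^ Q⁻¹ with hM
      have h2 : ∀ i : ℕ, ρ ^ (2 * i) * a (j + e i) ≤ M := fun i ↦ by
        rw [hM, ENNReal.le_rpow_inv_iff hQ0]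
        exact ENNReal.le_tsum (f := fun i : ℕ ↦ (ρ ^ (2 * i) * a (j + e i)) ^ Q) i
      have h3 : ∑' i : ℕ, (2 : ℝ≥0∞) ^ (-(σ * i)) * a (j + e i) ≤ L * M := by
        rw [hL, ← ENNReal.tsum_mul_right]
        refine ENNReal.tsum_le_tsum fun i ↦ ?_
        rw [hk, mul_assoc]
        exact mul_le_mul' (hρle i) (h2 i)
      refine (ENNReal.rpow_le_rpow h3 hQ0.le).trans ?_
      rw [ENNReal.mul_rpow_of_nonneg _ _ hQ0.le, hM, ENNReal.rpow_inv_rpow hQ0.ne']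
      refine mul_le_mul_right (ENNReal.tsum_le_tsum fun i ↦ ?_) _
      rw [ENNReal.mul_rpow_of_nonneg _ _ hQ0.le]
      refine mul_le_mul_left ?_ _
      rw [← ENNReal.rpow_natCast, ← ENNReal.rpow_mul, ← ENNReal.rpow_natCast]
      refine ENNReal.rpow_le_rpow_of_exponent_ge hρ1.le ?_
      push_cast
      nlinarith [(Nat.cast_nonneg i : (0 : ℝ) ≤ i)]
    have h4 : ∑' j, (∑' i : ℕ, (2 : ℝ≥0∞) ^ (-(σ * i)) * a (j + e i)) ^ Q ≤
        L ^ Q * (L * ∑' j, a j ^ Q) := by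
      refine (ENNReal.tsum_le_tsum h1).trans_eq ?_
      rw [ENNReal.tsum_mul_left, ENNReal.tsum_comm, hL, ← ENNReal.tsum_mul_right]
      congr 2
      funext i
      rw [ENNReal.tsum_mul_left]
      congr 1
      exact (Equiv.addRight (e i)).tsum_eq fun j ↦ a j ^ Q
    refine (ENNReal.rpow_le_rpow h4 (by positivity)).trans ?_
    rw [ENNReal.mul_rpow_of_nonneg _ _ (by positivity),
      ENNReal.mul_rpow_of_nonneg _ _ (by positivity), ENNReal.rpow_rpow_inv hQ0.ne', ← mul_assoc]
    refine mul_le_mul_left ?_ _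
    -- Here 1/Q ≤ 2 and L ≥ 1 make the constant L³ independent of q.
    have : L ^ Q⁻¹ ≤ L ^ (2 : ℝ) := by
      refine ENNReal.rpow_le_rpow_of_exponent_le hL1 ?_
      rw [inv_le_comm₀ hQ0 two_pos]
      linarith
    calc L * L ^ Q⁻¹ ≤ L * L ^ (2 : ℝ) := mul_le_mul_right this _
      _ = L ^ 3 := by
        rw [show (2 : ℝ) = ((2 : ℕ) : ℝ) by norm_num, ENNReal.rpow_natCast]; ring

/-- The nine shifts are i - 4 with 0 ≤ i ≤ 8, where 2^8 · 2^{-i} ≥ 1, so a geometric kernel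
dominates the window. -/
theorem exists_lqNorm_window_le : ∃ K : ℝ≥0, ∀ q : ℝ≥0∞, 2⁻¹ ≤ q → ∀ a : ℤ → ℝ≥0∞,
    lqNorm q (fun j ↦ ∑ m ∈ Finset.Icc (-4 : ℤ) 4, a (j + m)) ≤ K * lqNorm q a := by
  obtain ⟨K, hK⟩ := exists_lqNorm_conv_le one_pos
  refine ⟨2 ^ 8 * K, fun q hq a ↦ ?_⟩
  have h1 := hK q hq (fun i ↦ (i : ℤ) - 4) a
  have h2 : ∀ j, ∑ m ∈ Finset.Icc (-4 : ℤ) 4, a (j + m) ≤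
      2 ^ 8 * ∑' i : ℕ, (2 : ℝ≥0∞) ^ (-(1 * (i : ℝ))) * a (j + ((i : ℤ) - 4)) := fun j ↦ by
    have e : Finset.Icc (-4 : ℤ) 4 = (Finset.range 9).image fun i : ℕ ↦ (i : ℤ) - 4 := by decide
    rw [e, Finset.sum_image (fun x _ y _ hxy ↦ by simpa using hxy), ← ENNReal.tsum_mul_left]
    refine le_trans (Finset.sum_le_sum fun i hi ↦ ?_) (ENNReal.sum_le_tsum (Finset.range 9))
    rw [← mul_assoc]
    refine le_mul_of_one_le_left zero_le ?_
    rw [← ENNReal.rpow_natCast, ← ENNReal.rpow_add _ _ two_ne_zero ENNReal.ofNat_ne_top]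
    have hi' : (i : ℝ) ≤ 8 := by exact_mod_cast Nat.lt_succ_iff.1 (Finset.mem_range.1 hi)
    rw [← ENNReal.one_rpow ((8 : ℕ) + -(1 * (i : ℝ)))]
    exact ENNReal.rpow_le_rpow (by norm_num) (by push_cast; linarith)
  refine (lqNorm_mono h2).trans ?_
  rw [lqNorm_const_mul (ne_zero_of_half_le hq)]
  push_cast
  rw [mul_assoc]
  exact mul_le_mul_right h1 _

end SequenceNorm

end LittlewoodPaley

namespace LittlewoodPaley

/-! ### Weighted sequence norms -/

section WeightedNorm

/-- The norm of `j ↦ 2^{js} a_j` in `ℓ^q(ℤ)`. -/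
def weightedNorm (s : ℝ) (q : ℝ≥0∞) (a : ℤ → ℝ≥0∞) : ℝ≥0∞ :=
  lqNorm q fun j ↦ (2 : ℝ≥0∞) ^ ((j : ℝ) * s) * a j

theorem weightedNorm_mono {s : ℝ} {q : ℝ≥0∞} {a b : ℤ → ℝ≥0∞} (h : ∀ j, a j ≤ b j) :
    weightedNorm s q a ≤ weightedNorm s q b :=
  lqNorm_mono fun j ↦ mul_le_mul_right (h j) _

theorem weightedNorm_const_mul {q : ℝ≥0∞} (hq : q ≠ 0) (s : ℝ) (c : ℝ≥0∞) (a : ℤ → ℝ≥0∞) :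
    weightedNorm s q (fun j ↦ c * a j) = c * weightedNorm s q a := by
  rw [weightedNorm, weightedNorm, ← lqNorm_const_mul hq]
  simp only [mul_left_comm]

theorem two_rpow_add (x y : ℝ) : (2 : ℝ≥0∞) ^ (x + y) = 2 ^ x * 2 ^ y :=
  ENNReal.rpow_add x y two_ne_zero ENNReal.ofNat_ne_top

theorem weightedNorm_mul_le {q q₁ q₂ : ℝ≥0∞} (hq₁ : 1 ≤ q₁) (hq₂ : 1 ≤ q₂)
    (h : q⁻¹ = q₁⁻¹ + q₂⁻¹) (s₁ s₂ : ℝ) (a b : ℤ → ℝ≥0∞) :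
    weightedNorm (s₁ + s₂) q (fun j ↦ a j * b j) ≤ weightedNorm s₁ q₁ a * weightedNorm s₂ q₂ b := by
  refine le_trans (le_of_eq ?_) (lqNorm_mul_le hq₁ hq₂ h _ _)
  rw [weightedNorm]
  congr 1
  funext j
  rw [mul_add, two_rpow_add, mul_mul_mul_comm]

/-- The one-sided geometric mean `∑_{i ≥ 0} 2^{-κ i} a_{j + c + ε i}`. -/
def geomConv (κ c ε : ℤ) (a : ℤ → ℝ≥0∞) (j : ℤ) : ℝ≥0∞ :=
  ∑' i : ℕ, (2 : ℝ≥0∞) ^ (-(κ * i)) * a (j + (c + ε * i))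

/-- The sum of a sequence over a window of length `9` around `j`. -/
def windowSum (a : ℤ → ℝ≥0∞) (j : ℤ) : ℝ≥0∞ := ∑ m ∈ Finset.Icc (-4 : ℤ) 4, a (j + m)

/-- Convolution with a one-sided geometric kernel, uniformly in `q ≥ 1/2`. -/
theorem exists_weightedNorm_conv_le {s : ℝ} {κ ε : ℤ} (c : ℤ) (h : 0 < κ + ε * s) :
    ∃ K : ℝ≥0, ∀ q : ℝ≥0∞, 2⁻¹ ≤ q → ∀ a : ℤ → ℝ≥0∞,
      weightedNorm s q (geomConv κ c ε a) ≤ K * weightedNorm s q a := by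
  -- Shifting by c + εi changes the weight by 2^{-(c+εi)s}: the kernel then decays at rate κ + εs,
  -- and the fixed shift c costs only 2^{-cs}.
  obtain ⟨K, hK⟩ := exists_lqNorm_conv_le h
  have hc : (2 : ℝ≥0∞) ^ (-(c * s)) ≠ ⊤ :=
    ENNReal.rpow_ne_top_of_ne_zero two_ne_zero ENNReal.ofNat_ne_top
  refine ⟨((2 : ℝ≥0∞) ^ (-(c * s))).toNNReal * K, fun q hq a ↦ ?_⟩
  have h1 := hK q hq (fun i ↦ c + ε * i) fun j ↦ (2 : ℝ≥0∞) ^ ((j : ℝ) * s) * a j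
  rw [ENNReal.coe_mul, ENNReal.coe_toNNReal hc, mul_assoc]
  refine le_trans (le_of_eq ?_) (mul_le_mul_right h1 _)
  rw [weightedNorm, ← lqNorm_const_mul (ne_zero_of_half_le hq)]
  congr 1
  funext j
  rw [geomConv, ← ENNReal.tsum_mul_left, ← ENNReal.tsum_mul_left]
  refine tsum_congr fun i ↦ ?_
  rw [← ENNReal.rpow_intCast, ← mul_assoc, ← mul_assoc, ← mul_assoc, ← two_rpow_add, ← two_rpow_add, ← two_rpow_add]
  congr 2
  push_cast
  ring

theorem exists_weightedNorm_window_le (s : ℝ) : ∃ K : ℝ≥0, ∀ q : ℝ≥0∞, 2⁻¹ ≤ q →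
    ∀ a : ℤ → ℝ≥0∞, weightedNorm s q (windowSum a) ≤ K * weightedNorm s q a := by
  obtain ⟨K, hK⟩ := exists_lqNorm_window_le
  have hc : (2 : ℝ≥0∞) ^ (4 * |s|) ≠ ⊤ :=
    ENNReal.rpow_ne_top_of_ne_zero two_ne_zero ENNReal.ofNat_ne_top
  refine ⟨((2 : ℝ≥0∞) ^ (4 * |s|)).toNNReal * K, fun q hq a ↦ ?_⟩
  have h1 := hK q hq fun j ↦ (2 : ℝ≥0∞) ^ ((j : ℝ) * s) * a j
  rw [ENNReal.coe_mul, ENNReal.coe_toNNReal hc, mul_assoc]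
  refine le_trans ?_ (mul_le_mul_right h1 _)
  rw [weightedNorm, ← lqNorm_const_mul (ne_zero_of_half_le hq)]
  refine lqNorm_mono fun j ↦ ?_
  rw [windowSum, Finset.mul_sum, Finset.mul_sum]
  refine Finset.sum_le_sum fun m hm ↦ ?_
  rw [← mul_assoc, ← two_rpow_add]
  refine mul_le_mul_left (ENNReal.rpow_le_rpow_of_exponent_le one_le_two ?_) _
  rw [Finset.mem_Icc] at hm
  have hm1 : |(m : ℝ)| ≤ 4 := abs_le.2 ⟨by exact_mod_cast hm.1, by exact_mod_cast hm.2⟩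
  have h2 : -(m * s) ≤ 4 * |s| := by
    calc -((m : ℝ) * s) ≤ |(m : ℝ) * s| := neg_le_abs _
      _ = |(m : ℝ)| * |s| := abs_mul _ _
      _ ≤ 4 * |s| := mul_le_mul_of_nonneg_right hm1 (abs_nonneg s)
  push_cast
  linarith

end WeightedNorm

end LittlewoodPaley

namespace LittlewoodPaley

open FourierTransform Filter Topology
open scoped Convolution

variable {n : ℕ} {χ φ : Rn n → ℝ}

/-! ### Entries of the gradient -/

section Gradient

variable {F F' : Type*} [NormedAddCommGroup F] [NormedSpace ℂ F] [NormedAddCommGroup F']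
  [NormedSpace ℂ F']

theorem RepresentedBy.postcomp [CompleteSpace F] [CompleteSpace F'] {u : 𝓢'(Rn n, F)}
    {g : Rn n → F} (h : RepresentedBy u g) (L : F →L[ℂ] F') :
    RepresentedBy (PointwiseConvergenceCLM.postcomp 𝓢(Rn n, ℂ) L u) (fun x ↦ L (g x)) := by
  intro θ
  have h1 := L.integrable_comp (h θ).1
  have h2 := L.integral_comp_comm (h θ).1
  simp only [map_smul] at h1 h2
  refine ⟨h1, ?_⟩
  rw [h2, ← (h θ).2]
  rfl

theorem distLpNorm_postcomp_le [CompleteSpace F] [CompleteSpace F'] (p : ℝ≥0∞) (u : 𝓢'(Rn n, F))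
    {L : F →L[ℂ] F'} (hL : ∀ x, ‖L x‖ ≤ ‖x‖) :
    distLpNorm p (PointwiseConvergenceCLM.postcomp 𝓢(Rn n, ℂ) L u) ≤ distLpNorm p u := by
  refine le_iInf₂ fun g hg ↦ ?_
  have h1 : MemLp (fun x ↦ L (g x)) p volume :=
    hg.1.mono (L.continuous.comp_aestronglyMeasurable hg.1.1) (ae_of_all _ fun x ↦ hL _)
  exact (iInf₂_le _ ⟨h1, hg.2.postcomp L⟩).trans (eLpNorm_mono fun x ↦ hL _)

theorem postcomp_gradVec (v : 𝓢'(Rn n, EuclideanSpace ℂ (Fin n))) (k l : Fin n) :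
    PointwiseConvergenceCLM.postcomp 𝓢(Rn n, ℂ)
      (EuclideanSpace.proj (k, l) : EuclideanSpace ℂ (Fin n × Fin n) →L[ℂ] ℂ) (gradVec v) =
      partialD k (component v l) := by
  have h (b c : Fin n) : PointwiseConvergenceCLM.postcomp 𝓢(Rn n, ℂ)
      (EuclideanSpace.proj (k, l) : EuclideanSpace ℂ (Fin n × Fin n) →L[ℂ] ℂ)
      (PointwiseConvergenceCLM.postcomp 𝓢(Rn n, ℂ) (ContinuousLinearMap.toSpanSingleton ℂ
        (EuclideanSpace.single (b, c) (1 : ℂ) : EuclideanSpace ℂ (Fin n × Fin n)))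
        (partialD b (component v c))) =
      if b = k ∧ c = l then partialD b (component v c) else 0 := by
    ext θ
    change (partialD b (component v c) θ •
      (EuclideanSpace.single (b, c) (1 : ℂ) : EuclideanSpace ℂ (Fin n × Fin n))) (k, l) = _
    split_ifs with hbc
    · simp [hbc.1, hbc.2]
    · have : (k, l) ≠ (b, c) := fun e ↦ hbc ⟨(Prod.ext_iff.1 e).1.symm, (Prod.ext_iff.1 e).2.symm⟩
      simp only [PiLp.smul_apply, PiLp.single_apply, if_neg this, smul_zero]
      rfl
  simp only [gradVec, map_sum, h, ite_and]
  simp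

theorem distLpNorm_partialD_component_le (p : ℝ≥0∞) (v : 𝓢'(Rn n, EuclideanSpace ℂ (Fin n)))
    (k l : Fin n) : distLpNorm p (partialD k (component v l)) ≤ distLpNorm p (gradVec v) := by
  rw [← postcomp_gradVec]
  exact distLpNorm_postcomp_le p _ fun x ↦ PiLp.norm_apply_le x _

theorem distLpNorm_dyadic_partialD_component_le (m : Rn n → ℝ) (j : ℤ) (p : ℝ≥0∞)
    (v : 𝓢'(Rn n, EuclideanSpace ℂ (Fin n))) (k l : Fin n) :
    distLpNorm p (dyadic m j (partialD k (component v l))) ≤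
      distLpNorm p (dyadic m j (gradVec v)) := by
  have h : PointwiseConvergenceCLM.postcomp 𝓢(Rn n, ℂ)
      (EuclideanSpace.proj (k, l) : EuclideanSpace ℂ (Fin n × Fin n) →L[ℂ] ℂ)
      (dyadic m j (gradVec v)) = dyadic m j (partialD k (component v l)) := by
    -- The multiplier acts on the test function and the projection on the value, so the two commute
    -- by definition.
    rw [← postcomp_gradVec]
    rfl
  rw [← h]
  exact distLpNorm_postcomp_le p _ fun x ↦ PiLp.norm_apply_le x _

end Gradient

/-! ### Frequency localization of paraproducts -/

section Localization

variable {u w : 𝓢'(Rn n, ℂ)} {G H : Rn n → ℂ}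

theorem dyadic_comm {m m' : Rn n → ℝ} (hm : IsCutoff m) (hm' : IsCutoff m') (i j : ℤ)
    (u : 𝓢'(Rn n, ℂ)) : dyadic m i (dyadic m' j u) = dyadic m' j (dyadic m i u) := by
  simp only [dyadic_eq]
  rw [TemperedDistribution.fourierMultiplierCLM_fourierMultiplierCLM_apply
      (hm'.hasTemperateGrowth_symbol j) (hm.hasTemperateGrowth_symbol i),
    TemperedDistribution.fourierMultiplierCLM_fourierMultiplierCLM_apply
      (hm.hasTemperateGrowth_symbol i) (hm'.hasTemperateGrowth_symbol j), mul_comm]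

theorem HasSpectrum.dyadic_dyadic_eq_zero {m m' : Rn n → ℝ} (hm : IsCutoff m) (hm' : IsCutoff m')
    (hu : HasSpectrum u G) {i j : ℤ}
    (h : ∀ ξ, dyadicSymbol m i ξ ≠ 0 → dyadicSymbol m' j ξ = 0) :
    LittlewoodPaley.dyadic m i (LittlewoodPaley.dyadic m' j u) = 0 := by
  refine ((hu.dyadic hm' j).dyadic hm i).eq (HasSpectrum.zero.congr (ae_of_all _ fun ξ ↦ ?_))
  rcases eq_or_ne (dyadicSymbol m i ξ) 0 with h0 | h0
  · simp [h0]
  · simp [h ξ h0]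

theorem HasSpectrum.zero_distMul (hw : HasSpectrum w H) : LittlewoodPaley.distMul 0 w = 0 :=
  (HasSpectrum.zero.distMul hw).eq (HasSpectrum.zero.congr (ae_of_all _ fun ξ ↦ by
    simp [MeasureTheory.convolution]))

theorem HasSpectrum.distMul_zero (hu : HasSpectrum u G) : LittlewoodPaley.distMul u 0 = 0 :=
  (hu.distMul HasSpectrum.zero).eq (HasSpectrum.zero.congr (ae_of_all _ fun ξ ↦ by
    simp [MeasureTheory.convolution]))

/-- A bilateral series whose terms vanish away from `j` is a finite sum. -/
theorem tsum_eq_sum_window {M : Type*} [AddCommMonoid M] [TopologicalSpace M] {a : ℤ → M} {j : ℤ}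
    (h : ∀ i, a i ≠ 0 → i ≤ j + 4 ∧ j ≤ i + 4) :
    ∑' i, a i = ∑ m ∈ Finset.Icc (-4 : ℤ) 4, a (j + m) := by
  rw [tsum_eq_sum (s := (Finset.Icc (-4 : ℤ) 4).map (addLeftEmbedding j)), Finset.sum_map]
  · rfl
  · intro i hi
    by_contra hne
    have := h i hne
    refine hi (Finset.mem_map.2 ⟨i - j, Finset.mem_Icc.2 ⟨by omega, by omega⟩, ?_⟩)
    simp

/-- A bilateral series whose terms vanish on the left of `j` is a unilateral series. -/
theorem tsum_eq_tsum_nat {M : Type*} [AddCommMonoid M] [TopologicalSpace M] {a : ℤ → M} {j : ℤ}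
    (h : ∀ i, a i ≠ 0 → j ≤ i) : ∑' i, a i = ∑' i : ℕ, a (j + i) := by
  symm
  refine Function.Injective.tsum_eq (g := fun i : ℕ ↦ j + (i : ℤ))
    (fun x y hxy ↦ by simpa using hxy) fun i hi ↦ ?_
  exact ⟨(i - j).toNat, by have := h i hi; simp only; omega⟩

theorem IsDyadicPair.dyadic_paraTerm_eq_zero (h : IsDyadicPair χ φ) (hu : HasSpectrum u G)
    (hw : HasSpectrum w H) {i j : ℤ} (hij : ¬(i ≤ j + 4 ∧ j ≤ i + 4)) :
    dyadic φ j (paraTerm χ φ u w i) = 0 := by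
  refine HasSpectrum.dyadic_distMul_eq_zero h.isCutoff_ann j (hu.dyadic h.isCutoff_low _)
    (hw.dyadic h.isCutoff_ann _) fun ξ η hξ hη ↦ ?_
  by_contra hne
  have := h.symbol_para (left_ne_zero_of_mul hξ) (left_ne_zero_of_mul hη) hne
  omega

theorem IsDyadicPair.dyadic_dyadic_eq_zero (h : IsDyadicPair χ φ) (hu : HasSpectrum u G) {i j : ℤ}
    (hij : ¬(i ≤ j + 1 ∧ j ≤ i + 1)) : dyadic φ i (dyadic φ j u) = 0 := by
  refine hu.dyadic_dyadic_eq_zero h.isCutoff_ann h.isCutoff_ann fun ξ hξ ↦ ?_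
  by_contra hne
  exact hij ⟨h.symbol_ann_ann hξ hne, h.symbol_ann_ann hne hξ⟩

theorem IsDyadicPair.low_dyadic_eq_zero (h : IsDyadicPair χ φ) (hu : HasSpectrum u G) {i j : ℤ}
    (hij : i < j) : dyadic χ i (dyadic φ j u) = 0 := by
  refine hu.dyadic_dyadic_eq_zero h.isCutoff_low h.isCutoff_ann fun ξ hξ ↦ ?_
  by_contra hne
  have := h.symbol_low_ann hξ hne
  omega

theorem IsDyadicPair.distLpNorm_low_le [NeZero n] (h : IsDyadicPair χ φ) (hu : HasSpectrum u G)
    {p : ℝ≥0∞} (hp : 1 ≤ p) (j : ℤ) :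
    distLpNorm p (dyadic χ j u) ≤ ∑' i : ℕ, distLpNorm p (dyadic φ (j - 1 - i) u) := by
  rw [h.dyadic_low_eq_tsum hu j]
  exact (h.wienerSummable_low_blocks hu j).distLpNorm_tsum_le hp

theorem IsDyadicPair.dyadic_paraprod (h : IsDyadicPair χ φ) (hu : HasSpectrum u G)
    (hw : HasSpectrum w H) (j : ℤ) : dyadic φ j (paraprod χ φ u w) =
      ∑ m ∈ Finset.Icc (-4 : ℤ) 4, dyadic φ j (paraTerm χ φ u w (j + m)) := by
  rw [paraprod, dyadic_tsum φ j (h.wienerSummable_paraTerm hu hw).summable]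
  refine tsum_eq_sum_window fun i hi ↦ ?_
  by_contra hne
  exact hi (h.dyadic_paraTerm_eq_zero hu hw hne)

/-- Terms survive only for |i - j| ≤ 1. The wider window matches the one for Δ̇_j Ṫ_u w, so that the
two sums can be subtracted term by term. -/
theorem IsDyadicPair.paraprod_dyadic (h : IsDyadicPair χ φ) (hu : HasSpectrum u G)
    (hw : HasSpectrum w H) (j : ℤ) : paraprod χ φ u (dyadic φ j w) =
      ∑ m ∈ Finset.Icc (-4 : ℤ) 4, paraTerm χ φ u (dyadic φ j w) (j + m) := by
  refine tsum_eq_sum_window fun i hi ↦ ?_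
  by_contra hne
  refine hi ?_
  rw [paraTerm, h.dyadic_dyadic_eq_zero hw (by omega)]
  exact HasSpectrum.distMul_zero (hu.dyadic h.isCutoff_low _)

end Localization

end LittlewoodPaley

namespace LittlewoodPaley

variable {n : ℕ} {χ φ : Rn n → ℝ} {p p₁ p₂ : ℝ≥0∞}

/-! ### Estimates of each term at a fixed dyadic index -/

section Pointwise

theorem two_zpow_mul (i j : ℤ) : (2 : ℝ≥0∞) ^ i * 2 ^ j = 2 ^ (i + j) :=
  (ENNReal.zpow_add two_ne_zero ENNReal.ofNat_ne_top i j).symm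

theorem two_zpow_le {i j : ℤ} (h : i ≤ j) : (2 : ℝ≥0∞) ^ i ≤ 2 ^ j :=
  ENNReal.zpow_le_of_le one_le_two h

theorem IsDyadicPair.exists_dyadic_partialD_le (h : IsDyadicPair χ φ) (hp : 1 ≤ p) :
    ∃ C : ℝ≥0, ∀ (u : 𝓢'(Rn n, ℂ)) (G : Rn n → ℂ), HasSpectrum u G → ∀ (j : ℤ) (k : Fin n),
      distLpNorm p (dyadic φ j (partialD k u)) ≤
        C * (2 : ℝ≥0∞) ^ j * distLpNorm p (dyadic φ j u) := by
  obtain ⟨C, hC⟩ := h.exists_bernstein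
  refine ⟨C, fun u G hu j k ↦ ?_⟩
  rw [← partialD_dyadic h.isCutoff_ann]
  exact hC p j k u G hp hu

/-- The abstract majorant d keeps the estimates scalar; it is later taken to be the block norms of
∇v. -/
theorem IsDyadicPair.exists_dyadic_le_of_partialD_le (h : IsDyadicPair χ φ) (hp : 1 ≤ p) :
    ∃ C : ℝ≥0, ∀ (a : 𝓢'(Rn n, ℂ)) (A : Rn n → ℂ), HasSpectrum₁ a A → ∀ d : ℤ → ℝ≥0∞,
      (∀ j l, distLpNorm p (dyadic φ j (partialD l a)) ≤ d j) → ∀ j,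
        distLpNorm p (dyadic φ j a) ≤ C * (2 : ℝ≥0∞) ^ (-j) * d j := by
  obtain ⟨C, hC⟩ := h.exists_reverse_bernstein
  refine ⟨C * n, fun a A ha d hd j ↦ (hC p j a A hp ha).trans ?_⟩
  calc C * (2 : ℝ≥0∞) ^ (-j) * ∑ l, distLpNorm p (dyadic φ j (partialD l a))
      ≤ C * (2 : ℝ≥0∞) ^ (-j) * ∑ _l : Fin n, d j :=
        mul_le_mul_right (Finset.sum_le_sum fun l _ ↦ hd j l) _
    _ = _ := by
      rw [Finset.sum_const, Finset.card_univ, Fintype.card_fin, nsmul_eq_mul]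
      push_cast
      ring

/-- The difference is a window sum of commutators of Δ̇_j with Ṡ_{i-1}a, applied to Δ̇_i ∇_k f. The
gain 2^{-j} offsets the Bernstein factor 2^i up to 2^4. The majorant g of the low-frequency gradient
stays free because the two bounds of R^1 choose it differently. -/
theorem IsDyadicPair.exists_para_commutator_le (h : IsDyadicPair χ φ) (hp : 1 ≤ p) (hp₁ : 1 ≤ p₁)
    (hp₂ : 1 ≤ p₂) (hpp : p⁻¹ = p₁⁻¹ + p₂⁻¹) :
    ∃ C : ℝ≥0, ∀ (a f : 𝓢'(Rn n, ℂ)) (A K : Rn n → ℂ), HasSpectrum₁ a A → HasSpectrum₁ f K →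
      ∀ g : ℤ → ℝ≥0∞, (∀ j l, distLpNorm p₁ (dyadic χ (j - 1) (partialD l a)) ≤ g j) →
      ∀ j k, distLpNorm p (paraprod χ φ a (dyadic φ j (partialD k f)) -
          dyadic φ j (paraprod χ φ a (partialD k f))) ≤
        C * windowSum (fun i ↦ g i * distLpNorm p₂ (dyadic φ i f)) j := by
  obtain ⟨C₁, hC₁⟩ := h.isCutoff_ann.exists_distLpNorm_commutator_le
  obtain ⟨C₂, hC₂⟩ := h.exists_dyadic_partialD_le hp₂
  refine ⟨C₁ * n * C₂ * 2 ^ 4, fun a f A K ha hf g hg j k ↦ ?_⟩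
  have hw := hf.partialD k
  have e1 : ∀ i, paraTerm χ φ a (dyadic φ j (partialD k f)) i -
      dyadic φ j (paraTerm χ φ a (partialD k f) i) =
      distMul (dyadic χ (i - 1) a) (dyadic φ j (dyadic φ i (partialD k f))) -
        dyadic φ j (distMul (dyadic χ (i - 1) a) (dyadic φ i (partialD k f))) := fun i ↦ by
    rw [paraTerm, paraTerm, dyadic_comm h.isCutoff_ann h.isCutoff_ann i j]
  rw [h.paraprod_dyadic ha.1 hw, h.dyadic_paraprod ha.1 hw, ← Finset.sum_sub_distrib]
  simp only [e1]
  refine (distLpNorm_sum_le hp _ _).trans ?_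
  rw [windowSum, Finset.mul_sum]
  refine Finset.sum_le_sum fun m hm ↦ ?_
  set i := j + m with hi
  have h1 := hC₁ p p₁ p₂ j _ _ _ _ hp hp₁ hpp (ha.dyadic h.isCutoff_low (i - 1))
    (hw.dyadic h.isCutoff_ann i)
  have h2 : ∑ l, distLpNorm p₁ (partialD l (dyadic χ (i - 1) a)) ≤ n * g i := by
    refine (Finset.sum_le_sum fun l _ ↦ ?_).trans_eq
      (by rw [Finset.sum_const, Finset.card_univ, Fintype.card_fin, nsmul_eq_mul])
    rw [partialD_dyadic h.isCutoff_low]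
    exact hg i l
  have h3 : (2 : ℝ≥0∞) ^ (-j) * 2 ^ i ≤ 2 ^ 4 := by
    rw [two_zpow_mul, ← zpow_natCast]
    rw [Finset.mem_Icc] at hm
    exact two_zpow_le (by push_cast; omega)
  refine h1.trans ?_
  calc C₁ * (2 : ℝ≥0∞) ^ (-j) * ((∑ l, distLpNorm p₁ (partialD l (dyadic χ (i - 1) a))) *
        distLpNorm p₂ (dyadic φ i (partialD k f)))
      ≤ C₁ * (2 : ℝ≥0∞) ^ (-j) * ((n * g i) * (C₂ * (2 : ℝ≥0∞) ^ i * distLpNorm p₂ (dyadic φ i f))) :=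
        mul_le_mul_right (mul_le_mul' h2 (hC₂ f K hf.1 i k)) _
    _ = C₁ * n * C₂ * ((2 : ℝ≥0∞) ^ (-j) * 2 ^ i) * (g i * distLpNorm p₂ (dyadic φ i f)) := by ring
    _ ≤ C₁ * n * C₂ * 2 ^ 4 * (g i * distLpNorm p₂ (dyadic φ i f)) :=
        mul_le_mul_left (mul_le_mul_right h3 _) _
    _ = _ := by push_cast; ring

/-- Ṡ_{i-1} annihilates Δ̇_j unless i ≥ j + 1. The derivative costs 2^j and the reverse Bernstein
inequality for a gains 2^{-i}, which leaves a kernel decaying like 2^{-(i-j)}. -/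
theorem IsDyadicPair.exists_para_low_high_le (h : IsDyadicPair χ φ) (hp : 1 ≤ p) (hp₁ : 1 ≤ p₁)
    (hp₂ : 1 ≤ p₂) (hpp : p⁻¹ = p₁⁻¹ + p₂⁻¹) :
    ∃ C : ℝ≥0, ∀ (a f : 𝓢'(Rn n, ℂ)) (A K : Rn n → ℂ), HasSpectrum₁ a A → HasSpectrum₁ f K →
      ∀ d : ℤ → ℝ≥0∞, (∀ j l, distLpNorm p₁ (dyadic φ j (partialD l a)) ≤ d j) →
      ∀ j k, distLpNorm p (paraprod χ φ (partialD k (dyadic φ j f)) a) ≤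
        C * (geomConv 1 1 1 d j * distLpNorm p₂ (dyadic φ j f)) := by
  obtain ⟨C₁, hC₁⟩ := h.isCutoff_low.exists_distLpNorm_dyadic_le
  obtain ⟨C₂, hC₂⟩ := h.exists_bernstein
  obtain ⟨C₃, hC₃⟩ := h.exists_dyadic_le_of_partialD_le hp₁
  refine ⟨C₁ * C₂ * C₃, fun a f A K ha hf d hd j k ↦ ?_⟩
  have hu := (hf.dyadic h.isCutoff_ann j).partialD k
  have hW := h.wienerSummable_paraTerm hu ha.1
  have hz : ∀ i, distLpNorm p (paraTerm χ φ (partialD k (dyadic φ j f)) a i) ≠ 0 → j + 1 ≤ i := by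
    intro i hi
    by_contra hne
    refine hi ?_
    rw [paraTerm, partialD_dyadic h.isCutoff_ann, h.low_dyadic_eq_zero (hf.partialD k) (by omega),
      HasSpectrum.zero_distMul (ha.1.dyadic h.isCutoff_ann _), distLpNorm_zero]
  refine (hW.distLpNorm_tsum_le hp).trans ?_
  rw [tsum_eq_tsum_nat hz, geomConv, ← ENNReal.tsum_mul_right, ← ENNReal.tsum_mul_left]
  refine ENNReal.tsum_le_tsum fun i ↦ ?_
  rw [show j + (1 + 1 * (i : ℤ)) = j + 1 + i by ring]
  set i' := j + 1 + (i : ℤ) with hi'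
  have h3 : (2 : ℝ≥0∞) ^ j * 2 ^ (-i') ≤ 2 ^ (-(1 * (i : ℤ))) := by
    rw [two_zpow_mul]
    exact two_zpow_le (by omega)
  refine (HasSpectrum.distLpNorm_distMul_le (hu.dyadic h.isCutoff_low _)
    (ha.1.dyadic h.isCutoff_ann _) (p₁ := p₂) (p₂ := p₁) (by rw [hpp, add_comm])).trans ?_
  calc _ ≤ (C₁ * (C₂ * (2 : ℝ≥0∞) ^ j * distLpNorm p₂ (dyadic φ j f))) *
        (C₃ * (2 : ℝ≥0∞) ^ (-i') * d i') :=
        mul_le_mul' ((hC₁ p₂ _ _ _ hp₂ hu).trans (mul_le_mul_right (hC₂ p₂ j k f K hp₂ hf.1) _))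
          (hC₃ a A ha d hd i')
    _ = C₁ * C₂ * C₃ * ((2 : ℝ≥0∞) ^ j * 2 ^ (-i')) * (d i' * distLpNorm p₂ (dyadic φ j f)) := by
        ring
    _ ≤ C₁ * C₂ * C₃ * 2 ^ (-(1 * (i : ℤ))) * (d i' * distLpNorm p₂ (dyadic φ j f)) :=
        mul_le_mul_left (mul_le_mul_right h3 _) _
    _ = _ := by push_cast; ring

/-- Ṡ_{j-1} is the sum of the blocks j - 2 - i with i ≥ 0, where the derivative costs only
2^{j-2-i}. -/
theorem IsDyadicPair.exists_low_partialD_le [NeZero n] (h : IsDyadicPair χ φ) (hp : 1 ≤ p) :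
    ∃ C : ℝ≥0, ∀ (f : 𝓢'(Rn n, ℂ)) (K : Rn n → ℂ), HasSpectrum₁ f K → ∀ j k,
      distLpNorm p (dyadic χ (j - 1) (partialD k f)) ≤
        C * (2 : ℝ≥0∞) ^ j * geomConv 1 (-2) (-1) (fun i ↦ distLpNorm p (dyadic φ i f)) j := by
  obtain ⟨C, hC⟩ := h.exists_dyadic_partialD_le hp
  refine ⟨C, fun f K hf j k ↦ (h.distLpNorm_low_le (hf.partialD k) hp _).trans ?_⟩
  rw [geomConv, ← ENNReal.tsum_mul_left]
  refine ENNReal.tsum_le_tsum fun i ↦ ?_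
  rw [show j + (-2 + -1 * (i : ℤ)) = j - 1 - 1 - i by ring]
  refine (hC f K hf.1 _ k).trans ?_
  rw [← mul_assoc, mul_assoc (C : ℝ≥0∞) (2 ^ j), two_zpow_mul]
  exact mul_le_mul_left (mul_le_mul_right (two_zpow_le (by omega)) _) _

/-- The cost 2^i of the low-frequency derivative and the gain 2^{-i} from the reverse Bernstein
inequality cancel exactly. -/
theorem IsDyadicPair.exists_dyadic_para_le [NeZero n] (h : IsDyadicPair χ φ) (hp : 1 ≤ p)
    (hp₁ : 1 ≤ p₁) (hp₂ : 1 ≤ p₂) (hpp : p⁻¹ = p₁⁻¹ + p₂⁻¹) :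
    ∃ C : ℝ≥0, ∀ (a f : 𝓢'(Rn n, ℂ)) (A K : Rn n → ℂ), HasSpectrum₁ a A → HasSpectrum₁ f K →
      ∀ d : ℤ → ℝ≥0∞, (∀ j l, distLpNorm p₁ (dyadic φ j (partialD l a)) ≤ d j) →
      ∀ j k, distLpNorm p (dyadic φ j (paraprod χ φ (partialD k f) a)) ≤
        C * windowSum (fun i ↦ d i *
          geomConv 1 (-2) (-1) (fun i ↦ distLpNorm p₂ (dyadic φ i f)) i) j := by
  obtain ⟨C₁, hC₁⟩ := h.isCutoff_ann.exists_distLpNorm_dyadic_le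
  obtain ⟨C₂, hC₂⟩ := h.exists_low_partialD_le hp₂
  obtain ⟨C₃, hC₃⟩ := h.exists_dyadic_le_of_partialD_le hp₁
  refine ⟨C₁ * C₂ * C₃, fun a f A K ha hf d hd j k ↦ ?_⟩
  have hu := hf.partialD k
  rw [h.dyadic_paraprod hu ha.1, windowSum, Finset.mul_sum]
  refine (distLpNorm_sum_le hp _ _).trans (Finset.sum_le_sum fun m _ ↦ ?_)
  set i := j + m
  set T := geomConv 1 (-2) (-1) (fun i ↦ distLpNorm p₂ (dyadic φ i f)) i
  refine (hC₁ p j _ _ hp ((h.wienerSummable_paraTerm hu ha.1).1 i)).trans ?_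
  have h1 := HasSpectrum.distLpNorm_distMul_le (hu.dyadic h.isCutoff_low (i - 1))
    (ha.1.dyadic h.isCutoff_ann i) (p := p) (p₁ := p₂) (p₂ := p₁) (by rw [hpp, add_comm])
  calc _ ≤ C₁ * ((C₂ * (2 : ℝ≥0∞) ^ i * T) * (C₃ * (2 : ℝ≥0∞) ^ (-i) * d i)) :=
        mul_le_mul_right (h1.trans (mul_le_mul' (hC₂ f K hf i k) (hC₃ a A ha d hd i))) _
    _ = C₁ * C₂ * C₃ * ((2 : ℝ≥0∞) ^ i * 2 ^ (-i)) * (d i * T) := by ring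
    _ = _ := by
      rw [two_zpow_mul, add_neg_cancel, zpow_zero, mul_one]
      push_cast
      rfl

theorem IsDyadicPair.exists_remainder_dyadic_le (h : IsDyadicPair χ φ) (hp : 1 ≤ p)
    (hp₁ : 1 ≤ p₁) (hp₂ : 1 ≤ p₂) (hpp : p⁻¹ = p₁⁻¹ + p₂⁻¹) :
    ∃ C : ℝ≥0, ∀ (a f : 𝓢'(Rn n, ℂ)) (A K : Rn n → ℂ), HasSpectrum₁ a A → HasSpectrum₁ f K →
      ∀ d : ℤ → ℝ≥0∞, (∀ j l, distLpNorm p₁ (dyadic φ j (partialD l a)) ≤ d j) →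
      ∀ j k, distLpNorm p (remainder φ a (partialD k (dyadic φ j f))) ≤
        C * (windowSum d j * distLpNorm p₂ (dyadic φ j f)) := by
  obtain ⟨C₁, hC₁⟩ := h.isCutoff_ann.exists_distLpNorm_dyadic_le
  obtain ⟨C₂, hC₂⟩ := h.exists_bernstein
  obtain ⟨C₃, hC₃⟩ := h.exists_dyadic_le_of_partialD_le hp₁
  -- 3 counts the shifts ν, and 2^4 bounds 2^{j-i} over the window.
  refine ⟨3 * C₁ * C₂ * C₃ * 2 ^ 4, fun a f A K ha hf d hd j k ↦ ?_⟩
  have hw := (hf.dyadic h.isCutoff_ann j).partialD k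
  have hz : ∀ i, remTerm φ a (partialD k (dyadic φ j f)) i ≠ 0 → i ≤ j + 4 ∧ j ≤ i + 4 := by
    intro i hi
    by_contra hne
    refine hi (Finset.sum_eq_zero fun ν hν ↦ ?_)
    rw [Finset.mem_Icc] at hν
    rw [partialD_dyadic h.isCutoff_ann, h.dyadic_dyadic_eq_zero (hf.partialD k) (by omega),
      HasSpectrum.distMul_zero (ha.1.dyadic h.isCutoff_ann _)]
  rw [remainder, tsum_eq_sum_window hz, windowSum, Finset.sum_mul, Finset.mul_sum]
  refine (distLpNorm_sum_le hp _ _).trans (Finset.sum_le_sum fun m hm ↦ ?_)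
  rw [Finset.mem_Icc] at hm
  refine (distLpNorm_sum_le hp _ _).trans ?_
  set i := j + m with hi
  have h3 : (2 : ℝ≥0∞) ^ j * 2 ^ (-i) ≤ 2 ^ 4 := by
    rw [two_zpow_mul, ← zpow_natCast]
    exact two_zpow_le (by push_cast; omega)
  have h1 : ∀ ν, distLpNorm p (distMul (dyadic φ i a)
      (dyadic φ (i - ν) (partialD k (dyadic φ j f)))) ≤
      (C₃ * (2 : ℝ≥0∞) ^ (-i) * d i) *
        (C₁ * (C₂ * (2 : ℝ≥0∞) ^ j * distLpNorm p₂ (dyadic φ j f))) := fun ν ↦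
    (HasSpectrum.distLpNorm_distMul_le (ha.1.dyadic h.isCutoff_ann _)
      (hw.dyadic h.isCutoff_ann _) hpp).trans
      (mul_le_mul' (hC₃ a A ha d hd i) ((hC₁ p₂ _ _ _ hp₂ hw).trans
        (mul_le_mul_right (hC₂ p₂ j k f K hp₂ hf.1) _)))
  refine (Finset.sum_le_sum fun ν _ ↦ h1 ν).trans ?_
  rw [Finset.sum_const, show (Finset.Icc (-1 : ℤ) 1).card = 3 from rfl, nsmul_eq_mul]
  calc _ = 3 * C₁ * C₂ * C₃ * ((2 : ℝ≥0∞) ^ j * 2 ^ (-i)) *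
        (d i * distLpNorm p₂ (dyadic φ j f)) := by push_cast; ring
    _ ≤ 3 * C₁ * C₂ * C₃ * 2 ^ 4 * (d i * distLpNorm p₂ (dyadic φ j f)) :=
        mul_le_mul_left (mul_le_mul_right h3 _) _
    _ = _ := by push_cast; ring

theorem IsDyadicPair.wienerSummable_dyadic (h : IsDyadicPair χ φ) {ι : Type*}
    {u : ι → 𝓢'(Rn n, ℂ)} {G : ι → Rn n → ℂ} (hu : WienerSummable u G) (j : ℤ) :
    WienerSummable (fun i ↦ dyadic φ j (u i)) (fun i ξ ↦ dyadicSymbol φ j ξ * G i ξ) :=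
  ⟨fun i ↦ (hu.1 i).dyadic h.isCutoff_ann j,
    Summable.of_nonneg_of_le (fun _ ↦ integral_nonneg fun _ ↦ norm_nonneg _)
      (fun i ↦ h.integral_norm_ann_le (hu.1 i).1 j) hu.2⟩

/-- Every block with i ≥ j - 3 can feed frequency 2^j, and nothing decays in i - j; hence κ = 0, and
summability must come from the regularity s or from an extra derivative. -/
theorem IsDyadicPair.exists_dyadic_remainder_le (h : IsDyadicPair χ φ) (hp : 1 ≤ p)
    (hpp : p⁻¹ = p₁⁻¹ + p₂⁻¹) :
    ∃ C : ℝ≥0, ∀ (a f : 𝓢'(Rn n, ℂ)) (A K : Rn n → ℂ), HasSpectrum a A → HasSpectrum f K → ∀ j,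
      distLpNorm p (dyadic φ j (remainder φ a f)) ≤
        C * geomConv 0 (-3) 1 (fun i ↦ distLpNorm p₁ (dyadic φ i a) *
          windowSum (fun i ↦ distLpNorm p₂ (dyadic φ i f)) i) j := by
  obtain ⟨C₁, hC₁⟩ := h.isCutoff_ann.exists_distLpNorm_dyadic_le
  refine ⟨C₁, fun a f A K ha hf j ↦ ?_⟩
  have hW := h.wienerSummable_remTerm ha hf
  have hW' := h.wienerSummable_dyadic hW j
  have hz : ∀ i, distLpNorm p (dyadic φ j (remTerm φ a f i)) ≠ 0 → j - 3 ≤ i := by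
    intro i hi
    by_contra hne
    refine hi ?_
    rw [remTerm, dyadic_eq, map_sum, Finset.sum_eq_zero, distLpNorm_zero]
    intro ν hν
    refine HasSpectrum.dyadic_distMul_eq_zero h.isCutoff_ann j (ha.dyadic h.isCutoff_ann _)
      (hf.dyadic h.isCutoff_ann _) fun ξ η hξ hη ↦ ?_
    by_contra h0
    have := h.symbol_rem hν (left_ne_zero_of_mul hξ) (left_ne_zero_of_mul hη) h0
    omega
  rw [remainder, dyadic_tsum φ j hW.summable]
  refine (hW'.distLpNorm_tsum_le hp).trans ?_
  rw [tsum_eq_tsum_nat hz, geomConv, ← ENNReal.tsum_mul_left]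
  refine ENNReal.tsum_le_tsum fun i ↦ ?_
  rw [show j + (-3 + 1 * (i : ℤ)) = j - 3 + i by ring]
  set i' := j - 3 + (i : ℤ)
  refine (hC₁ p j _ _ hp (hW.1 i')).trans (mul_le_mul_right ?_ _)
  rw [zero_mul, neg_zero, zpow_zero, one_mul, windowSum, Finset.mul_sum]
  refine (distLpNorm_sum_le hp _ _).trans ?_
  refine (Finset.sum_le_sum fun ν _ ↦ HasSpectrum.distLpNorm_distMul_le
    (ha.dyadic h.isCutoff_ann i') (hf.dyadic h.isCutoff_ann (i' - ν)) hpp).trans ?_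
  -- The window is symmetric, so ν may be replaced by -ν before enlarging it to radius 4.
  have e : ∑ ν ∈ Finset.Icc (-1 : ℤ) 1, distLpNorm p₁ (dyadic φ i' a) *
      distLpNorm p₂ (dyadic φ (i' - ν) f) = ∑ ν ∈ Finset.Icc (-1 : ℤ) 1,
      distLpNorm p₁ (dyadic φ i' a) * distLpNorm p₂ (dyadic φ (i' + ν) f) :=
    Finset.sum_nbij' (fun ν ↦ -ν) (fun ν ↦ -ν) (by simp; omega) (by simp; omega) (by simp)
      (by simp) (by simp [sub_eq_add_neg])
  rw [e]
  exact Finset.sum_le_sum_of_subset (Finset.Icc_subset_Icc (by norm_num) (by norm_num))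

end Pointwise

end LittlewoodPaley

namespace LittlewoodPaley

variable {n : ℕ} {χ φ : Rn n → ℝ} {p p₁ p₂ : ℝ≥0∞}

/-! ### Besov estimates of R^1, ..., R^6 -/

section Estimates

theorem distLpNorm_sum_fin_le (hp : 1 ≤ p) {u : Fin n → 𝓢'(Rn n, ℂ)} {X : ℝ≥0∞}
    (h : ∀ k, distLpNorm p (u k) ≤ X) : distLpNorm p (∑ k, u k) ≤ n * X := by
  refine (distLpNorm_sum_le hp _ _).trans ((Finset.sum_le_sum fun k _ ↦ h k).trans_eq ?_)
  rw [Finset.sum_const, Finset.card_univ, Fintype.card_fin, nsmul_eq_mul]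

theorem seqNorm_le_of_le {q : ℝ≥0∞} (hq : 2⁻¹ ≤ q) {s : ℝ} {C K : ℝ≥0} {B : ℝ≥0∞}
    {u : ℤ → 𝓢'(Rn n, ℂ)} {X : ℤ → ℝ≥0∞} (h : ∀ j, distLpNorm p (u j) ≤ n * (C * X j))
    (hX : weightedNorm s q X ≤ K * B) : seqNorm s p q u ≤ (n * C * K : ℝ≥0) * B := by
  calc seqNorm s p q u ≤ weightedNorm s q (fun j ↦ (n * C : ℝ≥0) * X j) :=
        weightedNorm_mono fun j ↦ (h j).trans_eq (by push_cast; ring)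
    _ = (n * C : ℝ≥0) * weightedNorm s q X := weightedNorm_const_mul (ne_zero_of_half_le hq) _ _ _
    _ ≤ (n * C : ℝ≥0) * (K * B) := mul_le_mul_right hX _
    _ = _ := by push_cast; ring

theorem half_le_of_one_le {q : ℝ≥0∞} (hq : 1 ≤ q) : 2⁻¹ ≤ q :=
  (ENNReal.inv_le_one.2 one_le_two).trans hq

/-- The estimate `‖R‖ ≤ C ‖∇v‖ ‖f‖` of a family `R_j(v, f)`, uniformly in `v`, `f` and the
summation exponents. -/
def BesovBound (φ : Rn n → ℝ) (s₁ s₂ : ℝ) (p p₁ p₂ : ℝ≥0∞)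
    (R : 𝓢'(Rn n, EuclideanSpace ℂ (Fin n)) → 𝓢'(Rn n, ℂ) → ℤ → 𝓢'(Rn n, ℂ)) (C : ℝ≥0) : Prop :=
  ∀ q q₁ q₂ : ℝ≥0∞, 1 ≤ q₁ → 1 ≤ q₂ → q⁻¹ = q₁⁻¹ + q₂⁻¹ →
    ∀ (v : 𝓢'(Rn n, EuclideanSpace ℂ (Fin n))) (f : 𝓢'(Rn n, ℂ)),
      MemHdotInter v → MemHdotInter f → seqNorm (s₁ + s₂) p q (R v f) ≤
        C * (besovNorm φ s₁ p₁ q₁ (gradVec v) * besovNorm φ s₂ p₂ q₂ f)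

/-- A pointwise bound whose majorant is estimated in the weighted sequence space gives a bound in
Besov spaces. -/
theorem BesovBound.of_pointwise (hp : 1 ≤ p) {s₁ s₂ : ℝ}
    {R : 𝓢'(Rn n, EuclideanSpace ℂ (Fin n)) → 𝓢'(Rn n, ℂ) → ℤ → 𝓢'(Rn n, ℂ)}
    {T : Fin n → 𝓢'(Rn n, EuclideanSpace ℂ (Fin n)) → 𝓢'(Rn n, ℂ) → ℤ → 𝓢'(Rn n, ℂ)}
    (hR : ∀ v f j, R v f j = ∑ k, T k v f j) (X : (ℤ → ℝ≥0∞) → (ℤ → ℝ≥0∞) → ℤ → ℝ≥0∞)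
    {C K : ℝ≥0}
    (hT : ∀ v f, MemHdotInter v → MemHdotInter f → ∀ k j, distLpNorm p (T k v f j) ≤
      C * X (fun j ↦ distLpNorm p₁ (dyadic φ j (gradVec v)))
        (fun j ↦ distLpNorm p₂ (dyadic φ j f)) j)
    (hX : ∀ q q₁ q₂ : ℝ≥0∞, 2⁻¹ ≤ q → 2⁻¹ ≤ q₁ → 2⁻¹ ≤ q₂ →
      (∀ d e, weightedNorm (s₁ + s₂) q (fun j ↦ d j * e j) ≤
        weightedNorm s₁ q₁ d * weightedNorm s₂ q₂ e) →
      ∀ d e, weightedNorm (s₁ + s₂) q (X d e) ≤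
        K * (weightedNorm s₁ q₁ d * weightedNorm s₂ q₂ e)) :
    BesovBound φ s₁ s₂ p p₁ p₂ R (n * C * K) := by
  intro q q₁ q₂ hq₁ hq₂ hq v f hv hf
  refine seqNorm_le_of_le (half_le_of_inv_eq hq₁ hq₂ hq) (fun j ↦ ?_)
    (hX q q₁ q₂ (half_le_of_inv_eq hq₁ hq₂ hq) (half_le_of_one_le hq₁) (half_le_of_one_le hq₂)
      (weightedNorm_mul_le hq₁ hq₂ hq s₁ s₂)
      (fun j ↦ distLpNorm p₁ (dyadic φ j (gradVec v))) fun j ↦ distLpNorm p₂ (dyadic φ j f))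
  rw [hR]
  exact distLpNorm_sum_fin_le hp fun k ↦ hT v f hv hf k j

/-- The majorant of the low-frequency gradient is a constant multiple of ‖∇v‖_{L^{p₁}}, independent
of the index, so only a window sum in f remains. -/
theorem IsDyadicPair.exists_R1_le_lp (h : IsDyadicPair χ φ) (hp : 1 ≤ p) (hp₁ : 1 ≤ p₁)
    (hp₂ : 1 ≤ p₂) (hpp : p⁻¹ = p₁⁻¹ + p₂⁻¹) (s : ℝ) : ∃ C : ℝ≥0, ∀ q : ℝ≥0∞, 2⁻¹ ≤ q →
      ∀ (v : 𝓢'(Rn n, EuclideanSpace ℂ (Fin n))) (f : 𝓢'(Rn n, ℂ)),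
        MemHdotInter v → MemHdotInter f → seqNorm s p q (R1 χ φ v f) ≤
          C * (distLpNorm p₁ (gradVec v) * besovNorm φ s p₂ q f) := by
  obtain ⟨C, hC⟩ := h.exists_para_commutator_le hp hp₁ hp₂ hpp
  obtain ⟨L, hL⟩ := h.isCutoff_low.exists_distLpNorm_dyadic_le
  obtain ⟨K, hK⟩ := exists_weightedNorm_window_le s
  refine ⟨n * C * (K * L), fun q hq v f hv hf ↦ ?_⟩
  obtain ⟨F, hF⟩ := hf.exists_hasSpectrum₁
  refine seqNorm_le_of_le hq (X := windowSum fun i ↦ (L * distLpNorm p₁ (gradVec v)) *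
    distLpNorm p₂ (dyadic φ i f)) (fun j ↦ distLpNorm_sum_fin_le hp fun k ↦ ?_) ?_
  · obtain ⟨V, hV⟩ := hv.exists_hasSpectrum₁_component k
    exact hC _ _ _ _ hV hF _ (fun i l ↦ (hL p₁ _ _ _ hp₁ (hV.partialD l)).trans
      (mul_le_mul_right (distLpNorm_partialD_component_le p₁ v l k) _)) j k
  · refine (hK q hq _).trans_eq ?_
    rw [weightedNorm_const_mul (ne_zero_of_half_le hq)]
    simp only [besovNorm, seqNorm, weightedNorm, lqNorm]
    push_cast
    ring

/-- The low-frequency gradient is now summed over all lower blocks, without decay; the weight makes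
this sum converge when s₁ < 0. -/
theorem IsDyadicPair.exists_R1_le [NeZero n] (h : IsDyadicPair χ φ) (hp : 1 ≤ p) (hp₁ : 1 ≤ p₁)
    (hp₂ : 1 ≤ p₂) (hpp : p⁻¹ = p₁⁻¹ + p₂⁻¹) {s₁ : ℝ} (s₂ : ℝ) (hs : s₁ < 0) :
    ∃ C : ℝ≥0, BesovBound φ s₁ s₂ p p₁ p₂ (R1 χ φ) C := by
  obtain ⟨C, hC⟩ := h.exists_para_commutator_le hp hp₁ hp₂ hpp
  obtain ⟨K, hK⟩ := exists_weightedNorm_window_le (s₁ + s₂)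
  obtain ⟨L, hL⟩ := exists_weightedNorm_conv_le (s := s₁) (κ := 0) (ε := -1) (-2)
    (by push_cast; linarith)
  refine ⟨_, BesovBound.of_pointwise hp (fun _ _ _ ↦ rfl)
    (fun d e ↦ windowSum fun i ↦ geomConv 0 (-2) (-1) d i * e i) (C := C) (K := K * L)
    (fun v f hv hf k j ↦ ?_) fun q q₁ q₂ hq hq₁ hq₂ hm d e ↦ ?_⟩
  · obtain ⟨F, hF⟩ := hf.exists_hasSpectrum₁
    obtain ⟨V, hV⟩ := hv.exists_hasSpectrum₁_component k
    refine hC _ _ _ _ hV hF _ (fun i l ↦ (h.distLpNorm_low_le (hV.partialD l) hp₁ _).trans ?_) j k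
    rw [geomConv]
    refine ENNReal.tsum_le_tsum fun m ↦ ?_
    rw [zero_mul, neg_zero, zpow_zero, one_mul, show i + (-2 + -1 * (m : ℤ)) = i - 1 - 1 - m by ring]
    exact distLpNorm_dyadic_partialD_component_le φ _ p₁ v l k
  · calc _ ≤ K * (weightedNorm s₁ q₁ (geomConv 0 (-2) (-1) d) * weightedNorm s₂ q₂ e) :=
          (hK q hq _).trans (mul_le_mul_right (hm _ _) _)
      _ ≤ K * ((L * weightedNorm s₁ q₁ d) * weightedNorm s₂ q₂ e) :=
          mul_le_mul_right (mul_le_mul_left (hL q₁ hq₁ d) _) _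
      _ = _ := by push_cast; ring

theorem IsDyadicPair.exists_R2_le (h : IsDyadicPair χ φ) (hp : 1 ≤ p) (hp₁ : 1 ≤ p₁)
    (hp₂ : 1 ≤ p₂) (hpp : p⁻¹ = p₁⁻¹ + p₂⁻¹) {s₁ : ℝ} (s₂ : ℝ) (hs : -1 < s₁) :
    ∃ C : ℝ≥0, BesovBound φ s₁ s₂ p p₁ p₂ (R2 χ φ) C := by
  obtain ⟨C, hC⟩ := h.exists_para_low_high_le hp hp₁ hp₂ hpp
  obtain ⟨L, hL⟩ := exists_weightedNorm_conv_le (s := s₁) (κ := 1) (ε := 1) 1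
    (by push_cast; linarith)
  refine ⟨_, BesovBound.of_pointwise hp (fun _ _ _ ↦ rfl)
    (fun d e j ↦ geomConv 1 1 1 d j * e j) (C := C) (K := L)
    (fun v f hv hf k j ↦ ?_) fun q q₁ q₂ hq hq₁ hq₂ hm d e ↦ ?_⟩
  · obtain ⟨F, hF⟩ := hf.exists_hasSpectrum₁
    obtain ⟨V, hV⟩ := hv.exists_hasSpectrum₁_component k
    exact hC _ _ _ _ hV hF _
      (fun i l ↦ distLpNorm_dyadic_partialD_component_le φ i p₁ v l k) j k
  · refine (hm _ _).trans ?_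
    rw [← mul_assoc]
    exact mul_le_mul_left (hL q₁ hq₁ d) _

theorem IsDyadicPair.exists_R3_le [NeZero n] (h : IsDyadicPair χ φ) (hp : 1 ≤ p) (hp₁ : 1 ≤ p₁)
    (hp₂ : 1 ≤ p₂) (hpp : p⁻¹ = p₁⁻¹ + p₂⁻¹) (s₁ : ℝ) {s₂ : ℝ} (hs : s₂ < 1) :
    ∃ C : ℝ≥0, BesovBound φ s₁ s₂ p p₁ p₂ (R3 χ φ) C := by
  obtain ⟨C, hC⟩ := h.exists_dyadic_para_le hp hp₁ hp₂ hpp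
  obtain ⟨K, hK⟩ := exists_weightedNorm_window_le (s₁ + s₂)
  obtain ⟨L, hL⟩ := exists_weightedNorm_conv_le (s := s₂) (κ := 1) (ε := -1) (-2)
    (by push_cast; linarith)
  refine ⟨_, BesovBound.of_pointwise hp (fun _ _ _ ↦ rfl)
    (fun d e ↦ windowSum fun i ↦ d i * geomConv 1 (-2) (-1) e i) (C := C) (K := K * L)
    (fun v f hv hf k j ↦ ?_) fun q q₁ q₂ hq hq₁ hq₂ hm d e ↦ ?_⟩
  · obtain ⟨F, hF⟩ := hf.exists_hasSpectrum₁
    obtain ⟨V, hV⟩ := hv.exists_hasSpectrum₁_component k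
    have hW : HasSpectrum (paraprod χ φ (partialD k f) (component v k)) _ :=
      (h.wienerSummable_paraTerm (hF.partialD k) hV.1).hasSpectrum_tsum
    rw [distLpNorm_neg p _ ⟨_, hW.dyadic h.isCutoff_ann j⟩]
    exact hC _ _ _ _ hV hF _
      (fun i l ↦ distLpNorm_dyadic_partialD_component_le φ i p₁ v l k) j k
  · calc _ ≤ K * (weightedNorm s₁ q₁ d * weightedNorm s₂ q₂ (geomConv 1 (-2) (-1) e)) :=
          (hK q hq _).trans (mul_le_mul_right (hm _ _) _)
      _ ≤ K * (weightedNorm s₁ q₁ d * (L * weightedNorm s₂ q₂ e)) :=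
          mul_le_mul_right (mul_le_mul_right (hL q₂ hq₂ e) _) _
      _ = _ := by push_cast; ring

theorem IsDyadicPair.exists_R4_le (h : IsDyadicPair χ φ) (hp : 1 ≤ p) (hp₁ : 1 ≤ p₁)
    (hp₂ : 1 ≤ p₂) (hpp : p⁻¹ = p₁⁻¹ + p₂⁻¹) (s₁ s₂ : ℝ) :
    ∃ C : ℝ≥0, BesovBound φ s₁ s₂ p p₁ p₂ (R4 φ) C := by
  obtain ⟨C, hC⟩ := h.exists_remainder_dyadic_le hp hp₁ hp₂ hpp
  obtain ⟨L, hL⟩ := exists_weightedNorm_window_le s₁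
  refine ⟨_, BesovBound.of_pointwise hp (fun _ _ _ ↦ rfl)
    (fun d e j ↦ windowSum d j * e j) (C := C) (K := L)
    (fun v f hv hf k j ↦ ?_) fun q q₁ q₂ hq hq₁ hq₂ hm d e ↦ ?_⟩
  · obtain ⟨F, hF⟩ := hf.exists_hasSpectrum₁
    obtain ⟨V, hV⟩ := hv.exists_hasSpectrum₁_component k
    exact hC _ _ _ _ hV hF _
      (fun i l ↦ distLpNorm_dyadic_partialD_component_le φ i p₁ v l k) j k
  · refine (hm _ _).trans ?_
    rw [← mul_assoc]
    exact mul_le_mul_left (hL q₁ hq₁ d) _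

theorem geomConv_mono {κ c ε : ℤ} {a b : ℤ → ℝ≥0∞} (h : ∀ i, a i ≤ b i) (j : ℤ) :
    geomConv κ c ε a j ≤ geomConv κ c ε b j :=
  ENNReal.tsum_le_tsum fun _ ↦ mul_le_mul_right (h _) _

/-- The geometric mean of a product with a window sum, the majorant of the remainder terms. -/
theorem exists_weightedNorm_conv_mul_window_le {s₁ s₂ : ℝ} {κ : ℤ} (c : ℤ)
    (hs : 0 < κ + (s₁ + s₂)) : ∃ K : ℝ≥0, ∀ q q₁ q₂ : ℝ≥0∞, 2⁻¹ ≤ q → 2⁻¹ ≤ q₁ → 2⁻¹ ≤ q₂ →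
      (∀ d e, weightedNorm (s₁ + s₂) q (fun j ↦ d j * e j) ≤
        weightedNorm s₁ q₁ d * weightedNorm s₂ q₂ e) →
      ∀ d e, weightedNorm (s₁ + s₂) q (geomConv κ c 1 fun i ↦ d i * windowSum e i) ≤
        K * (weightedNorm s₁ q₁ d * weightedNorm s₂ q₂ e) := by
  obtain ⟨K, hK⟩ := exists_weightedNorm_window_le s₂
  obtain ⟨L, hL⟩ := exists_weightedNorm_conv_le (s := s₁ + s₂) (κ := κ) (ε := 1) c
    (by push_cast; linarith)
  refine ⟨L * K, fun q q₁ q₂ hq _ hq₂ hm d e ↦ ?_⟩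
  calc _ ≤ L * (weightedNorm s₁ q₁ d * weightedNorm s₂ q₂ (windowSum e)) :=
        (hL q hq _).trans (mul_le_mul_right (hm _ _) _)
    _ ≤ L * (weightedNorm s₁ q₁ d * (K * weightedNorm s₂ q₂ e)) :=
        mul_le_mul_right (mul_le_mul_right (hK q₂ hq₂ e) _) _
    _ = _ := by push_cast; ring

/-- The outer derivative costs 2^j and trading v_k for ∇v in block i gains 2^{-i}, so the kernel
improves from κ = 0 to κ = 1. -/
theorem IsDyadicPair.exists_R5_le (h : IsDyadicPair χ φ) (hp : 1 ≤ p) (hp₁ : 1 ≤ p₁)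
    (hpp : p⁻¹ = p₁⁻¹ + p₂⁻¹) {s₁ s₂ : ℝ} (hs : -1 < s₁ + s₂) :
    ∃ C : ℝ≥0, BesovBound φ s₁ s₂ p p₁ p₂ (R5 φ) C := by
  obtain ⟨C₁, hC₁⟩ := h.exists_dyadic_remainder_le hp hpp
  obtain ⟨C₂, hC₂⟩ := h.exists_bernstein
  obtain ⟨C₃, hC₃⟩ := h.exists_dyadic_le_of_partialD_le hp₁
  obtain ⟨K, hK⟩ := exists_weightedNorm_conv_mul_window_le (s₁ := s₁) (s₂ := s₂) (κ := 1) (-3)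
    (by push_cast; linarith)
  refine ⟨_, BesovBound.of_pointwise hp (fun _ _ _ ↦ rfl)
    (fun d e ↦ geomConv 1 (-3) 1 fun i ↦ d i * windowSum e i) (C := C₁ * C₂ * C₃ * 2 ^ 3) (K := K)
    (fun v f hv hf k j ↦ ?_) hK⟩
  obtain ⟨F, hF⟩ := hf.exists_hasSpectrum₁
  obtain ⟨V, hV⟩ := hv.exists_hasSpectrum₁_component k
  have hW : HasSpectrum (remainder φ (component v k) f) _ :=
    (h.wienerSummable_remTerm hV.1 hF.1).hasSpectrum_tsum
  rw [distLpNorm_neg p _ ⟨_, (hW.dyadic₁ h.isCutoff_ann j).partialD k⟩]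
  refine (hC₂ p j k _ _ hp hW).trans ((mul_le_mul_right (hC₁ _ _ _ _ hV.1 hF.1 j) _).trans ?_)
  simp only [geomConv]
  rw [← ENNReal.tsum_mul_left, ← ENNReal.tsum_mul_left, ← ENNReal.tsum_mul_left]
  refine ENNReal.tsum_le_tsum fun m ↦ ?_
  set i := j + (-3 + 1 * (m : ℤ)) with hi
  rw [zero_mul, neg_zero, zpow_zero, one_mul]
  set T := windowSum (fun i ↦ distLpNorm p₂ (dyadic φ i f)) i
  set D := distLpNorm p₁ (dyadic φ i (gradVec v))
  have h1 := hC₃ _ _ hV (fun j ↦ distLpNorm p₁ (dyadic φ j (gradVec v)))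
    (fun i l ↦ distLpNorm_dyadic_partialD_component_le φ i p₁ v l k) i
  -- The factor 2^3 reflects that the sum starts at i = j - 3.
  have h3 : (2 : ℝ≥0∞) ^ j * 2 ^ (-i) = 2 ^ 3 * 2 ^ (-(1 * (m : ℤ))) := by
    rw [two_zpow_mul, ← zpow_natCast, two_zpow_mul]
    congr 1
    push_cast
    omega
  calc C₂ * (2 : ℝ≥0∞) ^ j * (C₁ * (distLpNorm p₁ (dyadic φ i (component v k)) * T))
      ≤ C₂ * (2 : ℝ≥0∞) ^ j * (C₁ * ((C₃ * (2 : ℝ≥0∞) ^ (-i) * D) * T)) :=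
        mul_le_mul_right (mul_le_mul_right (mul_le_mul_left h1 _) _) _
    _ = C₁ * C₂ * C₃ * ((2 : ℝ≥0∞) ^ j * 2 ^ (-i)) * (D * T) := by ring
    _ = _ := by
      rw [h3]
      push_cast
      ring

theorem IsDyadicPair.exists_R6_le (h : IsDyadicPair χ φ) (hp : 1 ≤ p)
    (hpp : p⁻¹ = p₁⁻¹ + p₂⁻¹) {s₁ s₂ : ℝ} (hs : 0 < s₁ + s₂) :
    ∃ C : ℝ≥0, BesovBound φ s₁ s₂ p p₁ p₂ (R6 φ) C := by
  obtain ⟨C, hC⟩ := h.exists_dyadic_remainder_le hp hpp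
  obtain ⟨K, hK⟩ := exists_weightedNorm_conv_mul_window_le (s₁ := s₁) (s₂ := s₂) (κ := 0) (-3)
    (by push_cast; linarith)
  refine ⟨_, BesovBound.of_pointwise hp (fun _ _ _ ↦ rfl)
    (fun d e ↦ geomConv 0 (-3) 1 fun i ↦ d i * windowSum e i) (C := C) (K := K)
    (fun v f hv hf k j ↦ ?_) hK⟩
  obtain ⟨F, hF⟩ := hf.exists_hasSpectrum₁
  obtain ⟨V, hV⟩ := hv.exists_hasSpectrum₁_component k
  refine (hC _ _ _ _ (hV.partialD k) hF.1 j).trans (mul_le_mul_right ?_ _)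
  exact geomConv_mono (fun i ↦ mul_le_mul_left
    (distLpNorm_dyadic_partialD_component_le φ i p₁ v k k) _) j

theorem BesovBound.mono {s₁ s₂ : ℝ}
    {R : 𝓢'(Rn n, EuclideanSpace ℂ (Fin n)) → 𝓢'(Rn n, ℂ) → ℤ → 𝓢'(Rn n, ℂ)} {C C' : ℝ≥0}
    (h : BesovBound φ s₁ s₂ p p₁ p₂ R C) (hC : C ≤ C') : BesovBound φ s₁ s₂ p p₁ p₂ R C' :=
  fun q q₁ q₂ hq₁ hq₂ hq v f hv hf ↦ (h q q₁ q₂ hq₁ hq₂ hq v f hv hf).trans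
    (mul_le_mul_left (ENNReal.coe_le_coe.2 hC) _)

/-- The conditions on s₁, s₂, s involve neither q nor v, f, so each constant can be fixed before
those; if the condition fails, any value will do. -/
theorem exists_imp_of_imp_exists {P : Prop} {Q : ℝ≥0 → Prop} (h : P → ∃ C, Q C) :
    ∃ C, P → Q C := by
  by_cases hP : P
  · obtain ⟨C, hC⟩ := h hP
    exact ⟨C, fun _ ↦ hC⟩
  · exact ⟨0, fun h ↦ (hP h).elim⟩

theorem seqNorm_zero (s : ℝ) (p q : ℝ≥0∞) : seqNorm s p q (fun _ ↦ (0 : 𝓢'(Rn n, ℂ))) = 0 := by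
  simp [seqNorm, distLpNorm_zero]

end Estimates

end LittlewoodPaley

end

theorem proposition3p1 (n : ℕ) (χ φ : Rn n → ℝ) (hχφ : IsDyadicPair χ φ) :
    (∀ (v : 𝓢'(Rn n, EuclideanSpace ℂ (Fin n))) (f : 𝓢'(Rn n, ℂ)),
      MemHdotInter v → MemHdotInter f → ∀ j : ℤ,
        AllDefined χ φ v f j ∧
        commTerm φ v f j =
          R1 χ φ v f j + R2 χ φ v f j + R3 χ φ v f j + R4 φ v f j + R5 φ v f j + R6 φ v f j) ∧
    (∀ (s s₁ s₂ : ℝ) (p p₁ p₂ : ℝ≥0∞), s = s₁ + s₂ → 1 ≤ p₁ → 1 ≤ p₂ → 1 ≤ p →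
      p⁻¹ = p₁⁻¹ + p₂⁻¹ →
      ∃ C : ℝ≥0, ∀ q q₁ q₂ : ℝ≥0∞, 1 ≤ q₁ → 1 ≤ q₂ → q⁻¹ = q₁⁻¹ + q₂⁻¹ →
        ∀ (v : 𝓢'(Rn n, EuclideanSpace ℂ (Fin n))) (f : 𝓢'(Rn n, ℂ)),
          MemHdotInter v → MemHdotInter f →
          seqNorm s p q (R1 χ φ v f) ≤
            C * (distLpNorm p₁ (gradVec v) * besovNorm φ s p₂ q f) ∧
          (s₁ < 0 → seqNorm s p q (R1 χ φ v f) ≤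
            C * (besovNorm φ s₁ p₁ q₁ (gradVec v) * besovNorm φ s₂ p₂ q₂ f)) ∧
          (-1 < s₁ → seqNorm s p q (R2 χ φ v f) ≤
            C * (besovNorm φ s₁ p₁ q₁ (gradVec v) * besovNorm φ s₂ p₂ q₂ f)) ∧
          (s₂ < 1 → seqNorm s p q (R3 χ φ v f) ≤
            C * (besovNorm φ s₁ p₁ q₁ (gradVec v) * besovNorm φ s₂ p₂ q₂ f)) ∧
          seqNorm s p q (R4 φ v f) ≤
            C * (besovNorm φ s₁ p₁ q₁ (gradVec v) * besovNorm φ s₂ p₂ q₂ f) ∧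
          (-1 < s → seqNorm s p q (R5 φ v f) ≤
            C * (besovNorm φ s₁ p₁ q₁ (gradVec v) * besovNorm φ s₂ p₂ q₂ f)) ∧
          (0 < s → seqNorm s p q (R6 φ v f) ≤
            C * (besovNorm φ s₁ p₁ q₁ (gradVec v) * besovNorm φ s₂ p₂ q₂ f))) := by
  refine ⟨fun v f hv hf j ↦ ⟨hχφ.allDefined hv hf j, hχφ.commTerm_eq hv hf j⟩, ?_⟩
  rintro s s₁ s₂ p p₁ p₂ rfl hp₁ hp₂ hp hpp
  -- In dimension 0 the almost-everywhere partition of unity is unavailable, but every R_j^i is an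
  -- empty sum over k.
  rcases eq_or_ne n 0 with rfl | hn
  · refine ⟨0, fun q q₁ q₂ _ _ _ v f _ _ ↦ ?_⟩
    have h (u : ℤ → 𝓢'(Rn 0, ℂ)) (hu : ∀ j, u j = 0) (B : ℝ≥0∞) :
        seqNorm (s₁ + s₂) p q u ≤ B := by
      rw [funext hu, seqNorm_zero]
      exact zero_le
    exact ⟨h _ (fun _ ↦ rfl) _, fun _ ↦ h _ (fun _ ↦ rfl) _, fun _ ↦ h _ (fun _ ↦ rfl) _,
      fun _ ↦ h _ (fun _ ↦ rfl) _, h _ (fun _ ↦ rfl) _, fun _ ↦ h _ (fun _ ↦ rfl) _,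
      fun _ ↦ h _ (fun _ ↦ rfl) _⟩
  have : NeZero n := ⟨hn⟩
  obtain ⟨C₀, h₀⟩ := hχφ.exists_R1_le_lp hp hp₁ hp₂ hpp (s₁ + s₂)
  obtain ⟨C₁, h₁⟩ := exists_imp_of_imp_exists (hχφ.exists_R1_le hp hp₁ hp₂ hpp (s₁ := s₁) s₂)
  obtain ⟨C₂, h₂⟩ := exists_imp_of_imp_exists (hχφ.exists_R2_le hp hp₁ hp₂ hpp (s₁ := s₁) s₂)
  obtain ⟨C₃, h₃⟩ := exists_imp_of_imp_exists (hχφ.exists_R3_le hp hp₁ hp₂ hpp s₁ (s₂ := s₂))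
  obtain ⟨C₄, h₄⟩ := hχφ.exists_R4_le hp hp₁ hp₂ hpp s₁ s₂
  obtain ⟨C₅, h₅⟩ := exists_imp_of_imp_exists (hχφ.exists_R5_le hp hp₁ hpp (s₁ := s₁) (s₂ := s₂))
  obtain ⟨C₆, h₆⟩ := exists_imp_of_imp_exists (hχφ.exists_R6_le hp hpp (s₁ := s₁) (s₂ := s₂))
  -- The sum of the seven constants dominates each of them and serves all the estimates.
  let c : Fin 7 → ℝ≥0 := ![C₀, C₁, C₂, C₃, C₄, C₅, C₆]
  have hc (i : Fin 7) : c i ≤ ∑ i, c i := Finset.single_le_sum_of_canonicallyOrdered (Finset.mem_univ i)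
  refine ⟨∑ i, c i, fun q q₁ q₂ hq₁ hq₂ hq v f hv hf ↦ ?_⟩
  exact ⟨(h₀ q (half_le_of_inv_eq hq₁ hq₂ hq) v f hv hf).trans
      (mul_le_mul_left (ENNReal.coe_le_coe.2 (hc 0)) _),
    fun hs ↦ (h₁ hs).mono (hc 1) q q₁ q₂ hq₁ hq₂ hq v f hv hf,
    fun hs ↦ (h₂ hs).mono (hc 2) q q₁ q₂ hq₁ hq₂ hq v f hv hf,
    fun hs ↦ (h₃ hs).mono (hc 3) q q₁ q₂ hq₁ hq₂ hq v f hv hf,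
    h₄.mono (hc 4) q q₁ q₂ hq₁ hq₂ hq v f hv hf,
    fun hs ↦ (h₅ hs).mono (hc 5) q q₁ q₂ hq₁ hq₂ hq v f hv hf,
    fun hs ↦ (h₆ hs).mono (hc 6) q q₁ q₂ hq₁ hq₂ hq v f hv hf⟩
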